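/- **Setting.** Let $\Lambda$ be a ring with $1$ and involution $x\mapsto\bar x$ which is weakly finite ($\Lambda^n\cong\Lambda^n\oplus K$ implies $K=0$). Let $S\subset\Lambda$ be a central multiplicative subset: a submonoid, closed under the involution, of central non-zero-divisors. Let $q\ge 0$ and $\epsilon=(-1)^q$. Modules are left modules, $M^*=\mathrm{Hom}_\Lambda(M,\Lambda)$ with $(af)(x)=f(x)\bar a$, and f.g. free modules are identified with their double duals. For a module $M$ and a sign $e$ let $T_e\phi=e\phi^*$ on $\mathrm{Hom}_\Lambda(M,M^*)$, $Q^e(M)=\ker(1-T_e)$ and $Q_e(M)=\mathrm{coker}(1-T_e)$. *Preformations.* A regular $\epsilon$-quadratic preformation $z=(F\xleftarrow{\gamma}G\xrightarrow{\mu}F^*)$ consists of f.g. free modules $F,G$ and maps $\gamma,\mu$ such that $\gamma^*\mu$ is $(-\epsilon)$-symmetric; a split one has in addition $\bar\theta\in Q_{-\epsilon}(G)$ with $\theta-\epsilon\theta^*=\gamma^*\mu$. A strong isomorphism $(\eta,\zeta)\colon z\to z'$ consists of isomorphisms $\eta\colon F\to F'$, $\zeta\colon G\to G'$ with $\eta\gamma=\gamma'\zeta$,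 $\eta^{-*}\mu=\mu'\zeta$ (and $\zeta^*\bar\theta'\zeta=\bar\theta$ in the split case). For a f.g. free $L$ let $y^L=(K\xleftarrow{1}K\to K^*)$, $K=L\oplus L^*$, be the boundary of the hyperbolic form $((x,f),(x',f'))\mapsto f(x')-\epsilon\overline{f'(x)}$ (in the split case $\bar\theta$ is the class of $((x,f),(x',f'))\mapsto f(x')$). The abelian monoid $l^{2q+2}(\Lambda)$ (split: $l_{2q+2}(\Lambda)$) consists of the regular (split) preformations modulo strong isomorphism and addition of boundaries of hyperbolic forms: in the split case the $y^L$, in the non-split case the boundaries of the forms $H^{-\epsilon}(L,\phi)$ obtained by adding a $(-\epsilon)$-symmetric form $\phi$ on $L^*$. A (split) preformation is elementary if there is a f.g. free submodule $U\subset G$ such that $\mu(u)(\gamma(u'))=0$ for $u,u'\in U$ (and $\bar\theta$ vanishes on $U$), $\gamma|_U$ and $\mu|_U$ are injective, their images $U_0\subset F$ and $U_1\subset F^*$ are direct summands, and restriction induces an isomorphism $F^*/U_1\to U_0^*$. A class is elementary if it has an elementary representative. *Flip-isomorphisms.* A flip-isomorphism of $z$ is a triple $t=(\alpha,\beta,\sigma)$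 of isomorphisms $\alpha\colon F\to F^*$, $\beta\colon G\to G$ and $\sigma\in Q^{-\epsilon}(F^*)$ with $\alpha\gamma+\alpha\sigma\mu=\epsilon\mu\beta$ and $\alpha^{-*}\mu=\gamma\beta$. A flip-isomorphism of a split $z$ is a triple $(\alpha,\beta,\bar\nu)$ with $\bar\nu\in Q_{-\epsilon}(F^*)$ such that $(\alpha,\beta,\sigma)$ with $\sigma=(\nu-\epsilon\nu^*)^*$ is a flip-isomorphism and $\bar\theta+\mu^*\bar\nu\mu+\beta^*\bar\theta\beta=0$ in $Q_{-\epsilon}(G)$. The asymmetric Witt group $LAsy^0(\Lambda)$ is the group of non-singular forms $\rho\colon M\to M^*$ (no symmetry condition) on f.g. free modules modulo isomorphism and addition of metabolic forms, i.e. of forms having a direct summand $N$ with $N=\{x : \rho(x)(N)=0\}$. The asymmetric signature of $t$ is $$\sigma^*(z,t)=\left[F\oplus F^*\oplus F,\ \begin{pmatrix}0&0&\alpha\\1&0&-\epsilon\\0&1&\epsilon\alpha\sigma\alpha^*\end{pmatrix}\right]\in LAsy^0(\Lambda).$$ *Linking forms.* Suppose that $\gamma$ and $\mu$ are $S$-isomorphisms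 (isomorphisms after localization away from $S$). Then $L^\mu$ is the $(-\epsilon)$-symmetric linking form on $\mathrm{coker}\,\mu$ with values $s^{-1}\gamma^*(x)(g)\in S^{-1}\Lambda/\Lambda$ on $([x],[y])$, where $sy=\mu(g)$, and $L^\gamma$ is the one on $\mathrm{coker}\,\gamma$ with values $\epsilon s^{-1}\mu^*(x)(g)$ on $([x],[y])$, where $sy=\gamma(g)$. In the split case $L_\mu$ and $L_\gamma$ are these forms together with the quadratic refinements $[y]\mapsto s^{-1}\theta(g)(g)\bar s^{-1}$ and $[y]\mapsto -s^{-1}\theta(g)(g)\bar s^{-1}$ in $S^{-1}\Lambda/\{a+b+\epsilon\bar b : a\in\Lambda,\ b\in S^{-1}\Lambda\}$ (with the same $s,g$ as before). Every flip-isomorphism $t$ of $z$ induces an isometry $[\alpha^{-*}]\colon L^\mu\to L^\gamma$ (split: $L_\mu\to L_\gamma$). *Monoids.* Let $fl_S^{2q+2}(\Lambda)$ be the abelian monoid of pairs $(z,t)$, with $z$ a regular preformation such that $\gamma,\mu$ are $S$-isomorphisms and $t$ a flip-isomorphism of $z$, modulo strong isomorphisms $(\eta,\zeta)$ with $\alpha'=\eta^{-*}\alpha\eta^{-1}$,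 $\beta'=\zeta\beta\zeta^{-1}$, $\sigma'=\eta\sigma\eta^*$ and addition of the pairs $(y^L,t^L)$ with $t^L=\left(\begin{pmatrix}0&-\epsilon\\-1&0\end{pmatrix},\begin{pmatrix}1&0\\0&-1\end{pmatrix},0\right)$. Let $ll_S^{2q+2}(\Lambda)$ be the abelian monoid of pairs $(z,l)$, with $z$ as before and $l\colon L^\mu\to L^\gamma$ an isometry, modulo strong isomorphisms $(\eta,\zeta)$ under which $l$ and $l'$ correspond and addition of the pairs $(y^L,0)$. The split versions $fl^S_{2q+2}(\Lambda)$ and $ll^S_{2q+2}(\Lambda)$ are defined in the same way from split preformations, split strong isomorphisms, split flip-isomorphisms (with $\bar\nu'=\eta\bar\nu\eta^*$) and isometries $L_\mu\to L_\gamma$. There are homomorphisms $L\colon[(z,t)]\mapsto[(z,[\alpha^{-*}])]$ from $fl_S^{2q+2}(\Lambda)$ to $ll_S^{2q+2}(\Lambda)$ and $\sigma^*\colon[(z,t)]\mapsto\sigma^*(z,t)$ from $fl_S^{2q+2}(\Lambda)$ to $LAsy^0(\Lambda)$, and likewise in the split case. **Theorem.** 1. Let $z$ be a regular preformation, split or not,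 such that $\gamma$ and $\mu$ are $S$-isomorphisms. If two flip-isomorphisms $t,t'$ of $z$ induce the same isometry of linking forms, then $\sigma^*(z,t)=\sigma^*(z,t')\in LAsy^0(\Lambda)$. 2. The homomorphism $L\colon fl_S^{2q+2}(\Lambda)\to ll_S^{2q+2}(\Lambda)$ is surjective, and there is a unique homomorphism $\sigma^*\colon ll_S^{2q+2}(\Lambda)\to LAsy^0(\Lambda)$ whose composite with $L$ is $\sigma^*\colon fl_S^{2q+2}(\Lambda)\to LAsy^0(\Lambda)$. If $\gamma$ and $\mu$ are $S$-isomorphisms and $[z]\in l^{2q+2}(\Lambda)$ is elementary, then there exist isometries $l\colon L^\mu\cong L^\gamma$, and $\sigma^*(z,l)=0$ for all of them. 3. In the split case, the homomorphism $ll^S_{2q+2}(\Lambda)\to LAsy^0(\Lambda)$ which is the composite of the forgetful homomorphism to $ll_S^{2q+2}(\Lambda)$ with the $\sigma^*$ of part 2 satisfies $\sigma^*\circ L=\sigma^*$ on $fl^S_{2q+2}(\Lambda)$. If $\gamma$ and $\mu$ are $S$-isomorphisms and $[z]\in l_{2q+2}(\Lambda)$ is elementary, then there exist isometries $l\colon L_\mu\cong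 L_\gamma$ of split linking forms, and $\sigma^*(z,l)=0$ for all of them. -/

import Mathlib

set_option linter.unusedSectionVars false

universe u v

namespace Kreck

/-! ### Duals, sesquilinear forms and `Q`-groups over a ring with involution -/

section Dual

variable (Λ : Type u) [Ring Λ] [StarRing Λ]

/-- The dual `M^* = Hom_Λ(M, Λ)` of a left module over a ring with involution; it is a left
module through `(a • f) x = f x * star a`. -/
def StarDual (M : Type v) [AddCommGroup M] [Module Λ M] : Type (max u v) := M →ₗ[Λ] Λ

namespace StarDual

variable {Λ}
variable {M : Type*} [AddCommGroup M] [Module Λ M] {N : Type*} [AddCommGroup N] [Module Λ N]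
  {P : Type*} [AddCommGroup P] [Module Λ P]

instance : AddCommGroup (StarDual Λ M) := inferInstanceAs (AddCommGroup (M →ₗ[Λ] Λ))
instance : FunLike (StarDual Λ M) M Λ := inferInstanceAs (FunLike (M →ₗ[Λ] Λ) M Λ)
instance : LinearMapClass (StarDual Λ M) Λ M Λ :=
  inferInstanceAs (LinearMapClass (M →ₗ[Λ] Λ) Λ M Λ)

@[ext] theorem ext {f g : StarDual Λ M} (h : ∀ x, f x = g x) : f = g := DFunLike.ext f g h

/-- A linear functional as an element of the dual. -/
def of (f : M →ₗ[Λ] Λ) : StarDual Λ M := f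

@[simp] theorem of_apply (f : M →ₗ[Λ] Λ) (x : M) : of f x = f x := rfl
@[simp] theorem add_apply (f g : StarDual Λ M) (x : M) : (f + g) x = f x + g x := rfl
@[simp] theorem zero_apply (x : M) : (0 : StarDual Λ M) x = 0 := rfl
@[simp] theorem neg_apply (f : StarDual Λ M) (x : M) : (-f) x = -f x := rfl
@[simp] theorem sub_apply (f g : StarDual Λ M) (x : M) : (f - g) x = f x - g x := rfl

@[simp] theorem sum_apply {ι : Type*} (s : Finset ι) (f : ι → StarDual Λ M) (x : M) :
    (∑ i ∈ s, f i) x = ∑ i ∈ s, f i x := by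
  classical
  induction s using Finset.induction_on with
  | empty => simp
  | insert i s hi ih => rw [Finset.sum_insert hi, Finset.sum_insert hi, add_apply, ih]

instance : SMul Λ (StarDual Λ M) where
  smul a f := of
    { toFun := fun x => f x * star a
      map_add' := fun x y => by rw [map_add, add_mul]
      map_smul' := fun c x => by rw [map_smul, smul_eq_mul, RingHom.id_apply, smul_eq_mul, mul_assoc] }

@[simp] theorem smul_apply (a : Λ) (f : StarDual Λ M) (x : M) : (a • f) x = f x * star a := rfl

instance : Module Λ (StarDual Λ M) where
  one_smul f := by ext; simp
  mul_smul a b f := by ext; simp [mul_assoc]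
  smul_zero a := by ext; simp
  smul_add a f g := by ext; simp [add_mul]
  add_smul a b f := by ext; simp [mul_add]
  zero_smul f := by ext; simp

@[simp] theorem units_smul_apply (e : ℤˣ) (f : StarDual Λ M) (x : M) : (e • f) x = e • f x := by
  rcases Int.units_eq_one_or e with rfl | rfl <;> simp [Units.smul_def]

theorem star_units_smul (e : ℤˣ) (a : Λ) : star (e • a) = e • star a := by
  rcases Int.units_eq_one_or e with rfl | rfl <;> simp [Units.smul_def]

/-- The dual map `f^* : N^* → M^*`, `φ ↦ φ ∘ f`. -/
def dualMap (f : M →ₗ[Λ] N) : StarDual Λ N →ₗ[Λ] StarDual Λ M where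
  toFun φ := of ((show N →ₗ[Λ] Λ from φ) ∘ₗ f)
  map_add' _ _ := rfl
  map_smul' _ _ := rfl

@[simp] theorem dualMap_apply (f : M →ₗ[Λ] N) (φ : StarDual Λ N) (x : M) :
    dualMap f φ x = φ (f x) := rfl

/-- The isomorphism `(f^{-1})^* : M^* ≃ N^*` defined by an isomorphism `f : M ≃ N`; it is
written `f^{-*}`. -/
def dualEquiv (f : M ≃ₗ[Λ] N) : StarDual Λ M ≃ₗ[Λ] StarDual Λ N :=
  LinearEquiv.ofLinearMap (dualMap f.symm.toLinearMap) (dualMap f.toLinearMap)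
    (by ext; simp) (by ext; simp)

@[simp] theorem dualEquiv_apply (f : M ≃ₗ[Λ] N) (φ : StarDual Λ M) (x : N) :
    dualEquiv f φ x = φ (f.symm x) := rfl

@[simp] theorem dualEquiv_symm_apply (f : M ≃ₗ[Λ] N) (φ : StarDual Λ N) (x : M) :
    (dualEquiv f).symm φ x = φ (f x) := rfl

/-- The canonical map `M → M^{**}`. -/
def eval : M →ₗ[Λ] StarDual Λ (StarDual Λ M) where
  toFun x := of
    { toFun := fun f => star (f x)
      map_add' := fun f g => by simp
      map_smul' := fun a f => by simp }
  map_add' x y := by ext; simp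
  map_smul' a x := by ext; simp

@[simp] theorem eval_apply (x : M) (f : StarDual Λ M) : eval x f = star (f x) := rfl

/-- The functional `(x, y) ↦ f x + g y` on `M × N`. -/
def coprod (f : StarDual Λ M) (g : StarDual Λ N) : StarDual Λ (M × N) :=
  of (LinearMap.coprod (show M →ₗ[Λ] Λ from f) (show N →ₗ[Λ] Λ from g))

@[simp] theorem coprod_apply (f : StarDual Λ M) (g : StarDual Λ N) (x : M × N) :
    coprod f g x = f x.1 + g x.2 := rfl

/-- The identification `M^* ⊕ N^* = (M ⊕ N)^*`. -/
def prodEquiv : (StarDual Λ M × StarDual Λ N) ≃ₗ[Λ] StarDual Λ (M × N) where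
  toFun p := coprod p.1 p.2
  invFun φ := (dualMap (LinearMap.inl Λ M N) φ, dualMap (LinearMap.inr Λ M N) φ)
  map_add' p q := by ext; simp; abel
  map_smul' a p := by ext; simp [add_mul]
  left_inv p := by ext <;> simp
  right_inv φ := by ext x; simp [← map_add]

@[simp] theorem prodEquiv_apply (p : StarDual Λ M × StarDual Λ N) (x : M × N) :
    prodEquiv p x = p.1 x.1 + p.2 x.2 := rfl

theorem prodEquiv_symm_apply (φ : StarDual Λ (M × N)) :
    prodEquiv.symm φ = (dualMap (LinearMap.inl Λ M N) φ, dualMap (LinearMap.inr Λ M N) φ) := rfl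

/-- The sum `f ⊕ g : M ⊕ M' → N^* ⊕ N'^* = (N ⊕ N')^*` of two maps into duals. -/
def sumMap {M' : Type*} [AddCommGroup M'] [Module Λ M'] {N' : Type*} [AddCommGroup N']
    [Module Λ N'] (f : M →ₗ[Λ] StarDual Λ N) (g : M' →ₗ[Λ] StarDual Λ N') :
    (M × M') →ₗ[Λ] StarDual Λ (N × N') :=
  prodEquiv.toLinearMap ∘ₗ LinearMap.prodMap f g

@[simp] theorem sumMap_apply {M' : Type*} [AddCommGroup M'] [Module Λ M'] {N' : Type*}
    [AddCommGroup N'] [Module Λ N'] (f : M →ₗ[Λ] StarDual Λ N) (g : M' →ₗ[Λ] StarDual Λ N')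
    (x : M × M') (y : N × N') : sumMap f g x y = f x.1 y.1 + g x.2 y.2 := rfl

/-- The adjoint `φ^* : N → M^*` of a map `φ : M → N^*`, `φ^*(y)(x) = star (φ(x)(y))`. It is the
dual `N^{**} → M^*` of `φ` composed with the canonical map `N → N^{**}`. -/
def adj (φ : M →ₗ[Λ] StarDual Λ N) : N →ₗ[Λ] StarDual Λ M := dualMap φ ∘ₗ eval

@[simp] theorem adj_apply (φ : M →ₗ[Λ] StarDual Λ N) (y : N) (x : M) :
    adj φ y x = star (φ x y) := rfl

section Free

variable [Module.Free Λ M] [Module.Finite Λ M]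

theorem eval_bijective : Function.Bijective (eval : M →ₗ[Λ] StarDual Λ (StarDual Λ M)) := by
  classical
  let b := Module.Free.chooseBasis Λ M
  constructor
  · rw [injective_iff_map_eq_zero]
    intro x hx
    refine b.ext_elem fun i => ?_
    have := congrArg (fun Φ : StarDual Λ (StarDual Λ M) => Φ (of (b.coord i))) hx
    simpa using this
  · intro Φ
    refine ⟨∑ i, star (Φ (of (b.coord i))) • b i, ?_⟩
    ext f
    have hf : f = ∑ i, star (f (b i)) • of (b.coord i) := by
      ext x
      rw [sum_apply]
      conv_lhs => rw [← b.sum_repr x]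
      rw [map_sum]
      exact Finset.sum_congr rfl fun i _ => by simp
    conv_rhs => rw [hf]
    simp [map_sum]

/-- The identification `M = M^{**}` for a f.g. free module `M`. -/
noncomputable def evalEquiv (M : Type*) [AddCommGroup M] [Module Λ M] [Module.Free Λ M]
    [Module.Finite Λ M] : M ≃ₗ[Λ] StarDual Λ (StarDual Λ M) :=
  LinearEquiv.ofBijective eval eval_bijective

@[simp] theorem evalEquiv_apply (x : M) (f : StarDual Λ M) : evalEquiv M x f = star (f x) := rfl

/-- The dual of a f.g. free module, in coordinates. -/
noncomputable def dualEquivFun {ι : Type*} [Fintype ι] [DecidableEq ι] (b : Module.Basis ι Λ M) :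
    StarDual Λ M ≃ₗ[Λ] (ι → Λ) where
  toFun f i := star (f (b i))
  invFun c := of (b.constr ℕ fun i => star (c i))
  map_add' f g := by ext; simp
  map_smul' a f := by ext; simp
  left_inv f := by
    refine DFunLike.ext _ _ fun x => ?_
    have : (b.constr ℕ fun i => star (star (f (b i)))) = (show M →ₗ[Λ] Λ from f) :=
      b.ext fun i => by rw [b.constr_basis, star_star]; rfl
    change (b.constr ℕ fun i => star (star (f (b i)))) x = f x
    rw [this]; rfl
  right_inv c := by ext i; simp

instance : Module.Free Λ (StarDual Λ M) := by
  classical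
  exact Module.Free.of_equiv (dualEquivFun (Module.Free.chooseBasis Λ M)).symm

instance : Module.Finite Λ (StarDual Λ M) := by
  classical
  exact Module.Finite.equiv (dualEquivFun (Module.Free.chooseBasis Λ M)).symm

/-- For an isomorphism `α : M ≃ N^*`, the isomorphism `α^* : N ≃ M^*`. -/
noncomputable def adjEquiv {N : Type*} [AddCommGroup N] [Module Λ N] [Module.Free Λ N]
    [Module.Finite Λ N] (α : M ≃ₗ[Λ] StarDual Λ N) : N ≃ₗ[Λ] StarDual Λ M :=
  (evalEquiv N).trans (dualEquiv α.symm)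

end Free

end StarDual

end Dual

end Kreck

namespace Kreck

open StarDual

/-! ### Symmetric and quadratic forms -/

section Forms

variable {Λ : Type u} [Ring Λ] [StarRing Λ]
variable {M : Type*} [AddCommGroup M] [Module Λ M] {N : Type*} [AddCommGroup N] [Module Λ N]
  {P : Type*} [AddCommGroup P] [Module Λ P]

/-- The `e`-duality involution `T_e φ = e φ^*`, `T_e(φ)(x)(y) = e * star (φ(y)(x))`. -/
def dualityInv (e : ℤˣ) : (M →ₗ[Λ] StarDual Λ M) →+ (M →ₗ[Λ] StarDual Λ M) where
  toFun φ := e • adj φ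
  map_zero' := by ext; simp
  map_add' φ ψ := by ext; simp

@[simp] theorem dualityInv_apply (e : ℤˣ) (φ : M →ₗ[Λ] StarDual Λ M) (x y : M) :
    dualityInv e φ x y = e • star (φ y x) := by
  rcases Int.units_eq_one_or e with rfl | rfl <;> simp [dualityInv, Units.smul_def]

/-- `φ` is `e`-symmetric, i.e. `φ ∈ Q^e(M) = ker (1 - T_e)`. -/
def IsSymm (e : ℤˣ) (φ : M →ₗ[Λ] StarDual Λ M) : Prop := dualityInv e φ = φ

theorem isSymm_iff {e : ℤˣ} {φ : M →ₗ[Λ] StarDual Λ M} :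
    IsSymm e φ ↔ ∀ x y, φ x y = e • star (φ y x) := by
  constructor
  · intro h x y
    conv_lhs => rw [← h]
    simp
  · intro h
    ext x y
    rw [dualityInv_apply, ← h]

/-- The group `Q_e(M) = coker (1 - T_e)` of `e`-quadratic forms on `M`. -/
abbrev QForm (Λ : Type u) [Ring Λ] [StarRing Λ] (e : ℤˣ) (M : Type*) [AddCommGroup M]
    [Module Λ M] :=
  (M →ₗ[Λ] StarDual Λ M) ⧸
    (AddMonoidHom.id (M →ₗ[Λ] StarDual Λ M) - dualityInv e).range

/-- The subgroup `{b - e * star b}` of `Λ`. -/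
def skewSubgroup (Λ : Type u) [Ring Λ] [StarRing Λ] (e : ℤˣ) : AddSubgroup Λ where
  carrier := {a | ∃ b : Λ, a = b - e • star b}
  zero_mem' := ⟨0, by simp⟩
  add_mem' := by
    rintro _ _ ⟨b, rfl⟩ ⟨c, rfl⟩
    exact ⟨b + c, by rw [star_add, smul_add]; abel⟩
  neg_mem' := by
    rintro _ ⟨b, rfl⟩
    exact ⟨-b, by rw [star_neg, smul_neg]; abel⟩

/-- `Q_e(Λ) = Λ / {b - e * star b}`. -/
abbrev QRing (Λ : Type u) [Ring Λ] [StarRing Λ] (e : ℤˣ) := Λ ⧸ skewSubgroup Λ e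

namespace QForm

variable {e : ℤˣ}

/-- The class in `Q_e(M)` of a sesquilinear form. -/
abbrev mk (e : ℤˣ) (φ : M →ₗ[Λ] StarDual Λ M) : QForm Λ e M := QuotientAddGroup.mk φ

/-- The quadratic refinement `x ↦ ψ(x)(x) ∈ Q_e(Λ)` of `ψ ∈ Q_e(M)`. -/
def value (ψ : QForm Λ e M) (x : M) : QRing Λ e :=
  QuotientAddGroup.map _ (skewSubgroup Λ e)
    ({ toFun := fun φ => φ x x, map_zero' := rfl, map_add' := fun _ _ => rfl } :
      (M →ₗ[Λ] StarDual Λ M) →+ Λ)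
    (by
      rintro _ ⟨φ, rfl⟩
      exact ⟨φ x x, congrArg (fun c => φ x x - c) (dualityInv_apply e φ x x)⟩) ψ

@[simp] theorem value_mk (φ : M →ₗ[Λ] StarDual Λ M) (x : M) :
    (mk e φ).value x = QuotientAddGroup.mk (φ x x) := rfl

theorem value_add (ψ ψ' : QForm Λ e M) (x : M) :
    (ψ + ψ').value x = ψ.value x + ψ'.value x := by
  unfold value; exact map_add _ _ _

theorem value_neg (ψ : QForm Λ e M) (x : M) : (-ψ).value x = -ψ.value x := by
  unfold value; exact map_neg _ _

theorem value_zero (x : M) : (0 : QForm Λ e M).value x = 0 := by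
  unfold value; exact map_zero _

/-- The symmetrization `(1 + T_e) ψ` of `ψ ∈ Q_e(M)`. -/
def symmetrize : QForm Λ e M →+ (M →ₗ[Λ] StarDual Λ M) :=
  QuotientAddGroup.lift _ (AddMonoidHom.id (M →ₗ[Λ] StarDual Λ M) + dualityInv e) (by
    rintro _ ⟨φ, rfl⟩
    ext x y
    rcases Int.units_eq_one_or e with rfl | rfl <;> simp [Units.smul_def])

@[simp] theorem symmetrize_mk (φ : M →ₗ[Λ] StarDual Λ M) (x y : M) :
    symmetrize (mk e φ) x y = φ x y + e • star (φ y x) := by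
  change (φ + dualityInv e φ) x y = _
  simp

/-- The form `f^* ψ f ∈ Q_e(M)` induced from `ψ ∈ Q_e(N)` by a map `f : M → N`. -/
def pullback (f : M →ₗ[Λ] N) : QForm Λ e N →+ QForm Λ e M :=
  QuotientAddGroup.map _ _
    ({ toFun := fun φ => dualMap f ∘ₗ φ ∘ₗ f
       map_zero' := by ext; simp
       map_add' := fun φ ψ => by ext; simp } :
      (N →ₗ[Λ] StarDual Λ N) →+ (M →ₗ[Λ] StarDual Λ M))
    (by
      rintro _ ⟨φ, rfl⟩
      exact ⟨dualMap f ∘ₗ φ ∘ₗ f, by ext; simp⟩)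

@[simp] theorem pullback_mk (f : M →ₗ[Λ] N) (φ : N →ₗ[Λ] StarDual Λ N) :
    pullback f (mk e φ) = mk e (dualMap f ∘ₗ φ ∘ₗ f) := rfl

theorem pullback_comp (g : N →ₗ[Λ] P) (f : M →ₗ[Λ] N) (ψ : QForm Λ e P) :
    pullback (g ∘ₗ f) ψ = pullback f (pullback g ψ) := by
  induction ψ using QuotientAddGroup.induction_on with | H φ => rfl

theorem pullback_id (ψ : QForm Λ e M) : pullback LinearMap.id ψ = ψ := by
  induction ψ using QuotientAddGroup.induction_on with | H φ => rfl

theorem value_pullback (f : M →ₗ[Λ] N) (ψ : QForm Λ e N) (x : M) :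
    (pullback f ψ).value x = ψ.value (f x) := by
  induction ψ using QuotientAddGroup.induction_on with | H φ => rfl

theorem symmetrize_pullback (f : M →ₗ[Λ] N) (ψ : QForm Λ e N) (x y : M) :
    symmetrize (pullback f ψ) x y = symmetrize ψ (f x) (f y) := by
  induction ψ using QuotientAddGroup.induction_on with | H φ =>
  change symmetrize (mk e (dualMap f ∘ₗ φ ∘ₗ f)) x y = symmetrize (mk e φ) (f x) (f y)
  simp

/-- The orthogonal sum of quadratic forms. -/
def sum (ψ : QForm Λ e M) (ψ' : QForm Λ e N) : QForm Λ e (M × N) :=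
  pullback (LinearMap.fst Λ M N) ψ + pullback (LinearMap.snd Λ M N) ψ'

end QForm

end Forms

/-! ### Localization away from a central multiplicative subset -/

/-- A submonoid `S` of `Λ` is central and multiplicative if it is closed under the involution,
consists of central elements and contains no zero divisors. -/
class IsCentralMul {Λ : Type u} [Ring Λ] [StarRing Λ] (S : Submonoid Λ) : Prop where
  star_mem : ∀ s ∈ S, star s ∈ S
  regular : ∀ s ∈ S, ∀ a : Λ, s * a = 0 → a = 0
  central : ∀ s ∈ S, ∀ a : Λ, s * a = a * s

section Localization

variable {Λ : Type u} [Ring Λ] [StarRing Λ] (S : Submonoid Λ) [IsCentralMul S]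

instance : OreLocalization.OreSet S where
  ore_right_cancel r₁ r₂ s h :=
    ⟨s, by rw [IsCentralMul.central s.1 s.2, h, IsCentralMul.central s.1 s.2]⟩
  oreNum r _ := r
  oreDenom _ s := s
  ore_eq r s := IsCentralMul.central s.1 s.2 r

/-- The localization `S⁻¹Λ`; the fraction `s⁻¹ a` is `a /ₒ s`. -/
abbrev Loc := OreLocalization S Λ

variable {S}

open OreLocalization

theorem div_add_div_same {M : Type*} [AddCommGroup M] [Module Λ M] (x y : M) (s : S) :
    x /ₒ s + y /ₒ s = (x + y) /ₒ s := add_oreDiv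

theorem div_eq_div_iff {M : Type*} [AddCommGroup M] [Module Λ M] {x y : M} {s t : S} :
    x /ₒ s = y /ₒ t ↔ ∃ u : S, (u * t : Λ) • x = (u * s : Λ) • y := by
  rw [oreDiv_eq_iff]
  constructor
  · rintro ⟨u, v, h1, h2⟩
    refine ⟨u, ?_⟩
    rw [h2, ← IsCentralMul.central s.1 s.2, mul_smul, ← h1, ← IsCentralMul.central s.1 s.2,
      mul_smul]
    rfl
  · rintro ⟨u, hu⟩
    refine ⟨u * s, u * t, ?_, ?_⟩
    · rw [hu]; rfl
    · simp only [Submonoid.coe_mul, mul_assoc]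
      rw [IsCentralMul.central s.1 s.2]

theorem regular_smul {M : Type*} [AddCommGroup M] [Module Λ M] [Module.Free Λ M] (s : S)
    {x : M} (h : (s : Λ) • x = 0) : x = 0 := by
  let b := Module.Free.chooseBasis Λ M
  refine b.ext_elem fun i => ?_
  have := congrArg (fun y => b.repr y i) h
  simp only [map_smul, Finsupp.smul_apply, smul_eq_mul, map_zero, Finsupp.zero_apply] at this
  simpa using IsCentralMul.regular s.1 s.2 _ this

theorem loc_eq_iff {a b : Λ} {s t : S} :
    (a /ₒ s : Loc S) = b /ₒ t ↔ (t : Λ) * a = s * b := by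
  rw [div_eq_div_iff]
  constructor
  · rintro ⟨u, hu⟩
    have : (u : Λ) • ((t : Λ) * a - s * b) = 0 := by
      rw [smul_sub, sub_eq_zero, smul_eq_mul, smul_eq_mul, ← mul_assoc, ← mul_assoc]
      exact hu
    exact sub_eq_zero.1 (regular_smul u this)
  · intro h
    refine ⟨1, ?_⟩
    simpa using h

theorem smul_div {M : Type*} [AddCommGroup M] [Module Λ M] (a : Λ) (x : M) (s : S) :
    a • (x /ₒ s) = (a • x) /ₒ s := by
  rw [← oreDiv_one_smul, oreDiv_smul_char a x 1 s a s (IsCentralMul.central s.1 s.2 a), mul_one]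

theorem div_mul_div (a b : Λ) (s t : S) :
    (a /ₒ s * (b /ₒ t) : Loc S) = (a * b) /ₒ (t * s) :=
  oreDiv_mul_char a b s t a t (IsCentralMul.central t.1 t.2 a)

/-- The localization `S⁻¹f : S⁻¹M → S⁻¹N`, `x / s ↦ f(x) / s`. -/
def locMap (S : Submonoid Λ) [IsCentralMul S] {M N : Type*} [AddCommGroup M] [Module Λ M]
    [AddCommGroup N] [Module Λ N] (f : M →ₗ[Λ] N) :
    OreLocalization S M →ₗ[Loc S] OreLocalization S N where
  toFun := liftExpand (fun x s => f x /ₒ s) fun x t s ht => by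
    rw [map_smul]; exact OreLocalization.expand _ _ _ _
  map_add' x y := by
    induction x using OreLocalization.ind with | _ x s
    induction y using OreLocalization.ind with | _ y t
    rw [oreDiv_add_char (X := M) s t s t (IsCentralMul.central t.1 t.2 s)]
    simp only [liftExpand_of]
    rw [oreDiv_add_char (X := N) s t s t (IsCentralMul.central t.1 t.2 s)]
    simp [Submonoid.smul_def]
  map_smul' a x := by
    induction x using OreLocalization.ind with | _ x s
    induction a using OreLocalization.ind with | _ a t
    rw [oreDiv_smul_char a x t s a s (IsCentralMul.central s.1 s.2 a)]
    simp only [liftExpand_of, RingHom.id_apply, map_smul]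
    rw [oreDiv_smul_char a (f x) t s a s (IsCentralMul.central s.1 s.2 a)]

@[simp] theorem locMap_div {M N : Type*} [AddCommGroup M] [Module Λ M]
    [AddCommGroup N] [Module Λ N] (f : M →ₗ[Λ] N) (x : M) (s : S) :
    locMap S f (x /ₒ s) = f x /ₒ s := rfl

/-- `f` is an `S`-isomorphism if `S⁻¹f` is an isomorphism. -/
def IsSIso (S : Submonoid Λ) [IsCentralMul S] {M N : Type*} [AddCommGroup M] [Module Λ M]
    [AddCommGroup N] [Module Λ N] (f : M →ₗ[Λ] N) : Prop :=
  Function.Bijective (locMap S f)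

theorem div_eq_zero_iff {M : Type*} [AddCommGroup M] [Module Λ M] {x : M} {s : S} :
    x /ₒ s = 0 ↔ ∃ u : S, (u : Λ) • x = 0 := by
  rw [OreLocalization.zero_def, div_eq_div_iff]
  simp

theorem isSIso_iff {M N : Type*} [AddCommGroup M] [Module Λ M]
    [AddCommGroup N] [Module Λ N] {f : M →ₗ[Λ] N} :
    IsSIso S f ↔ (∀ x, f x = 0 → ∃ s : S, (s : Λ) • x = 0) ∧
      ∀ y, ∃ (s : S) (x : M), (s : Λ) • y = f x := by
  constructor
  · rintro ⟨hi, hs⟩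
    constructor
    · intro x hx
      have : locMap S f (x /ₒ 1) = locMap S f 0 := by
        rw [locMap_div, hx, map_zero, zero_oreDiv]
      exact div_eq_zero_iff.1 (hi this)
    · intro y
      obtain ⟨x, hx⟩ := hs (y /ₒ 1)
      induction x using OreLocalization.ind with | _ x s
      rw [locMap_div, div_eq_div_iff] at hx
      obtain ⟨u, hu⟩ := hx
      refine ⟨u * s, (u : Λ) • x, ?_⟩
      rw [map_smul, Submonoid.coe_mul, ← hu]
      simp
  · rintro ⟨h1, h2⟩
    constructor
    · rw [injective_iff_map_eq_zero]
      intro x hx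
      induction x using OreLocalization.ind with | _ x s
      rw [locMap_div, div_eq_zero_iff] at hx
      obtain ⟨u, hu⟩ := hx
      obtain ⟨t, ht⟩ := h1 ((u : Λ) • x) (by rw [map_smul, hu])
      rw [div_eq_zero_iff]
      exact ⟨t * u, by rw [Submonoid.coe_mul, mul_smul, ht]⟩
    · intro y
      induction y using OreLocalization.ind with | _ y s
      obtain ⟨t, x, hx⟩ := h2 y
      refine ⟨x /ₒ (t * s), ?_⟩
      rw [locMap_div, ← hx, div_eq_div_iff]
      refine ⟨1, ?_⟩
      simp only [OneMemClass.coe_one, one_mul, Submonoid.coe_mul, smul_smul]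
      rw [IsCentralMul.central s.1 s.2]

theorem IsSIso.injective {M N : Type*} [AddCommGroup M] [Module Λ M] [Module.Free Λ M]
    [AddCommGroup N] [Module Λ N] {f : M →ₗ[Λ] N} (hf : IsSIso S f) : Function.Injective f := by
  rw [injective_iff_map_eq_zero]
  intro x hx
  obtain ⟨s, hs⟩ := (isSIso_iff.1 hf).1 x hx
  exact regular_smul s hs

theorem IsSIso.exists_denom {M N : Type*} [AddCommGroup M] [Module Λ M]
    [AddCommGroup N] [Module Λ N] {f : M →ₗ[Λ] N} (hf : IsSIso S f) (y : N) :
    ∃ (s : S) (x : M), (s : Λ) • y = f x := (isSIso_iff.1 hf).2 y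

theorem IsSIso.of_bijective {M N : Type*} [AddCommGroup M] [Module Λ M]
    [AddCommGroup N] [Module Λ N] {f : M →ₗ[Λ] N} (hf : Function.Bijective f) : IsSIso S f := by
  rw [isSIso_iff]
  refine ⟨fun x hx => ⟨1, ?_⟩, fun y => ?_⟩
  · rw [hf.1 (hx.trans (map_zero f).symm), smul_zero]
  · obtain ⟨x, rfl⟩ := hf.2 y
    exact ⟨1, x, by simp⟩

theorem IsSIso.prodMap {M N M' N' : Type*} [AddCommGroup M] [Module Λ M]
    [AddCommGroup N] [Module Λ N] [AddCommGroup M'] [Module Λ M']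
    [AddCommGroup N'] [Module Λ N'] {f : M →ₗ[Λ] N} {g : M' →ₗ[Λ] N'}
    (hf : IsSIso S f) (hg : IsSIso S g) : IsSIso S (LinearMap.prodMap f g) := by
  rw [isSIso_iff] at *
  refine ⟨fun x hx => ?_, fun y => ?_⟩
  · obtain ⟨s, hs⟩ := hf.1 x.1 (congrArg Prod.fst hx)
    obtain ⟨t, ht⟩ := hg.1 x.2 (congrArg Prod.snd hx)
    refine ⟨s * t, Prod.ext ?_ ?_⟩
    · rw [Submonoid.coe_mul, IsCentralMul.central s.1 s.2, mul_smul, Prod.smul_fst,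
        Prod.smul_fst, hs, smul_zero, Prod.fst_zero]
    · rw [Submonoid.coe_mul, mul_smul, Prod.smul_snd, Prod.smul_snd, ht, smul_zero, Prod.snd_zero]
  · obtain ⟨s, x, hs⟩ := hf.2 y.1
    obtain ⟨t, x', ht⟩ := hg.2 y.2
    refine ⟨s * t, ((t : Λ) • x, (s : Λ) • x'), Prod.ext ?_ ?_⟩
    · rw [Submonoid.coe_mul, IsCentralMul.central s.1 s.2, mul_smul, Prod.smul_fst,
        Prod.smul_fst, hs]
      simp
    · rw [Submonoid.coe_mul, mul_smul, Prod.smul_snd, Prod.smul_snd, ht]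
      simp

theorem IsSIso.comp_equiv {M N P : Type*} [AddCommGroup M] [Module Λ M]
    [AddCommGroup N] [Module Λ N] [AddCommGroup P] [Module Λ P] {f : M →ₗ[Λ] N}
    (hf : IsSIso S f) (g : N ≃ₗ[Λ] P) : IsSIso S (g.toLinearMap ∘ₗ f) := by
  rw [isSIso_iff] at *
  refine ⟨fun x hx => hf.1 x (g.injective (hx.trans (map_zero g).symm)), fun y => ?_⟩
  obtain ⟨s, x, hs⟩ := hf.2 (g.symm y)
  exact ⟨s, x, by simp [← hs]⟩

/-- The involution of `S⁻¹Λ`, `star (a / s) = star a / star s`. -/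
def locStar (S : Submonoid Λ) [IsCentralMul S] : Loc S →+ Loc S where
  toFun := liftExpand (fun a s => star a /ₒ ⟨star s.1, IsCentralMul.star_mem s.1 s.2⟩)
    fun a t s ht => by
      rw [loc_eq_iff]
      change star (t * (s : Λ)) * star a = star (s : Λ) * star (t * a)
      rw [← star_mul, ← star_mul, star_inj]
      rw [← IsCentralMul.central _ ht, mul_assoc, mul_assoc,
        ← IsCentralMul.central s.1 s.2, IsCentralMul.central s.1 s.2]
  map_zero' := by
    rw [OreLocalization.zero_def, liftExpand_of, loc_eq_iff]
    simp
  map_add' x y := by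
    induction x using OreLocalization.ind with | _ x s
    induction y using OreLocalization.ind with | _ y t
    rw [oreDiv_add_char (X := Λ) s t s t (IsCentralMul.central t.1 t.2 s)]
    simp only [liftExpand_of]
    rw [oreDiv_add_char (X := Λ) _ _ (star (s : Λ)) ⟨star (t : Λ), IsCentralMul.star_mem t.1 t.2⟩
      (IsCentralMul.central _ (IsCentralMul.star_mem t.1 t.2) _), loc_eq_iff]
    simp only [Submonoid.coe_mul, Submonoid.smul_def, smul_eq_mul, star_add, star_mul]
    rw [IsCentralMul.central _ (IsCentralMul.star_mem t.1 t.2) (star x),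
      IsCentralMul.central _ (IsCentralMul.star_mem s.1 s.2) (star y),
      IsCentralMul.central _ (IsCentralMul.star_mem t.1 t.2) (star (s : Λ))]

@[simp] theorem locStar_div (a : Λ) (s : S) :
    locStar S (a /ₒ s) = star a /ₒ ⟨star s.1, IsCentralMul.star_mem s.1 s.2⟩ := rfl

/-- The canonical map `Λ → S⁻¹Λ` of left `Λ`-modules. -/
def toLoc (S : Submonoid Λ) [IsCentralMul S] : Λ →ₗ[Λ] Loc S where
  toFun a := a /ₒ 1
  map_add' a b := (div_add_div_same a b 1).symm
  map_smul' a b := (smul_div a b 1).symm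

theorem toLoc_apply (a : Λ) : toLoc S a = a /ₒ (1 : S) := rfl

theorem mul_div_self (s : S) (a : Λ) : ((s * a : Λ) /ₒ s : Loc S) = toLoc S a := by
  rw [toLoc_apply, loc_eq_iff]; simp

/-- The `Λ`-module `S⁻¹Λ / Λ`. -/
abbrev LocMod (S : Submonoid Λ) [IsCentralMul S] := Loc S ⧸ LinearMap.range (toLoc S)

end Localization

end Kreck

namespace Kreck

open StarDual OreLocalization

/-! ### Linking forms -/

section Linking

variable {Λ : Type u} [Ring Λ] [StarRing Λ] (S : Submonoid Λ) [IsCentralMul S]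

instance : DistribMulAction ℤ (Loc S) := (AddCommGroup.toIntModule (Loc S)).toDistribMulAction
instance : MulAction ℤ (Loc S) := (AddCommGroup.toIntModule (Loc S)).toMulAction
instance : SMul ℤ (Loc S) := (AddCommGroup.toIntModule (Loc S)).toSMul

/-- A homomorphism on `S⁻¹Λ` that kills `Λ` descends to `S⁻¹Λ / Λ`. -/
def LocMod.lift {A : Type*} [AddCommGroup A] (f : Loc S →+ A) (hf : ∀ a, f (toLoc S a) = 0) :
    LocMod S →+ A :=
  QuotientAddGroup.lift (LinearMap.range (toLoc S)).toAddSubgroup f (by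
    rintro _ ⟨a, rfl⟩; exact hf a)

/-- The class in `S⁻¹Λ / Λ`. -/
abbrev LocMod.mk : Loc S →ₗ[Λ] LocMod S := (LinearMap.range (toLoc S)).mkQ

@[simp] theorem LocMod.lift_mk {A : Type*} [AddCommGroup A] (f : Loc S →+ A)
    (hf : ∀ a, f (toLoc S a) = 0) (x : Loc S) : LocMod.lift S f hf (LocMod.mk S x) = f x := rfl

theorem LocMod.mk_toLoc (a : Λ) : LocMod.mk S (toLoc S a) = 0 :=
  (Submodule.Quotient.mk_eq_zero _).2 ⟨a, rfl⟩

theorem locStar_toLoc (a : Λ) : locStar S (toLoc S a) = toLoc S (star a) := by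
  rw [toLoc_apply, locStar_div, toLoc_apply, loc_eq_iff]
  simp

/-- The involution of `S⁻¹Λ / Λ`. -/
def LocMod.conj : LocMod S →+ LocMod S :=
  LocMod.lift S ((LocMod.mk S).toAddMonoidHom.comp (locStar S)) fun a => by
    simp only [AddMonoidHom.comp_apply, locStar_toLoc]
    exact LocMod.mk_toLoc S _

@[simp] theorem LocMod.conj_mk (x : Loc S) :
    LocMod.conj S (LocMod.mk S x) = LocMod.mk S (locStar S x) := rfl

/-- The subgroup `{a + b - e * star b | a ∈ Λ, b ∈ S⁻¹Λ}` of `S⁻¹Λ`. -/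
def locSkewSubgroup (e : ℤˣ) : AddSubgroup (Loc S) where
  carrier := {x | ∃ (a : Λ) (b : Loc S), x = toLoc S a + b - e • locStar S b}
  zero_mem' := ⟨0, 0, by simp⟩
  add_mem' := by
    rintro _ _ ⟨a, b, rfl⟩ ⟨a', b', rfl⟩
    exact ⟨a + a', b + b', by rw [map_add, map_add, smul_add]; abel⟩
  neg_mem' := by
    rintro _ ⟨a, b, rfl⟩
    exact ⟨-a, -b, by rw [map_neg, map_neg, smul_neg]; abel⟩

/-- The group `Q_e(S⁻¹Λ / Λ) = S⁻¹Λ / {a + b - e * star b | a ∈ Λ, b ∈ S⁻¹Λ}`. -/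
abbrev QLoc (e : ℤˣ) := Loc S ⧸ locSkewSubgroup S e

variable (e : ℤˣ)

/-- The class in `Q_e(S⁻¹Λ / Λ)`. -/
abbrev QLoc.mk : Loc S →+ QLoc S e := QuotientAddGroup.mk' _

theorem QLoc.mk_toLoc (a : Λ) : QLoc.mk S e (toLoc S a) = 0 :=
  (QuotientAddGroup.eq_zero_iff _).2 ⟨a, 0, by simp⟩

theorem QLoc.mk_skew (b : Loc S) : QLoc.mk S e (b - e • locStar S b) = 0 :=
  (QuotientAddGroup.eq_zero_iff _).2 ⟨0, b, by simp⟩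

/-- The projection `S⁻¹Λ / Λ → Q_e(S⁻¹Λ / Λ)`. -/
def LocMod.toQLoc : LocMod S →+ QLoc S e :=
  LocMod.lift S (QLoc.mk S e) (QLoc.mk_toLoc S e)

@[simp] theorem LocMod.toQLoc_mk (x : Loc S) :
    LocMod.toQLoc S e (LocMod.mk S x) = QLoc.mk S e x := rfl

theorem locStar_locStar (x : Loc S) : locStar S (locStar S x) = x := by
  induction x using OreLocalization.ind with | _ a s
  simp only [locStar_div, star_star]

theorem units_smul_smul_self {A : Type*} [AddCommGroup A] (e : ℤˣ) (x : A) : e • e • x = x := by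
  rw [smul_smul, Int.units_mul_self, one_smul]

theorem locStar_units_smul (x : Loc S) : locStar S (e • x) = e • locStar S x := by
  rcases Int.units_eq_one_or e with rfl | rfl <;> simp [Units.smul_def]

theorem toLoc_units_smul (a : Λ) : toLoc S (e • a) = e • toLoc S a := by
  rcases Int.units_eq_one_or e with rfl | rfl <;> simp [Units.smul_def]

theorem units_smul_div (a : Λ) (s : S) : (e • a : Λ) /ₒ s = e • (a /ₒ s : Loc S) := by
  rcases Int.units_eq_one_or e with rfl | rfl
  · simp
  · simp only [Units.smul_def, Units.val_neg, Units.val_one, neg_smul, one_smul]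
    rw [eq_neg_iff_add_eq_zero, div_add_div_same, neg_add_cancel, zero_oreDiv]

theorem LocMod.mk_units_smul (x : Loc S) : LocMod.mk S (e • x) = e • LocMod.mk S x := by
  rcases Int.units_eq_one_or e with rfl | rfl <;> simp [Units.smul_def]

/-- The map `1 + T_e : Q_e(S⁻¹Λ / Λ) → S⁻¹Λ / Λ`, `b ↦ b + e * star b`. -/
def QLoc.symmetrize : QLoc S e →+ LocMod S :=
  QuotientAddGroup.lift _
    ((LocMod.mk S).toAddMonoidHom +
      (DistribSMul.toAddMonoidHom (LocMod S) e).comp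
        ((LocMod.mk S).toAddMonoidHom.comp (locStar S))) (by
    rintro _ ⟨a, b, rfl⟩
    have : ∀ x : Loc S, ((LocMod.mk S).toAddMonoidHom +
      (DistribSMul.toAddMonoidHom (LocMod S) e).comp
        ((LocMod.mk S).toAddMonoidHom.comp (locStar S))) x
        = LocMod.mk S (x + e • locStar S x) := fun x => by
      rw [map_add, LocMod.mk_units_smul]; rfl
    rw [AddMonoidHom.mem_ker, this]
    have h : toLoc S a + b - e • locStar S b +
        e • locStar S (toLoc S a + b - e • locStar S b) = toLoc S (a + e • star a) := by
      rw [map_sub, map_add, locStar_toLoc, locStar_units_smul, locStar_locStar, smul_sub,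
        smul_add, units_smul_smul_self, map_add, toLoc_units_smul]
      abel
    rw [h, LocMod.mk_toLoc])

@[simp] theorem QLoc.symmetrize_mk (x : Loc S) :
    QLoc.symmetrize S e (QLoc.mk S e x) = LocMod.mk S (x + e • locStar S x) := by
  rw [map_add, LocMod.mk_units_smul]; rfl

theorem locStar_smul_mul (a b : Λ) (x : Loc S) :
    locStar S (toLoc S a * x * toLoc S b) = toLoc S (star b) * locStar S x * toLoc S (star a) := by
  induction x using OreLocalization.ind with | _ c s
  simp only [toLoc_apply, div_mul_div, locStar_div, one_mul, mul_one, star_mul,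
    mul_assoc]

/-- The action `x ↦ a * x * star a` of `a ∈ Λ` on `Q_e(S⁻¹Λ / Λ)`. -/
def QLoc.act (a : Λ) : QLoc S e →+ QLoc S e :=
  QuotientAddGroup.map _ _
    ((AddMonoidHom.mulRight (toLoc S (star a))).comp (AddMonoidHom.mulLeft (toLoc S a))) (by
    rintro _ ⟨c, b, rfl⟩
    refine ⟨a * c * star a, toLoc S a * b * toLoc S (star a), ?_⟩
    have h1 : toLoc S a * toLoc S c * toLoc S (star a) = toLoc S (a * c * star a) := by
      simp only [toLoc_apply, div_mul_div, mul_one]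
    have h2 : ∀ x : Loc S, toLoc S a * (e • x) * toLoc S (star a) =
        e • (toLoc S a * x * toLoc S (star a)) := fun x => by
      rcases Int.units_eq_one_or e with rfl | rfl <;> simp [Units.smul_def]
    change toLoc S a * (toLoc S c + b - e • locStar S b) * toLoc S (star a) = _
    rw [locStar_smul_mul, star_star, mul_sub, sub_mul, mul_add, add_mul, h1, h2])

@[simp] theorem QLoc.act_mk (a : Λ) (x : Loc S) :
    QLoc.act S e a (QLoc.mk S e x) = QLoc.mk S e (toLoc S a * x * toLoc S (star a)) := rfl

variable {S}

/-- The conjugate of a denominator. -/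
def denStar (s : S) : S := ⟨star s.1, IsCentralMul.star_mem s.1 s.2⟩

@[simp] theorem coe_denStar (s : S) : (denStar s : Λ) = star (s : Λ) := rfl

variable (S)

/-- The map `Q_e(Λ) → Q_e(S⁻¹Λ / Λ)`, `c ↦ s⁻¹ * c * star s⁻¹`. -/
def QLoc.scale (s : S) : QRing Λ e →+ QLoc S e :=
  QuotientAddGroup.lift _
    ({ toFun := fun c => QLoc.mk S e (c /ₒ (s * denStar s))
       map_zero' := by rw [zero_oreDiv, map_zero]
       map_add' := fun c c' => by rw [← div_add_div_same, map_add] } : Λ →+ QLoc S e)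
    (by
      rintro _ ⟨b, rfl⟩
      change QLoc.mk S e ((b - e • star b) /ₒ (s * denStar s)) = 0
      rw [← QLoc.mk_skew S e (b /ₒ (s * denStar s))]
      congr 1
      rw [locStar_div, sub_eq_add_neg, ← div_add_div_same, sub_eq_add_neg]
      congr 1
      have h : (⟨star ((s * denStar s : S) : Λ), IsCentralMul.star_mem _ (s * denStar s).2⟩ : S)
          = s * denStar s := Subtype.ext (by simp)
      rw [h, ← units_smul_div, ← smul_neg, units_smul_div, units_smul_div, ← smul_neg]
      congr 1
      rw [eq_neg_iff_add_eq_zero, div_add_div_same, neg_add_cancel, zero_oreDiv])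

@[simp] theorem QLoc.scale_mk (s : S) (c : Λ) :
    QLoc.scale S e s (QuotientAddGroup.mk c) = QLoc.mk S e (c /ₒ (s * denStar s)) := rfl

/-- A `(Λ, S)`-module is the cokernel of an injective `S`-isomorphism of f.g. projective
modules. -/
def IsLSModule (M : Type u) [AddCommGroup M] [Module Λ M] : Prop :=
  ∃ (P Q : Type u) (_ : AddCommGroup P) (_ : Module Λ P) (_ : AddCommGroup Q) (_ : Module Λ Q)
    (d : P →ₗ[Λ] Q) (p : Q →ₗ[Λ] M),
    Module.Finite Λ P ∧ Module.Projective Λ P ∧ Module.Finite Λ Q ∧ Module.Projective Λ Q ∧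
    Function.Injective d ∧ Function.Exact d p ∧ Function.Surjective p ∧ IsSIso S d

/-- An `e`-symmetric linking form over `(Λ, S)` on the module `M`. -/
structure LinkingForm (M : Type u) [AddCommGroup M] [Module Λ M] where
  isLS : IsLSModule S M
  form : M → M →ₗ[Λ] LocMod S
  symm : ∀ x y, form x y = e • LocMod.conj S (form y x)

/-- A split `e`-quadratic linking form over `(Λ, S)` on the module `M`. -/
structure SplitLinkingForm (M : Type u) [AddCommGroup M] [Module Λ M] extends
    LinkingForm S e M where
  quad : M → QLoc S e
  quad_smul : ∀ (a : Λ) (x : M), quad (a • x) = QLoc.act S e a (quad x)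
  quad_add : ∀ x y, quad (x + y) - quad x - quad y = LocMod.toQLoc S e (form x y)
  symmetrize_quad : ∀ x, QLoc.symmetrize S e (quad x) = form x x

variable {S e}

/-- An isometry of linking forms. -/
structure LinkingForm.Isometry {M N : Type u} [AddCommGroup M] [Module Λ M] [AddCommGroup N]
    [Module Λ N] (A : LinkingForm S e M) (B : LinkingForm S e N) extends M ≃ₗ[Λ] N where
  map_form : ∀ x y, B.form (toLinearEquiv x) (toLinearEquiv y) = A.form x y

/-- An isometry of split linking forms. -/
structure SplitLinkingForm.Isometry {M N : Type u} [AddCommGroup M] [Module Λ M] [AddCommGroup N]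
    [Module Λ N] (A : SplitLinkingForm S e M) (B : SplitLinkingForm S e N) extends
    LinkingForm.Isometry A.toLinkingForm B.toLinkingForm where
  map_quad : ∀ x, B.quad (toLinearEquiv x) = A.quad x

/-! ### The linking form on the cokernel of an `S`-isomorphism -/

section Construction

variable {G X : Type u} [AddCommGroup G] [Module Λ G] [AddCommGroup X] [Module Λ X]
  {d : G →ₗ[Λ] X} (hd : IsSIso S d) (a : X →ₗ[Λ] StarDual Λ G)

/-- The element `g / s` of `S⁻¹G` for `y ∈ X` with `s • y = d g`. -/
noncomputable def lift (y : X) : OreLocalization S G :=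
  (LinearEquiv.ofBijective (locMap S d) hd).symm (y /ₒ 1)

theorem lift_eq {y : X} {s : S} {g : G} (h : (s : Λ) • y = d g) : lift hd y = g /ₒ s := by
  rw [lift, LinearEquiv.symm_apply_eq]
  change _ = locMap S d (g /ₒ s)
  rw [locMap_div, div_eq_div_iff]
  exact ⟨1, by simp [h]⟩

/-- The fraction `s⁻¹ * a(x)(g) ∈ S⁻¹Λ` for `x, y ∈ X` with `s • y = d g`. -/
noncomputable def pair (x y : X) : Loc S :=
  locMap S (show G →ₗ[Λ] Λ from a x) (lift hd y)

theorem pair_eq (x : X) {y : X} {s : S} {g : G} (h : (s : Λ) • y = d g) :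
    pair hd a x y = a x g /ₒ s := by
  rw [pair, lift_eq hd h]; rfl

theorem common_denom (x y : X) (hd : IsSIso S d) :
    ∃ (s : S) (g h : G), (s : Λ) • x = d g ∧ (s : Λ) • y = d h := by
  obtain ⟨s, g, hs⟩ := hd.exists_denom x
  obtain ⟨t, h, ht⟩ := hd.exists_denom y
  refine ⟨s * t, (t : Λ) • g, (s : Λ) • h, ?_, ?_⟩
  · rw [map_smul, ← hs, smul_smul, Submonoid.coe_mul, IsCentralMul.central s.1 s.2]
  · rw [map_smul, ← ht, smul_smul, Submonoid.coe_mul]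

theorem pair_add_left (x x' y : X) : pair hd a (x + x') y = pair hd a x y + pair hd a x' y := by
  obtain ⟨s, g, hs⟩ := hd.exists_denom y
  rw [pair_eq hd a _ hs, pair_eq hd a _ hs, pair_eq hd a _ hs, div_add_div_same, map_add]
  rfl

theorem pair_add_right (x y y' : X) : pair hd a x (y + y') = pair hd a x y + pair hd a x y' := by
  obtain ⟨s, g, h, hs, ht⟩ := common_denom y y' hd
  rw [pair_eq hd a _ hs, pair_eq hd a _ ht, pair_eq (s := s) (g := g + h) hd a _
    (by rw [smul_add, hs, ht, map_add]), div_add_div_same, map_add]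

theorem pair_smul_right (c : Λ) (x y : X) : pair hd a x (c • y) = c • pair hd a x y := by
  obtain ⟨s, g, hs⟩ := hd.exists_denom y
  rw [pair_eq hd a _ hs, pair_eq (s := s) (g := c • g) hd a _
    (by rw [smul_smul, IsCentralMul.central s.1 s.2, mul_smul, hs, map_smul]), smul_div, map_smul]

theorem pair_right_range (x : X) (h : G) : pair hd a x (d h) = toLoc S (a x h) := by
  rw [pair_eq (s := 1) (g := h) hd a _ (by simp)]; rfl

variable {a}

theorem pair_left_range (ha : ∀ g h, a (d g) h = e • star (a (d h) g))
    (y : X) (h : G) : pair hd a (d h) y = toLoc S (e • star (a y h)) := by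
  obtain ⟨s, g, hs⟩ := hd.exists_denom y
  rw [pair_eq hd a _ hs, ha, ← hs, map_smul, StarDual.smul_apply, star_mul, star_star, ← mul_smul_comm,
    mul_div_self]

theorem pair_symm (ha : ∀ g h, a (d g) h = e • star (a (d h) g)) (x y : X) :
    pair hd a x y = e • locStar S (pair hd a y x) := by
  obtain ⟨s, g, hs⟩ := hd.exists_denom y
  obtain ⟨t, h, ht⟩ := hd.exists_denom x
  rw [pair_eq hd a _ hs, pair_eq hd a _ ht, locStar_div, ← units_smul_div, loc_eq_iff]
  have := ha h g
  rw [← hs, ← ht, map_smul, map_smul, StarDual.smul_apply, StarDual.smul_apply, star_mul, star_star,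
    ← mul_smul_comm] at this
  rw [← this]
  exact IsCentralMul.central _ (IsCentralMul.star_mem t.1 t.2) _

/-- The form on `coker d` with `(x, y) ↦ s⁻¹ * a(x)(g)` for `s • y = d g`. -/
noncomputable def cokerForm (ha : ∀ g h, a (d g) h = e • star (a (d h) g))
    (x : X ⧸ LinearMap.range d) :
    (X ⧸ LinearMap.range d) →ₗ[Λ] LocMod S :=
  Quotient.liftOn' x
    (fun x => (LinearMap.range d).liftQ
      { toFun := fun y => LocMod.mk S (pair hd a x y)
        map_add' := fun y y' => by rw [pair_add_right, map_add]
        map_smul' := fun c y => by rw [pair_smul_right, map_smul, RingHom.id_apply] }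
      (by
        rintro _ ⟨h, rfl⟩
        change LocMod.mk S (pair hd a x (d h)) = 0
        rw [pair_right_range, LocMod.mk_toLoc]))
    (by
      intro x x' hx
      have hx' : -x + x' ∈ LinearMap.range d := QuotientAddGroup.leftRel_apply.1 hx
      obtain ⟨h, hh⟩ := hx'
      refine LinearMap.ext fun y => ?_
      obtain ⟨y, rfl⟩ := Submodule.Quotient.mk_surjective _ y
      change LocMod.mk S (pair hd a x y) = LocMod.mk S (pair hd a x' y)
      have : x' = x + d h := by rw [hh]; abel
      rw [this, pair_add_left, pair_left_range hd ha, map_add, LocMod.mk_toLoc, add_zero])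

@[simp] theorem cokerForm_mk (ha : ∀ g h, a (d g) h = e • star (a (d h) g))
    (x y : X) :
    cokerForm hd ha (Submodule.Quotient.mk x) (Submodule.Quotient.mk y) =
      LocMod.mk S (pair hd a x y) := rfl

/-- The symmetric linking form on `coker d` with `(x, y) ↦ s⁻¹ * a(x)(g)` for `s • y = d g`. -/
noncomputable def cokerLinking [Module.Free Λ G] [Module.Finite Λ G] [Module.Free Λ X]
    [Module.Finite Λ X] (ha : ∀ g h, a (d g) h = e • star (a (d h) g)) :
    LinkingForm S e (X ⧸ LinearMap.range d) where
  isLS := ⟨G, X, inferInstance, inferInstance, inferInstance, inferInstance, d,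
    (LinearMap.range d).mkQ, inferInstance, inferInstance, inferInstance, inferInstance,
    hd.injective, LinearMap.exact_map_mkQ_range d, Submodule.mkQ_surjective _, hd⟩
  form := cokerForm hd ha
  symm x y := by
    obtain ⟨x, rfl⟩ := Submodule.Quotient.mk_surjective _ x
    obtain ⟨y, rfl⟩ := Submodule.Quotient.mk_surjective _ y
    rw [cokerForm_mk, cokerForm_mk, LocMod.conj_mk, ← LocMod.mk_units_smul, ← pair_symm hd ha]

variable {θ : QForm Λ e G}

theorem scale_value_smul (θ : QForm Λ e G) (s t : S) (g : G) :
    QLoc.scale S e (t * s) (θ.value ((t : Λ) • g)) = QLoc.scale S e s (θ.value g) := by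
  induction θ using QuotientAddGroup.induction_on with | H φ =>
  change QLoc.scale S e (t * s) ((QForm.mk e φ).value ((t : Λ) • g)) =
    QLoc.scale S e s ((QForm.mk e φ).value g)
  rw [QForm.value_mk, QForm.value_mk, QLoc.scale_mk, QLoc.scale_mk]
  congr 1
  rw [loc_eq_iff]
  simp only [map_smul, smul_eq_mul, StarDual.smul_apply, Submonoid.coe_mul, coe_denStar, star_mul]
  have c1 := IsCentralMul.central _ (IsCentralMul.star_mem t.1 t.2) (φ g g)
  have c2 := IsCentralMul.central _ (IsCentralMul.star_mem s.1 s.2) (t : Λ)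
  have c3 := IsCentralMul.central _ s.2 (t : Λ)
  rw [← c1]
  calc (s : Λ) * star (s : Λ) * (t * (star (t : Λ) * φ g g))
      = s * (star (s : Λ) * t) * (star (t : Λ) * φ g g) := by simp only [mul_assoc]
    _ = s * t * star (s : Λ) * star (t : Λ) * φ g g := by rw [c2]; simp only [mul_assoc]
    _ = _ := by rw [c3]; simp only [mul_assoc]

theorem value_add_right (θ : QForm Λ e G) (g h : G) :
    θ.value (g + h) = θ.value g + θ.value h + QuotientAddGroup.mk (θ.symmetrize g h) := by
  induction θ using QuotientAddGroup.induction_on with | H φ =>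
  change (QForm.mk e φ).value (g + h) = (QForm.mk e φ).value g + (QForm.mk e φ).value h +
    QuotientAddGroup.mk ((QForm.mk e φ).symmetrize g h)
  simp only [QForm.value_mk, QForm.symmetrize_mk]
  rw [← QuotientAddGroup.mk_add, ← QuotientAddGroup.mk_add, QuotientAddGroup.eq]
  refine ⟨-(φ h g), ?_⟩
  simp only [map_add, StarDual.add_apply, star_neg, smul_neg]
  abel

variable [Module.Free Λ G]

/-- The class of `s⁻¹ * θ(g)(g) * star s⁻¹` for a choice of `s` and `g` with `s • y = d g`. It
does not depend on the choice, see `preQuad_eq`. -/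
noncomputable def preQuad (hd : IsSIso S d) (θ : QForm Λ e G) (y : X) : QLoc S e :=
  QLoc.scale S e (hd.exists_denom y).choose (θ.value (hd.exists_denom y).choose_spec.choose)

theorem preQuad_eq {y : X} {s : S} {g : G} (h : (s : Λ) • y = d g) :
    preQuad hd θ y = QLoc.scale S e s (θ.value g) := by
  set t := (hd.exists_denom y).choose with ht
  set k := (hd.exists_denom y).choose_spec.choose with hk
  have hy : (t : Λ) • y = d k := (hd.exists_denom y).choose_spec.choose_spec
  have key : (t : Λ) • g = (s : Λ) • k := hd.injective (by
    rw [map_smul, map_smul, ← h, ← hy, smul_smul, smul_smul, IsCentralMul.central t.1 t.2])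
  change QLoc.scale S e t (θ.value k) = _
  have hst : s * t = t * s := Subtype.ext (IsCentralMul.central s.1 s.2 t.1)
  rw [← scale_value_smul θ t s k, ← key, hst, scale_value_smul θ s t g]

theorem preQuad_add (hθ : ∀ g h, θ.symmetrize g h = a (d g) h) (x y : X) :
    preQuad hd θ (x + y) - preQuad hd θ x - preQuad hd θ y = QLoc.mk S e (pair hd a x y) := by
  obtain ⟨s, g, h, hs, ht⟩ := common_denom x y hd
  rw [preQuad_eq hd hs, preQuad_eq hd ht, preQuad_eq (s := s) (g := g + h) hd
    (by rw [smul_add, hs, ht, map_add]), value_add_right, map_add, map_add, hθ, ← hs,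
    pair_eq hd a x ht, map_smul, StarDual.smul_apply, QLoc.scale_mk]
  have : (a x h * star (s : Λ)) /ₒ (s * denStar s) = (a x h /ₒ s : Loc S) := by
    rw [loc_eq_iff, Submonoid.coe_mul, coe_denStar, mul_assoc,
      IsCentralMul.central _ (IsCentralMul.star_mem s.1 s.2)]
  rw [this]
  abel

theorem preQuad_add_range (hθ : ∀ g h, θ.symmetrize g h = a (d g) h) (y : X) (h : G) :
    preQuad hd θ (y + d h) = preQuad hd θ y := by
  have h1 := preQuad_add hd hθ y (d h)
  rw [pair_right_range, QLoc.mk_toLoc] at h1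
  have h2 : preQuad hd θ (d h) = 0 := by
    rw [preQuad_eq (s := 1) (g := h) hd (by simp)]
    generalize θ.value h = c
    induction c using QuotientAddGroup.induction_on with | H c =>
    rw [QLoc.scale_mk, ← QLoc.mk_toLoc S e c, toLoc_apply]
    congr 1
    rw [loc_eq_iff]
    simp
  rw [h2, sub_zero, sub_eq_zero] at h1
  exact h1

/-- The split quadratic linking form on `coker d` with `(x, y) ↦ s⁻¹ * a(x)(g)` and
`y ↦ s⁻¹ * θ(g)(g) * star s⁻¹` for `s • y = d g`. -/
noncomputable def cokerSplitLinking [Module.Finite Λ G] [Module.Free Λ X] [Module.Finite Λ X]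
    (ha : ∀ g h, a (d g) h = e • star (a (d h) g)) (hθ : ∀ g h, θ.symmetrize g h = a (d g) h) :
    SplitLinkingForm S e (X ⧸ LinearMap.range d) where
  toLinkingForm := cokerLinking hd ha
  quad y := Quotient.liftOn' y (preQuad hd θ) (by
    intro x x' hx
    have hx' : -x + x' ∈ LinearMap.range d := QuotientAddGroup.leftRel_apply.1 hx
    obtain ⟨h, hh⟩ := hx'
    have : x' = x + d h := by rw [hh]; abel
    rw [this, preQuad_add_range hd hθ])
  quad_smul c y := by
    obtain ⟨y, rfl⟩ := Submodule.Quotient.mk_surjective _ y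
    change preQuad hd θ (c • y) = QLoc.act S e c (preQuad hd θ y)
    obtain ⟨s, g, hs⟩ := hd.exists_denom y
    rw [preQuad_eq hd hs, preQuad_eq (s := s) (g := c • g) hd
      (by rw [smul_smul, IsCentralMul.central s.1 s.2, mul_smul, hs, map_smul])]
    clear hθ
    induction θ using QuotientAddGroup.induction_on with | H φ =>
    change QLoc.scale S e s ((QForm.mk e φ).value (c • g)) =
      QLoc.act S e c (QLoc.scale S e s ((QForm.mk e φ).value g))
    rw [QForm.value_mk, QForm.value_mk, QLoc.scale_mk, QLoc.scale_mk, QLoc.act_mk]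
    congr 1
    rw [toLoc_apply, toLoc_apply, div_mul_div, div_mul_div, loc_eq_iff]
    simp [mul_assoc]
  quad_add x y := by
    obtain ⟨x, rfl⟩ := Submodule.Quotient.mk_surjective _ x
    obtain ⟨y, rfl⟩ := Submodule.Quotient.mk_surjective _ y
    exact preQuad_add hd hθ x y
  symmetrize_quad x := by
    obtain ⟨x, rfl⟩ := Submodule.Quotient.mk_surjective _ x
    change QLoc.symmetrize S e (preQuad hd θ x) = LocMod.mk S (pair hd a x x)
    obtain ⟨s, g, hs⟩ := hd.exists_denom x
    have h1 : a x g * star (s : Λ) = θ.symmetrize g g := by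
      rw [hθ, ← hs, map_smul, StarDual.smul_apply]
    rw [preQuad_eq hd hs, pair_eq hd a x hs]
    clear hθ
    induction θ using QuotientAddGroup.induction_on with | H φ =>
    change a x g * star (s : Λ) = (QForm.mk e φ).symmetrize g g at h1
    change QLoc.symmetrize S e (QLoc.scale S e s ((QForm.mk e φ).value g)) = _
    rw [QForm.value_mk, QLoc.scale_mk, QLoc.symmetrize_mk]
    congr 1
    have h : (⟨star ((s * denStar s : S) : Λ), IsCentralMul.star_mem _ (s * denStar s).2⟩ : S)
        = s * denStar s := Subtype.ext (by simp)
    rw [locStar_div, h, ← units_smul_div, div_add_div_same, ← QForm.symmetrize_mk, ← h1, loc_eq_iff,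
      Submonoid.coe_mul, coe_denStar, mul_assoc,
      IsCentralMul.central _ (IsCentralMul.star_mem s.1 s.2)]

end Construction

end Linking

end Kreck

namespace Kreck

open StarDual

/-! ### Preformations -/

section Preformations

/-- The sign `ε = (-1)^q`. -/
def eps (q : ℕ) : ℤˣ := (-1) ^ q

variable {Λ : Type u} [Ring Λ] [StarRing Λ]

/-- A regular `ε`-quadratic preformation `F ← G → F^*`, `ε = (-1)^q`: f.g. free modules `F` and
`G` with maps `γ : G → F` and `μ : G → F^*` such that `γ^*μ` is `(-ε)`-symmetric. -/
structure Preform (Λ : Type u) [Ring Λ] [StarRing Λ] (q : ℕ) where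
  F : Type u
  G : Type u
  [addCommGroupF : AddCommGroup F]
  [moduleF : Module Λ F]
  [freeF : Module.Free Λ F]
  [finiteF : Module.Finite Λ F]
  [addCommGroupG : AddCommGroup G]
  [moduleG : Module Λ G]
  [freeG : Module.Free Λ G]
  [finiteG : Module.Finite Λ G]
  gamma : G →ₗ[Λ] F
  mu : G →ₗ[Λ] StarDual Λ F
  symm : IsSymm (-eps q) (dualMap gamma ∘ₗ mu)

attribute [instance] Preform.addCommGroupF Preform.moduleF Preform.freeF Preform.finiteF
  Preform.addCommGroupG Preform.moduleG Preform.freeG Preform.finiteG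

/-- A regular `ε`-quadratic split preformation: a regular preformation with a quadratic
refinement `θ ∈ Q_{-ε}(G)` of `γ^*μ`. -/
structure SplitPreform (Λ : Type u) [Ring Λ] [StarRing Λ] (q : ℕ) extends Preform Λ q where
  theta : QForm Λ (-eps q) G
  symmetrize_theta : QForm.symmetrize theta = dualMap gamma ∘ₗ mu

variable {q : ℕ}

theorem Preform.mu_gamma (z : Preform Λ q) (g h : z.G) :
    z.mu g (z.gamma h) = -eps q • star (z.mu h (z.gamma g)) :=
  isSymm_iff.1 z.symm g h

/-- The sum of preformations. -/
abbrev Preform.add (z z' : Preform Λ q) : Preform Λ q where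
  F := z.F × z'.F
  G := z.G × z'.G
  gamma := LinearMap.prodMap z.gamma z'.gamma
  mu := sumMap z.mu z'.mu
  symm := isSymm_iff.2 fun g h => by
    change z.mu g.1 (z.gamma h.1) + z'.mu g.2 (z'.gamma h.2) =
      -eps q • star (z.mu h.1 (z.gamma g.1) + z'.mu h.2 (z'.gamma g.2))
    rw [z.mu_gamma, z'.mu_gamma, star_add, smul_add]

/-- The sum of split preformations. -/
abbrev SplitPreform.add (z z' : SplitPreform Λ q) : SplitPreform Λ q where
  toPreform := z.toPreform.add z'.toPreform
  theta := z.theta.sum z'.theta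
  symmetrize_theta := by
    refine LinearMap.ext fun g => StarDual.ext fun h => ?_
    change QForm.symmetrize (QForm.pullback (LinearMap.fst Λ z.G z'.G) z.theta +
      QForm.pullback (LinearMap.snd Λ z.G z'.G) z'.theta) g h =
      z.mu g.1 (z.gamma h.1) + z'.mu g.2 (z'.gamma h.2)
    rw [map_add]
    change QForm.symmetrize (QForm.pullback (LinearMap.fst Λ z.G z'.G) z.theta) g h +
      QForm.symmetrize (QForm.pullback (LinearMap.snd Λ z.G z'.G) z'.theta) g h = _
    rw [QForm.symmetrize_pullback, QForm.symmetrize_pullback, z.symmetrize_theta,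
      z'.symmetrize_theta]
    rfl

/-- The zero preformation. -/
abbrev Preform.zero (Λ : Type u) [Ring Λ] [StarRing Λ] (q : ℕ) : Preform Λ q where
  F := PUnit
  G := PUnit
  gamma := 0
  mu := 0
  symm := isSymm_iff.2 fun g h => by simp

/-- The zero split preformation. -/
abbrev SplitPreform.zero (Λ : Type u) [Ring Λ] [StarRing Λ] (q : ℕ) : SplitPreform Λ q where
  toPreform := Preform.zero Λ q
  theta := 0
  symmetrize_theta := by rw [map_zero]; rfl

/-- The boundary `(K = K → K^*)` of the hyperbolic `(-ε)`-symmetric form `H^{-ε}(L, φ)` on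
`K = L ⊕ L^*`, given by `((x, f), (x', f')) ↦ f(x') - ε * star (f'(x)) + φ(f)(f')`. -/
abbrev Preform.hyp (q : ℕ) (L : Type u) [AddCommGroup L] [Module Λ L] [Module.Free Λ L]
    [Module.Finite Λ L] (φ : StarDual Λ L →ₗ[Λ] StarDual Λ (StarDual Λ L))
    (hφ : IsSymm (-eps q) φ) : Preform Λ q where
  F := L × StarDual Λ L
  G := L × StarDual Λ L
  gamma := LinearMap.id
  mu := prodEquiv.toLinearMap ∘ₗ LinearMap.prod (LinearMap.snd Λ L (StarDual Λ L))
    ((-eps q) • (eval ∘ₗ LinearMap.fst Λ L (StarDual Λ L)) +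
      φ ∘ₗ LinearMap.snd Λ L (StarDual Λ L))
  symm := isSymm_iff.2 fun g h => by
    change g.2 h.1 + (((-eps q) • eval g.1) h.2 + φ g.2 h.2) =
      -eps q • star (h.2 g.1 + (((-eps q) • eval h.1) g.2 + φ h.2 g.2))
    rw [isSymm_iff.1 hφ g.2 h.2]
    simp only [units_smul_apply, eval_apply, star_add, smul_add, star_units_smul, star_star,
      units_smul_smul_self]
    abel

theorem Preform.hyp_mu_apply (q : ℕ) (L : Type u) [AddCommGroup L] [Module Λ L] [Module.Free Λ L]
    [Module.Finite Λ L] (φ : StarDual Λ L →ₗ[Λ] StarDual Λ (StarDual Λ L))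
    (hφ : IsSymm (-eps q) φ) (g h : L × StarDual Λ L) :
    (Preform.hyp q L φ hφ).mu g h = g.2 h.1 + (-eps q • star (h.2 g.1) + φ g.2 h.2) := by
  rw [← eval_apply, ← units_smul_apply]; rfl

theorem isSymm_zero {M : Type*} [AddCommGroup M] [Module Λ M] (e : ℤˣ) :
    IsSymm e (0 : M →ₗ[Λ] StarDual Λ M) := map_zero _

/-- The boundary `y^L` of the hyperbolic form `H^{-ε}(L) = H^{-ε}(L, 0)`. -/
abbrev Preform.hyp0 (q : ℕ) (L : Type u) [AddCommGroup L] [Module Λ L] [Module.Free Λ L]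
    [Module.Finite Λ L] : Preform Λ q := Preform.hyp q L 0 (isSymm_zero _)

/-- The boundary of the hyperbolic `(-ε)`-quadratic form `H_{-ε}(L)`, whose quadratic structure
is the class of `((x, f), (x', f')) ↦ f(x')`. -/
abbrev SplitPreform.hyp0 (q : ℕ) (L : Type u) [AddCommGroup L] [Module Λ L] [Module.Free Λ L]
    [Module.Finite Λ L] : SplitPreform Λ q where
  toPreform := Preform.hyp0 q L
  theta := QForm.mk (-eps q) (prodEquiv.toLinearMap ∘ₗ
    LinearMap.prod (LinearMap.snd Λ L (StarDual Λ L)) 0)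
  symmetrize_theta := by
    refine LinearMap.ext fun g => StarDual.ext fun h => ?_
    rw [QForm.symmetrize_mk]
    change (g.2 h.1 + 0) + -eps q • star (h.2 g.1 + 0) = (Preform.hyp q L 0 _).mu g h
    rw [Preform.hyp_mu_apply]
    simp

/-! ### Strong isomorphisms -/

/-- A strong isomorphism `(η, ζ)` of preformations. -/
structure StrongIso (z z' : Preform Λ q) where
  eta : z.F ≃ₗ[Λ] z'.F
  zeta : z.G ≃ₗ[Λ] z'.G
  gamma_comm : ∀ g, eta (z.gamma g) = z'.gamma (zeta g)
  mu_comm : ∀ g, dualEquiv eta (z.mu g) = z'.mu (zeta g)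

namespace StrongIso

/-- The identity. -/
def refl (z : Preform Λ q) : StrongIso z z where
  eta := LinearEquiv.refl Λ _
  zeta := LinearEquiv.refl Λ _
  gamma_comm _ := rfl
  mu_comm _ := rfl

/-- The inverse. -/
def symm {z z' : Preform Λ q} (i : StrongIso z z') : StrongIso z' z where
  eta := i.eta.symm
  zeta := i.zeta.symm
  gamma_comm g := by
    rw [LinearEquiv.symm_apply_eq, i.gamma_comm, LinearEquiv.apply_symm_apply]
  mu_comm g := by
    have := i.mu_comm (i.zeta.symm g)
    rw [LinearEquiv.apply_symm_apply] at this
    rw [← this]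
    ext x
    simp

/-- The composite. -/
def trans {z z' z'' : Preform Λ q} (i : StrongIso z z') (j : StrongIso z' z'') :
    StrongIso z z'' where
  eta := i.eta.trans j.eta
  zeta := i.zeta.trans j.zeta
  gamma_comm g := by simp only [LinearEquiv.trans_apply, i.gamma_comm, j.gamma_comm]
  mu_comm g := by
    rw [LinearEquiv.trans_apply, ← j.mu_comm, ← i.mu_comm]; rfl

/-- The sum. -/
def add {z z' w w' : Preform Λ q} (i : StrongIso z z') (j : StrongIso w w') :
    StrongIso (z.add w) (z'.add w') where
  eta := LinearEquiv.prodCongr i.eta j.eta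
  zeta := LinearEquiv.prodCongr i.zeta j.zeta
  gamma_comm g := Prod.ext (i.gamma_comm g.1) (j.gamma_comm g.2)
  mu_comm g := by
    ext x
    exact congrArg₂ (· + ·) (congrArg (fun f : StarDual Λ z'.F => f x.1) (i.mu_comm g.1))
      (congrArg (fun f : StarDual Λ w'.F => f x.2) (j.mu_comm g.2))

/-- Commutativity of the sum. -/
def comm (z w : Preform Λ q) : StrongIso (z.add w) (w.add z) where
  eta := LinearEquiv.prodComm Λ _ _
  zeta := LinearEquiv.prodComm Λ _ _
  gamma_comm g := rfl
  mu_comm g := by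
    ext x
    exact add_comm _ _

/-- Associativity of the sum. -/
def assoc (z w v : Preform Λ q) : StrongIso ((z.add w).add v) (z.add (w.add v)) where
  eta := LinearEquiv.prodAssoc Λ _ _ _
  zeta := LinearEquiv.prodAssoc Λ _ _ _
  gamma_comm g := rfl
  mu_comm g := by
    ext x
    exact add_assoc _ _ _

/-- Neutrality of the zero preformation. -/
def zeroAdd (z : Preform Λ q) : StrongIso ((Preform.zero Λ q).add z) z where
  eta := LinearEquiv.uniqueProd
  zeta := LinearEquiv.uniqueProd
  gamma_comm g := rfl
  mu_comm g := by
    ext x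
    exact zero_add _

/-- The isomorphism `(L ⊕ L^*) ⊕ (L' ⊕ L'^*) = (L ⊕ L') ⊕ (L ⊕ L')^*`. -/
def shuffle (L L' : Type u) [AddCommGroup L] [Module Λ L] [AddCommGroup L'] [Module Λ L'] :
    ((L × StarDual Λ L) × (L' × StarDual Λ L')) ≃ₗ[Λ] (L × L') × StarDual Λ (L × L') :=
  (LinearEquiv.prodProdProdComm Λ _ _ _ _).trans
    (LinearEquiv.prodCongr (LinearEquiv.refl Λ _) prodEquiv)

section Hyp

variable {L L' : Type u} [AddCommGroup L] [Module Λ L] [Module.Free Λ L] [Module.Finite Λ L]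
  [AddCommGroup L'] [Module Λ L'] [Module.Free Λ L'] [Module.Finite Λ L']

/-- The sum of two forms on dual modules. -/
def sumDual (φ : StarDual Λ L →ₗ[Λ] StarDual Λ (StarDual Λ L))
    (φ' : StarDual Λ L' →ₗ[Λ] StarDual Λ (StarDual Λ L')) :
    StarDual Λ (L × L') →ₗ[Λ] StarDual Λ (StarDual Λ (L × L')) :=
  dualMap prodEquiv.symm.toLinearMap ∘ₗ sumMap φ φ' ∘ₗ prodEquiv.symm.toLinearMap

theorem sumDual_apply (φ : StarDual Λ L →ₗ[Λ] StarDual Λ (StarDual Λ L))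
    (φ' : StarDual Λ L' →ₗ[Λ] StarDual Λ (StarDual Λ L')) (f g : StarDual Λ (L × L')) :
    sumDual φ φ' f g = φ (prodEquiv.symm f).1 (prodEquiv.symm g).1 +
      φ' (prodEquiv.symm f).2 (prodEquiv.symm g).2 := rfl

theorem sumDual_isSymm {e : ℤˣ} {φ : StarDual Λ L →ₗ[Λ] StarDual Λ (StarDual Λ L)}
    {φ' : StarDual Λ L' →ₗ[Λ] StarDual Λ (StarDual Λ L')} (hφ : IsSymm e φ) (hφ' : IsSymm e φ') :
    IsSymm e (sumDual φ φ') := isSymm_iff.2 fun f g => by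
  rw [sumDual_apply, sumDual_apply, isSymm_iff.1 hφ, isSymm_iff.1 hφ', star_add, smul_add]

theorem sumDual_zero : sumDual (0 : StarDual Λ L →ₗ[Λ] StarDual Λ (StarDual Λ L))
    (0 : StarDual Λ L' →ₗ[Λ] StarDual Λ (StarDual Λ L')) = 0 := by
  refine LinearMap.ext fun f => StarDual.ext fun g => ?_
  rw [sumDual_apply]
  exact add_zero _

/-- The sum of two boundaries of hyperbolic forms is such a boundary. -/
def hypAdd {φ : StarDual Λ L →ₗ[Λ] StarDual Λ (StarDual Λ L)}
    {φ' : StarDual Λ L' →ₗ[Λ] StarDual Λ (StarDual Λ L')} (hφ : IsSymm (-eps q) φ)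
    (hφ' : IsSymm (-eps q) φ') :
    StrongIso ((Preform.hyp q L φ hφ).add (Preform.hyp q L' φ' hφ'))
      (Preform.hyp q (L × L') (sumDual φ φ') (sumDual_isSymm hφ hφ')) where
  eta := shuffle L L'
  zeta := shuffle L L'
  gamma_comm _ := rfl
  mu_comm g := by
    refine StarDual.ext fun x => ?_
    obtain ⟨x, rfl⟩ := (shuffle L L').surjective x
    rw [Preform.hyp_mu_apply, sumDual_apply]
    change (dualEquiv (shuffle L L') (sumMap _ _ g)) _ = _
    rw [dualEquiv_apply, LinearEquiv.symm_apply_apply, sumMap_apply, Preform.hyp_mu_apply,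
      Preform.hyp_mu_apply]
    have h1 : ∀ y : (L × StarDual Λ L) × (L' × StarDual Λ L'), (prodEquiv.symm ((shuffle L L') y).2).1 = y.1.2 := fun y => by
      change (prodEquiv.symm (prodEquiv (y.1.2, y.2.2))).1 = _
      rw [LinearEquiv.symm_apply_apply]
    have h2 : ∀ y : (L × StarDual Λ L) × (L' × StarDual Λ L'), (prodEquiv.symm ((shuffle L L') y).2).2 = y.2.2 := fun y => by
      change (prodEquiv.symm (prodEquiv (y.1.2, y.2.2))).2 = _
      rw [LinearEquiv.symm_apply_apply]
    rw [h1, h1, h2, h2]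
    change _ = (g.1.2 x.1.1 + g.2.2 x.2.1) + (-eps q • star (x.1.2 g.1.1 + x.2.2 g.2.1) + _)
    rw [star_add, smul_add]
    abel

end Hyp

/-- The boundary of `H^{-ε}(L, φ)` with `φ = 0` is `y^L`. -/
def hypZero {L : Type u} [AddCommGroup L] [Module Λ L] [Module.Free Λ L] [Module.Finite Λ L]
    (φ : StarDual Λ L →ₗ[Λ] StarDual Λ (StarDual Λ L)) (hφ : IsSymm (-eps q) φ) (h : φ = 0) :
    StrongIso (Preform.hyp q L φ hφ) (Preform.hyp0 q L) where
  eta := LinearEquiv.refl Λ _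
  zeta := LinearEquiv.refl Λ _
  gamma_comm _ := rfl
  mu_comm _ := by subst h; rfl

/-- The zero preformation is a boundary of a hyperbolic form. -/
def zeroHyp : StrongIso (Preform.zero Λ q) (Preform.hyp0 q PUnit) where
  eta := { toFun := fun _ => 0, invFun := fun _ => 0, map_add' := by simp, map_smul' := by simp
           left_inv := fun _ => rfl
           right_inv := fun x => Prod.ext rfl (StarDual.ext fun y => by
             rw [Subsingleton.elim y 0, map_zero, map_zero]) }
  zeta := { toFun := fun _ => 0, invFun := fun _ => 0, map_add' := by simp, map_smul' := by simp
            left_inv := fun _ => rfl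
            right_inv := fun x => Prod.ext rfl (StarDual.ext fun y => by
              rw [Subsingleton.elim y 0, map_zero, map_zero]) }
  gamma_comm _ := rfl
  mu_comm g := by
    rw [show (Preform.zero Λ q).mu g = 0 from rfl, map_zero]
    exact (map_zero (Preform.hyp0 q PUnit.{u + 1}).mu).symm

end StrongIso

/-! ### Flip-isomorphisms -/

/-- A flip-isomorphism `(α, β, σ)` of a regular preformation. -/
structure Flip (z : Preform Λ q) where
  alpha : z.F ≃ₗ[Λ] StarDual Λ z.F
  beta : z.G ≃ₗ[Λ] z.G
  sigma : StarDual Λ z.F →ₗ[Λ] z.F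
  /-- `σ ∈ Q^{-ε}(F^*)`. -/
  sigma_symm : IsSymm (-eps q) (eval ∘ₗ sigma)
  /-- `α γ + α σ μ = ε μ β`. -/
  cond_gamma : ∀ g, alpha (z.gamma g) + alpha (sigma (z.mu g)) = eps q • z.mu (beta g)
  /-- `α^{-*} μ = γ β`. -/
  cond_mu : ∀ g, (adjEquiv alpha).symm (z.mu g) = z.gamma (beta g)

/-- A flip-isomorphism `(α, β, ν)` of a regular split preformation; `σ` is determined by `ν`. -/
structure SplitFlip (z : SplitPreform Λ q) extends Flip z.toPreform where
  nu : QForm Λ (-eps q) (StarDual Λ z.F)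
  /-- `σ = (ν - ε ν^*)^*`. -/
  sigma_eq : eval ∘ₗ sigma = adj (QForm.symmetrize nu)
  /-- `θ + μ^* ν μ + β^* θ β = 0 ∈ Q_{-ε}(G)`. -/
  cond_theta : z.theta + QForm.pullback z.mu nu + QForm.pullback beta.toLinearMap z.theta = 0

@[simp] theorem adjEquiv_apply {M N : Type*} [AddCommGroup M] [Module Λ M] [AddCommGroup N]
    [Module Λ N] [Module.Free Λ N] [Module.Finite Λ N] (α : M ≃ₗ[Λ] StarDual Λ N) (y : N) (x : M) :
    adjEquiv α y x = star (α x y) := rfl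

theorem Flip.mu_eq {z : Preform Λ q} (t : Flip z) (g : z.G) (x : z.F) :
    z.mu g x = star (t.alpha x (z.gamma (t.beta g))) := by
  rw [← t.cond_mu, ← adjEquiv_apply, LinearEquiv.apply_symm_apply]

/-- The sum of flip-isomorphisms. -/
noncomputable def Flip.add {z w : Preform Λ q} (t : Flip z) (u : Flip w) : Flip (z.add w) where
  alpha := (LinearEquiv.prodCongr t.alpha u.alpha).trans prodEquiv
  beta := LinearEquiv.prodCongr t.beta u.beta
  sigma := LinearMap.prodMap t.sigma u.sigma ∘ₗ prodEquiv.symm.toLinearMap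
  sigma_symm := isSymm_iff.2 fun f g => by
    have h1 := isSymm_iff.1 t.sigma_symm (prodEquiv.symm f).1 (prodEquiv.symm g).1
    have h2 := isSymm_iff.1 u.sigma_symm (prodEquiv.symm f).2 (prodEquiv.symm g).2
    simp only [LinearMap.comp_apply, eval_apply, star_star] at h1 h2
    have key : ∀ f g : StarDual Λ (z.F × w.F),
        g (t.sigma (prodEquiv.symm f).1, u.sigma (prodEquiv.symm f).2) =
        (prodEquiv.symm g).1 (t.sigma (prodEquiv.symm f).1) +
        (prodEquiv.symm g).2 (u.sigma (prodEquiv.symm f).2) := fun f g => by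
      conv_lhs => rw [← prodEquiv.apply_symm_apply g]
      rfl
    change star (g (t.sigma (prodEquiv.symm f).1, u.sigma (prodEquiv.symm f).2)) =
      -eps q • star (star (f (t.sigma (prodEquiv.symm g).1, u.sigma (prodEquiv.symm g).2)))
    rw [key, key, star_star, star_add, h1, h2, smul_add]
  cond_gamma g := by
    change prodEquiv (t.alpha (z.gamma g.1), u.alpha (w.gamma g.2)) +
      prodEquiv (t.alpha (t.sigma (prodEquiv.symm (prodEquiv (z.mu g.1, w.mu g.2))).1),
        u.alpha (u.sigma (prodEquiv.symm (prodEquiv (z.mu g.1, w.mu g.2))).2)) =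
      eps q • prodEquiv (z.mu (t.beta g.1), w.mu (u.beta g.2))
    rw [LinearEquiv.symm_apply_apply, ← map_add, Prod.mk_add_mk, t.cond_gamma, u.cond_gamma]
    refine StarDual.ext fun x => ?_
    simp [smul_add]
  cond_mu g := by
    rw [LinearEquiv.symm_apply_eq]
    refine StarDual.ext fun x => ?_
    change z.mu g.1 x.1 + w.mu g.2 x.2 =
      star (t.alpha x.1 (z.gamma (t.beta g.1)) + u.alpha x.2 (w.gamma (u.beta g.2)))
    rw [t.mu_eq, u.mu_eq, star_add]

/-- The sum of flip-isomorphisms of split preformations. -/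
noncomputable def SplitFlip.add {z w : SplitPreform Λ q} (t : SplitFlip z) (u : SplitFlip w) :
    SplitFlip (z.add w) where
  toFlip := t.toFlip.add u.toFlip
  nu := QForm.pullback (prodEquiv.symm.toLinearMap) (t.nu.sum u.nu)
  sigma_eq := by
    refine LinearMap.ext fun f => StarDual.ext fun g => ?_
    have h1 := congrArg (fun h => h (prodEquiv.symm f).1 (prodEquiv.symm g).1) t.sigma_eq
    have h2 := congrArg (fun h => h (prodEquiv.symm f).2 (prodEquiv.symm g).2) u.sigma_eq
    simp only [LinearMap.comp_apply, eval_apply, adj_apply] at h1 h2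
    change star (g (t.sigma (prodEquiv.symm f).1, u.sigma (prodEquiv.symm f).2)) = star _
    rw [QForm.symmetrize_pullback, QForm.sum, map_add]
    change _ = star (QForm.symmetrize (QForm.pullback _ t.nu) (prodEquiv.symm g)
        (prodEquiv.symm f) +
      QForm.symmetrize (QForm.pullback _ u.nu) (prodEquiv.symm g) (prodEquiv.symm f))
    rw [QForm.symmetrize_pullback, QForm.symmetrize_pullback, star_add]
    change _ = star (QForm.symmetrize t.nu (prodEquiv.symm g).1 (prodEquiv.symm f).1) +
      star (QForm.symmetrize u.nu (prodEquiv.symm g).2 (prodEquiv.symm f).2)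
    rw [← h1, ← h2, ← star_add]
    congr 1
    conv_lhs => rw [← prodEquiv.apply_symm_apply g]
    rfl
  cond_theta := by
    have h1 := congrArg (QForm.pullback (LinearMap.fst Λ z.G w.G)) t.cond_theta
    have h2 := congrArg (QForm.pullback (LinearMap.snd Λ z.G w.G)) u.cond_theta
    simp only [map_add, map_zero, ← QForm.pullback_comp] at h1 h2
    have e1 : QForm.pullback (sumMap z.mu w.mu) (QForm.pullback (prodEquiv.symm.toLinearMap)
        (t.nu.sum u.nu)) = QForm.pullback (z.mu ∘ₗ LinearMap.fst Λ z.G w.G) t.nu +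
          QForm.pullback (w.mu ∘ₗ LinearMap.snd Λ z.G w.G) u.nu := by
      rw [← QForm.pullback_comp]
      have : prodEquiv.symm.toLinearMap ∘ₗ sumMap z.mu w.mu = LinearMap.prodMap z.mu w.mu := by
        refine LinearMap.ext fun g => ?_
        change prodEquiv.symm (prodEquiv _) = _
        rw [LinearEquiv.symm_apply_apply]
      rw [this, QForm.sum, map_add, ← QForm.pullback_comp, ← QForm.pullback_comp]
      rfl
    have e2 : QForm.pullback (LinearEquiv.prodCongr t.beta u.beta).toLinearMap
        (z.theta.sum w.theta) =
        QForm.pullback (t.beta.toLinearMap ∘ₗ LinearMap.fst Λ z.G w.G) z.theta +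
          QForm.pullback (u.beta.toLinearMap ∘ₗ LinearMap.snd Λ z.G w.G) w.theta := by
      rw [QForm.sum, map_add, ← QForm.pullback_comp, ← QForm.pullback_comp]
      rfl
    change z.theta.sum w.theta + QForm.pullback (sumMap z.mu w.mu) _ +
      QForm.pullback (LinearEquiv.prodCongr t.beta u.beta).toLinearMap (z.theta.sum w.theta) = 0
    rw [e1, e2, QForm.sum]
    have h3 := congrArg₂ (· + ·) h1 h2
    simp only [add_zero] at h3
    rw [← h3]
    abel

/-- The flip-isomorphism of the zero preformation. -/
noncomputable def Flip.zero : Flip (Preform.zero Λ q) where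
  alpha := { toFun := fun _ => 0, invFun := fun _ => 0, map_add' := by simp, map_smul' := by simp
             left_inv := fun _ => rfl
             right_inv := fun x => StarDual.ext fun y => by
               have : y = (0 : PUnit) := rfl
               subst this
               exact (map_zero _).symm.trans rfl |>.symm.trans (map_zero x).symm }
  beta := LinearEquiv.refl Λ _
  sigma := 0
  sigma_symm := isSymm_iff.2 fun f g => by simp
  cond_gamma g := by
    refine StarDual.ext fun y => ?_
    have : y = (0 : PUnit) := rfl
    subst this
    exact (map_zero _).trans (map_zero _).symm
  cond_mu _ := rfl

/-- The flip-isomorphism of the zero split preformation. -/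
noncomputable def SplitFlip.zero : SplitFlip (SplitPreform.zero Λ q) where
  toFlip := Flip.zero
  nu := 0
  sigma_eq := by
    refine LinearMap.ext fun f => StarDual.ext fun g => ?_
    rw [map_zero]
    change star (g 0) = star 0
    rw [map_zero]
  cond_theta := by
    change (0 : QForm Λ _ _) + QForm.pullback _ 0 + QForm.pullback _ 0 = 0
    rw [map_zero, map_zero, add_zero, add_zero]

/-- The isomorphism `α(x, f) = (-ε f, -x)` from `L ⊕ L^*` to its dual. -/
noncomputable def hypAlpha (e : ℤˣ) (L : Type u) [AddCommGroup L] [Module Λ L] [Module.Free Λ L]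
    [Module.Finite Λ L] : (L × StarDual Λ L) ≃ₗ[Λ] StarDual Λ (L × StarDual Λ L) :=
  (LinearEquiv.prodComm Λ L (StarDual Λ L)).trans
    ((LinearEquiv.prodCongr
      { toFun := fun f => -e • f
        invFun := fun f => -e • f
        map_add' := fun f g => smul_add _ f g
        map_smul' := fun _ _ => smul_comm _ _ _
        left_inv := fun f => units_smul_smul_self _ f
        right_inv := fun f => units_smul_smul_self _ f }
      ((LinearEquiv.neg Λ).trans (evalEquiv L))).trans prodEquiv)

theorem hypAlpha_apply (e : ℤˣ) (L : Type u) [AddCommGroup L] [Module Λ L] [Module.Free Λ L]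
    [Module.Finite Λ L] (x y : L × StarDual Λ L) :
    hypAlpha e L x y = -e • x.2 y.1 - star (y.2 x.1) := by
  change (-e • x.2) y.1 + star (y.2 (-x.1)) = _
  rw [units_smul_apply, map_neg, star_neg, sub_eq_add_neg]

/-- The flip-isomorphism `t^L` of `y^L`: `α(x, f) = (-ε f, -x)`, `β(x, f) = (x, -f)`, `σ = 0`. -/
noncomputable def Flip.hyp0 (q : ℕ) (L : Type u) [AddCommGroup L] [Module Λ L] [Module.Free Λ L]
    [Module.Finite Λ L] : Flip (Preform.hyp0 (Λ := Λ) q L) where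
  alpha := hypAlpha (eps q) L
  beta := LinearEquiv.prodCongr (LinearEquiv.refl Λ L) (LinearEquiv.neg Λ)
  sigma := 0
  sigma_symm := isSymm_iff.2 fun f g => by simp
  cond_gamma g := by
    refine StarDual.ext fun x => ?_
    rw [LinearMap.zero_apply, map_zero, add_zero, units_smul_apply, Preform.hyp_mu_apply]
    change hypAlpha (eps q) L g x = eps q • ((-g.2) x.1 + (-eps q • star (x.2 g.1) + 0))
    rw [hypAlpha_apply, add_zero, smul_add, smul_smul, mul_neg, Int.units_mul_self,
      StarDual.neg_apply, smul_neg, Units.neg_smul, Units.neg_smul, one_smul, sub_eq_add_neg]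
  cond_mu g := by
    rw [LinearEquiv.symm_apply_eq]
    refine StarDual.ext fun x => ?_
    rw [adjEquiv_apply, Preform.hyp_mu_apply]
    change _ = star (hypAlpha (eps q) L x (g.1, -g.2))
    rw [hypAlpha_apply]
    simp only [LinearMap.zero_apply, StarDual.zero_apply, StarDual.neg_apply, star_neg, star_star,
      add_zero, star_sub, star_units_smul]
    abel

/-- The flip-isomorphism `t^L` of the split preformation `y^L`; here `ν = 0`. -/
noncomputable def SplitFlip.hyp0 (q : ℕ) (L : Type u) [AddCommGroup L] [Module Λ L]
    [Module.Free Λ L] [Module.Finite Λ L] : SplitFlip (SplitPreform.hyp0 (Λ := Λ) q L) where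
  toFlip := Flip.hyp0 q L
  nu := 0
  sigma_eq := by
    refine LinearMap.ext fun f => StarDual.ext fun g => ?_
    rw [map_zero]
    change star (g 0) = star 0
    rw [map_zero]
  cond_theta := by
    rw [map_zero, add_zero, QForm.pullback_mk]
    change QForm.mk (-eps q) (_ + _) = _
    rw [show (prodEquiv.toLinearMap ∘ₗ LinearMap.prod (LinearMap.snd Λ L (StarDual Λ L)) 0 +
      dualMap (Flip.hyp0 (Λ := Λ) q L).beta.toLinearMap ∘ₗ (prodEquiv.toLinearMap ∘ₗ
        LinearMap.prod (LinearMap.snd Λ L (StarDual Λ L)) 0) ∘ₗ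
          (Flip.hyp0 (Λ := Λ) q L).beta.toLinearMap) = 0 from ?_]
    · rfl
    · refine LinearMap.ext fun g => StarDual.ext fun h => ?_
      change (g.2 h.1 + 0) + ((-g.2) h.1 + 0) = 0
      rw [StarDual.neg_apply]
      abel

end Preformations

end Kreck

namespace Kreck

open StarDual

/-! ### Linking forms of preformations -/

section PreformLinking

variable {Λ : Type u} [Ring Λ] [StarRing Λ] {S : Submonoid Λ} [IsCentralMul S] {q : ℕ}

/-- Both `γ` and `μ` are `S`-isomorphisms. -/
structure Preform.IsS (S : Submonoid Λ) [IsCentralMul S] (z : Preform Λ q) : Prop where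
  gamma : IsSIso S z.gamma
  mu : IsSIso S z.mu

/-- `coker μ`. -/
abbrev Preform.cokerMu (z : Preform Λ q) := StarDual Λ z.F ⧸ LinearMap.range z.mu

/-- `coker γ`. -/
abbrev Preform.cokerGamma (z : Preform Λ q) := z.F ⧸ LinearMap.range z.gamma

theorem Preform.dualMap_gamma_mu (z : Preform Λ q) (g h : z.G) :
    dualMap z.gamma (z.mu g) h = -eps q • star (dualMap z.gamma (z.mu h) g) := z.mu_gamma g h

theorem Preform.adj_mu_gamma (z : Preform Λ q) (g h : z.G) :
    (eps q • adj z.mu) (z.gamma g) h = -eps q • star ((eps q • adj z.mu) (z.gamma h) g) := by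
  rw [LinearMap.smul_apply, LinearMap.smul_apply, units_smul_apply, units_smul_apply, adj_apply,
    adj_apply, star_units_smul, star_star, smul_smul, neg_mul, Int.units_mul_self, z.mu_gamma g h,
    Units.neg_smul, Units.neg_smul, one_smul, neg_neg]

/-- The `(-ε)`-symmetric linking form `L^μ` on `coker μ`: `(x, y) ↦ s⁻¹ * γ^*(x)(g)` for
`s • y = μ(g)`. -/
noncomputable def Preform.linkMu (z : Preform Λ q) (hz : z.IsS S) :
    LinkingForm S (-eps q) z.cokerMu :=
  cokerLinking hz.mu z.dualMap_gamma_mu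

/-- The `(-ε)`-symmetric linking form `L^γ` on `coker γ`: `(x, y) ↦ ε * s⁻¹ * μ^*(x)(g)` for
`s • y = γ(g)`. -/
noncomputable def Preform.linkGamma (z : Preform Λ q) (hz : z.IsS S) :
    LinkingForm S (-eps q) z.cokerGamma :=
  cokerLinking hz.gamma z.adj_mu_gamma

theorem SplitPreform.theta_gamma_mu (z : SplitPreform Λ q) (g h : z.G) :
    QForm.symmetrize z.theta g h = dualMap z.gamma (z.mu g) h := by
  rw [z.symmetrize_theta]; rfl

theorem SplitPreform.neg_theta_gamma (z : SplitPreform Λ q) (g h : z.G) :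
    QForm.symmetrize (-z.theta) g h = (eps q • adj z.mu) (z.gamma g) h := by
  rw [map_neg, z.symmetrize_theta, LinearMap.smul_apply, units_smul_apply, adj_apply]
  change -(z.mu g (z.gamma h)) = _
  rw [z.mu_gamma, Units.neg_smul, neg_neg]

/-- The split `(-ε)`-quadratic linking form `L_μ` on `coker μ`; its quadratic part is
`y ↦ s⁻¹ * θ(g)(g) * star s⁻¹` for `s • y = μ(g)`. -/
noncomputable def SplitPreform.linkMu (z : SplitPreform Λ q) (hz : z.IsS S) :
    SplitLinkingForm S (-eps q) z.cokerMu :=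
  cokerSplitLinking hz.mu z.dualMap_gamma_mu z.theta_gamma_mu

/-- The split `(-ε)`-quadratic linking form `L_γ` on `coker γ`; its quadratic part is
`y ↦ -s⁻¹ * θ(g)(g) * star s⁻¹` for `s • y = γ(g)`. -/
noncomputable def SplitPreform.linkGamma (z : SplitPreform Λ q) (hz : z.IsS S) :
    SplitLinkingForm S (-eps q) z.cokerGamma :=
  cokerSplitLinking hz.gamma z.adj_mu_gamma z.neg_theta_gamma

theorem Preform.linkMu_mk (z : Preform Λ q) (hz : z.IsS S) (x y : StarDual Λ z.F) :
    (z.linkMu hz).form (Submodule.Quotient.mk x) (Submodule.Quotient.mk y) =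
      LocMod.mk S (pair hz.mu (dualMap z.gamma) x y) := rfl

theorem Preform.linkGamma_mk (z : Preform Λ q) (hz : z.IsS S) (x y : z.F) :
    (z.linkGamma hz).form (Submodule.Quotient.mk x) (Submodule.Quotient.mk y) =
      LocMod.mk S (pair hz.gamma (eps q • adj z.mu) x y) := rfl

theorem SplitPreform.linkMu_mk (z : SplitPreform Λ q) (hz : z.IsS S) (y : StarDual Λ z.F) :
    (z.linkMu hz).quad (Submodule.Quotient.mk y) = preQuad hz.mu z.theta y := rfl

theorem SplitPreform.linkGamma_mk (z : SplitPreform Λ q) (hz : z.IsS S) (y : z.F) :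
    (z.linkGamma hz).quad (Submodule.Quotient.mk y) = preQuad hz.gamma (-z.theta) y := rfl

/-! ### The isometry of linking forms induced by a flip-isomorphism -/

theorem Flip.map_range {z : Preform Λ q} (t : Flip z) :
    (LinearMap.range z.mu).map ((adjEquiv t.alpha).symm : StarDual Λ z.F →ₗ[Λ] z.F) =
      LinearMap.range z.gamma := by
  ext x
  constructor
  · rintro ⟨_, ⟨g, rfl⟩, rfl⟩
    exact ⟨t.beta g, (t.cond_mu g).symm⟩
  · rintro ⟨g, rfl⟩
    refine ⟨z.mu (t.beta.symm g), ⟨_, rfl⟩, ?_⟩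
    have := t.cond_mu (t.beta.symm g)
    rw [LinearEquiv.apply_symm_apply] at this
    exact this

/-- The isomorphism `[α^{-*}] : coker μ → coker γ`. -/
noncomputable def Flip.cokerEquiv {z : Preform Λ q} (t : Flip z) : z.cokerMu ≃ₗ[Λ] z.cokerGamma :=
  Submodule.Quotient.equiv _ _ (adjEquiv t.alpha).symm t.map_range

@[simp] theorem Flip.cokerEquiv_mk {z : Preform Λ q} (t : Flip z) (x : StarDual Λ z.F) :
    t.cokerEquiv (Submodule.Quotient.mk x) =
      Submodule.Quotient.mk ((adjEquiv t.alpha).symm x) := rfl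

theorem Flip.denom {z : Preform Λ q} (t : Flip z) {s : S} {y : StarDual Λ z.F} {g : z.G}
    (h : (s : Λ) • y = z.mu g) :
    (s : Λ) • (adjEquiv t.alpha).symm y = z.gamma (t.beta g) := by
  rw [← map_smul, h, t.cond_mu]

/-- The isometry `[α^{-*}] : L^μ → L^γ` induced by a flip-isomorphism. -/
noncomputable def Flip.isometry {z : Preform Λ q} (t : Flip z) (hz : z.IsS S) :
    (z.linkMu hz).Isometry (z.linkGamma hz) where
  toLinearEquiv := t.cokerEquiv
  map_form x y := by
    obtain ⟨x, rfl⟩ := Submodule.Quotient.mk_surjective _ x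
    obtain ⟨y, rfl⟩ := Submodule.Quotient.mk_surjective _ y
    rw [t.cokerEquiv_mk, t.cokerEquiv_mk, z.linkMu_mk, z.linkGamma_mk]
    obtain ⟨s, g, h⟩ := hz.mu.exists_denom y
    rw [pair_eq hz.mu _ _ h, pair_eq hz.gamma _ _ (t.denom h)]
    obtain ⟨w, rfl⟩ := (adjEquiv t.alpha).surjective x
    rw [LinearEquiv.symm_apply_apply, LinearMap.smul_apply, units_smul_apply, adj_apply,
      ← star_units_smul, ← units_smul_apply, ← t.cond_gamma, StarDual.add_apply, star_add,
      ← div_add_div_same, map_add, ← h, map_smul, map_smul, StarDual.smul_apply, star_mul,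
      star_star, mul_div_self, LocMod.mk_toLoc, add_zero]
    rfl

/-- The isometry `[α^{-*}] : L_μ → L_γ` induced by a flip-isomorphism of split preformations. -/
noncomputable def SplitFlip.isometry {z : SplitPreform Λ q} (t : SplitFlip z) (hz : z.IsS S) :
    (z.linkMu hz).Isometry (z.linkGamma hz) where
  toIsometry := t.toFlip.isometry hz
  map_quad y := by
    obtain ⟨y, rfl⟩ := Submodule.Quotient.mk_surjective _ y
    change (z.linkGamma hz).quad (Submodule.Quotient.mk ((adjEquiv t.alpha).symm y)) = _
    rw [z.linkMu_mk, z.linkGamma_mk]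
    obtain ⟨s, g, h⟩ := hz.mu.exists_denom y
    rw [preQuad_eq hz.mu h, preQuad_eq hz.gamma (t.denom h)]
    have h1 := congrArg (fun ψ => QForm.value ψ g) t.cond_theta
    simp only [QForm.value_add, QForm.value_pullback, QForm.value_zero] at h1
    have h2 : QLoc.scale S (-eps q) s (t.nu.value (z.mu g)) = 0 := by
      have h3 := scale_value_smul (S := S) t.nu 1 s y
      rw [mul_one, h] at h3
      rw [h3]
      generalize t.nu.value y = c
      induction c using QuotientAddGroup.induction_on with | H c =>
      rw [QLoc.scale_mk, ← QLoc.mk_toLoc S (-eps q) c, toLoc_apply]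
      congr 1
      rw [loc_eq_iff]
      simp
    rw [QForm.value_neg, map_neg]
    have h4 := congrArg (QLoc.scale S (-eps q) s) h1
    rw [map_add, map_add, h2, add_zero, map_zero] at h4
    exact (eq_neg_of_add_eq_zero_left h4).symm

/-! ### Sums of isometries -/

theorem Preform.IsS.add {z w : Preform Λ q} (hz : z.IsS S) (hw : w.IsS S) :
    (z.add w).IsS S where
  gamma := hz.gamma.prodMap hw.gamma
  mu := (hz.mu.prodMap hw.mu).comp_equiv prodEquiv

theorem Preform.IsS.zero : (Preform.zero Λ q).IsS S where
  gamma := IsSIso.of_bijective ⟨fun _ _ _ => rfl, fun x => ⟨x, rfl⟩⟩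
  mu := IsSIso.of_bijective ⟨fun _ _ _ => rfl, fun x => ⟨0, by
    refine StarDual.ext fun y => ?_
    obtain rfl : y = 0 := rfl
    rw [map_zero, map_zero]⟩⟩

section CokerProd

variable {G G' X X' Y : Type u} [AddCommGroup G] [Module Λ G] [AddCommGroup G'] [Module Λ G']
  [AddCommGroup X] [Module Λ X] [AddCommGroup X'] [Module Λ X'] [AddCommGroup Y] [Module Λ Y]

variable {d : G →ₗ[Λ] X} {d' : G' →ₗ[Λ] X'} {dd : (G × G') →ₗ[Λ] Y} (e : (X × X') ≃ₗ[Λ] Y)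
  (hdd : ∀ g, dd g = e (d g.1, d' g.2))

/-- The map `coker (d ⊕ d') → coker d ⊕ coker d'`, up to an identification `e` of the target. -/
def cokerProdMap : (Y ⧸ LinearMap.range dd) →ₗ[Λ]
    (X ⧸ LinearMap.range d) × (X' ⧸ LinearMap.range d') :=
  (LinearMap.range dd).liftQ
    (LinearMap.prodMap (LinearMap.range d).mkQ (LinearMap.range d').mkQ ∘ₗ e.symm.toLinearMap)
    (by
      rintro _ ⟨g, rfl⟩
      rw [LinearMap.mem_ker, LinearMap.comp_apply, LinearEquiv.coe_coe, hdd,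
        LinearEquiv.symm_apply_apply]
      exact Prod.ext ((Submodule.Quotient.mk_eq_zero _).2 ⟨g.1, rfl⟩)
        ((Submodule.Quotient.mk_eq_zero _).2 ⟨g.2, rfl⟩))

theorem cokerProdMap_mk (x : X × X') :
    cokerProdMap e hdd (Submodule.Quotient.mk (e x)) =
      (Submodule.Quotient.mk x.1, Submodule.Quotient.mk x.2) := by
  rw [cokerProdMap, Submodule.liftQ_apply, LinearMap.comp_apply, LinearEquiv.coe_coe,
    LinearEquiv.symm_apply_apply]
  rfl

theorem cokerProdMap_bijective : Function.Bijective (cokerProdMap e hdd) := by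
  constructor
  · rw [injective_iff_map_eq_zero]
    intro y hy
    obtain ⟨y, rfl⟩ := Submodule.Quotient.mk_surjective _ y
    obtain ⟨x, rfl⟩ := e.surjective y
    rw [cokerProdMap_mk] at hy
    obtain ⟨g, hg⟩ := (Submodule.Quotient.mk_eq_zero _).1 (congrArg Prod.fst hy)
    obtain ⟨g', hg'⟩ := (Submodule.Quotient.mk_eq_zero _).1 (congrArg Prod.snd hy)
    exact (Submodule.Quotient.mk_eq_zero _).2
      ⟨(g, g'), (hdd _).trans (congrArg e (Prod.ext hg hg'))⟩
  · rintro ⟨x, x'⟩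
    obtain ⟨x, rfl⟩ := Submodule.Quotient.mk_surjective _ x
    obtain ⟨x', rfl⟩ := Submodule.Quotient.mk_surjective _ x'
    exact ⟨Submodule.Quotient.mk (e (x, x')), cokerProdMap_mk e hdd (x, x')⟩

/-- `coker (d ⊕ d') = coker d ⊕ coker d'`, up to an identification `e` of the target. -/
noncomputable def cokerProd : (Y ⧸ LinearMap.range dd) ≃ₗ[Λ]
    (X ⧸ LinearMap.range d) × (X' ⧸ LinearMap.range d') :=
  LinearEquiv.ofBijective (cokerProdMap e hdd) (cokerProdMap_bijective e hdd)

theorem cokerProd_mk (x : X × X') :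
    cokerProd e hdd (Submodule.Quotient.mk (e x)) =
      (Submodule.Quotient.mk x.1, Submodule.Quotient.mk x.2) := cokerProdMap_mk e hdd x

end CokerProd

variable {z w : Preform Λ q}

/-- The sum of isomorphisms `coker μ → coker γ` and `coker μ' → coker γ'`. -/
noncomputable def sumCoker (l : z.cokerMu ≃ₗ[Λ] z.cokerGamma) (m : w.cokerMu ≃ₗ[Λ] w.cokerGamma) :
    (z.add w).cokerMu ≃ₗ[Λ] (z.add w).cokerGamma :=
  ((cokerProd (d := z.mu) (d' := w.mu) prodEquiv fun _ => rfl).trans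
    (LinearEquiv.prodCongr l m)).trans
    (cokerProd (d := z.gamma) (d' := w.gamma) (LinearEquiv.refl Λ _) fun _ => rfl).symm

theorem sumCoker_mk (l : z.cokerMu ≃ₗ[Λ] z.cokerGamma) (m : w.cokerMu ≃ₗ[Λ] w.cokerGamma)
    (x : StarDual Λ z.F × StarDual Λ w.F) (y : z.F × w.F) :
    sumCoker l m (Submodule.Quotient.mk (prodEquiv x)) = Submodule.Quotient.mk y ↔
      l (Submodule.Quotient.mk x.1) = Submodule.Quotient.mk y.1 ∧
        m (Submodule.Quotient.mk x.2) = Submodule.Quotient.mk y.2 := by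
  rw [sumCoker, LinearEquiv.trans_apply, LinearEquiv.symm_apply_eq]
  have h1 := cokerProd_mk (d := z.mu) (d' := w.mu) (dd := (z.add w).mu) prodEquiv (fun _ => rfl) x
  have h2 := cokerProd_mk (d := z.gamma) (d' := w.gamma) (dd := (z.add w).gamma)
    (LinearEquiv.refl Λ _) (fun _ => rfl) y
  rw [LinearEquiv.trans_apply, h1]
  refine Iff.trans (Eq.congr rfl h2) ?_
  exact Prod.ext_iff

theorem pair_prod_mu (hz : z.IsS S) (hw : w.IsS S) (x y : StarDual Λ z.F × StarDual Λ w.F) :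
    pair (hz.add hw).mu (dualMap (z.add w).gamma) (prodEquiv x) (prodEquiv y) =
      pair hz.mu (dualMap z.gamma) x.1 y.1 + pair hw.mu (dualMap w.gamma) x.2 y.2 := by
  obtain ⟨s, g, h⟩ := (hz.mu.prodMap hw.mu).exists_denom y
  have h1 : (s : Λ) • y.1 = z.mu g.1 := congrArg Prod.fst h
  have h2 : (s : Λ) • y.2 = w.mu g.2 := congrArg Prod.snd h
  have h3 : (s : Λ) • prodEquiv y = (z.add w).mu g := by
    rw [← map_smul, h]; rfl
  rw [pair_eq _ _ _ h1, pair_eq _ _ _ h2, pair_eq _ _ _ h3, div_add_div_same]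
  rfl

theorem pair_prod_gamma (hz : z.IsS S) (hw : w.IsS S) (x y : z.F × w.F) :
    pair (hz.add hw).gamma (eps q • adj (z.add w).mu) x y =
      pair hz.gamma (eps q • adj z.mu) x.1 y.1 + pair hw.gamma (eps q • adj w.mu) x.2 y.2 := by
  obtain ⟨s, g, h⟩ := (hz.add hw).gamma.exists_denom y
  have h1 : (s : Λ) • y.1 = z.gamma g.1 := congrArg Prod.fst h
  have h2 : (s : Λ) • y.2 = w.gamma g.2 := congrArg Prod.snd h
  rw [pair_eq _ _ _ h1, pair_eq _ _ _ h2, pair_eq _ _ _ h, div_add_div_same]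
  congr 1
  simp only [LinearMap.smul_apply, units_smul_apply, adj_apply, sumMap_apply, star_add, smul_add]

/-- The sum of isometries of linking forms. -/
noncomputable def sumIsometry {hz : z.IsS S} {hw : w.IsS S}
    (l : (z.linkMu hz).Isometry (z.linkGamma hz)) (m : (w.linkMu hw).Isometry (w.linkGamma hw)) :
    ((z.add w).linkMu (hz.add hw)).Isometry ((z.add w).linkGamma (hz.add hw)) where
  toLinearEquiv := sumCoker l.toLinearEquiv m.toLinearEquiv
  map_form x y := by
    obtain ⟨x, rfl⟩ := Submodule.Quotient.mk_surjective _ x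
    obtain ⟨y, rfl⟩ := Submodule.Quotient.mk_surjective _ y
    obtain ⟨x, rfl⟩ := prodEquiv.surjective x
    obtain ⟨y, rfl⟩ := prodEquiv.surjective y
    obtain ⟨x1, hx1⟩ := Submodule.Quotient.mk_surjective _ (l.toLinearEquiv (Submodule.Quotient.mk x.1))
    obtain ⟨x2, hx2⟩ := Submodule.Quotient.mk_surjective _ (m.toLinearEquiv (Submodule.Quotient.mk x.2))
    obtain ⟨y1, hy1⟩ := Submodule.Quotient.mk_surjective _ (l.toLinearEquiv (Submodule.Quotient.mk y.1))
    obtain ⟨y2, hy2⟩ := Submodule.Quotient.mk_surjective _ (m.toLinearEquiv (Submodule.Quotient.mk y.2))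
    rw [(sumCoker_mk _ _ x (x1, x2)).2 ⟨hx1.symm, hx2.symm⟩,
      (sumCoker_mk _ _ y (y1, y2)).2 ⟨hy1.symm, hy2.symm⟩, Preform.linkMu_mk,
      Preform.linkGamma_mk, pair_prod_mu hz hw, pair_prod_gamma hz hw, map_add, map_add,
      ← z.linkMu_mk hz, ← w.linkMu_mk hw, ← z.linkGamma_mk hz, ← w.linkGamma_mk hw,
      hx1, hx2, hy1, hy2, l.map_form, m.map_form]

theorem preQuad_prod {G G' X X' Y : Type u} [AddCommGroup G] [Module Λ G] [AddCommGroup G']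
    [Module Λ G'] [AddCommGroup X] [Module Λ X] [AddCommGroup X'] [Module Λ X'] [AddCommGroup Y]
    [Module Λ Y] [Module.Free Λ G] [Module.Free Λ G'] {d : G →ₗ[Λ] X} {d' : G' →ₗ[Λ] X'}
    {dd : (G × G') →ₗ[Λ] Y} (e : (X × X') ≃ₗ[Λ] Y) (hdd : ∀ g, dd g = e (d g.1, d' g.2))
    (hd : IsSIso S d) (hd' : IsSIso S d') (h : IsSIso S dd) {ε : ℤˣ}
    (θ : QForm Λ ε G) (θ' : QForm Λ ε G') (y : X × X') :
    preQuad h (θ.sum θ') (e y) = preQuad hd θ y.1 + preQuad hd' θ' y.2 := by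
  obtain ⟨s, g, hs⟩ := h.exists_denom (e y)
  have hs' : (s : Λ) • y = (d g.1, d' g.2) := e.injective (by rw [map_smul, hs, hdd])
  rw [preQuad_eq h hs, preQuad_eq hd (congrArg Prod.fst hs'), preQuad_eq hd' (congrArg Prod.snd hs'),
    ← map_add, QForm.sum, QForm.value_add, QForm.value_pullback, QForm.value_pullback]
  rfl

/-- The sum of isometries of split linking forms. -/
noncomputable def sumSplitIsometry {z w : SplitPreform Λ q} {hz : z.IsS S} {hw : w.IsS S}
    (l : (z.linkMu hz).Isometry (z.linkGamma hz)) (m : (w.linkMu hw).Isometry (w.linkGamma hw)) :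
    ((z.add w).linkMu (hz.add hw)).Isometry ((z.add w).linkGamma (hz.add hw)) where
  toIsometry := sumIsometry (hz := hz) (hw := hw) l.toIsometry m.toIsometry
  map_quad x := by
    obtain ⟨x, rfl⟩ := Submodule.Quotient.mk_surjective _ x
    obtain ⟨x, rfl⟩ := prodEquiv.surjective x
    obtain ⟨x1, hx1⟩ := Submodule.Quotient.mk_surjective _ (l.toLinearEquiv (Submodule.Quotient.mk x.1))
    obtain ⟨x2, hx2⟩ := Submodule.Quotient.mk_surjective _ (m.toLinearEquiv (Submodule.Quotient.mk x.2))
    have h1 : (sumIsometry (hz := hz) (hw := hw) l.toIsometry m.toIsometry).toLinearEquiv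
        (Submodule.Quotient.mk (prodEquiv x)) = Submodule.Quotient.mk (x1, x2) :=
      (sumCoker_mk _ _ x (x1, x2)).2 ⟨hx1.symm, hx2.symm⟩
    rw [h1, SplitPreform.linkMu_mk, SplitPreform.linkGamma_mk]
    have h2 := preQuad_prod (ε := -eps q) (LinearEquiv.refl Λ (z.F × w.F)) (fun _ => rfl) hz.gamma
      hw.gamma (hz.add hw).gamma (-z.theta) (-w.theta) (x1, x2)
    have h3 := preQuad_prod (ε := -eps q) (prodEquiv (M := z.F) (N := w.F)) (fun _ => rfl) hz.mu
      hw.mu (hz.add hw).mu z.theta w.theta x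
    have h4 : -(z.theta.sum w.theta) = (-z.theta).sum (-w.theta) := by
      rw [QForm.sum, QForm.sum, map_neg, map_neg, neg_add]
    refine ((congrArg (fun t => preQuad (hz.add hw).gamma t (x1, x2)) h4).trans h2).trans
      (Eq.trans ?_ h3.symm)
    rw [← z.linkMu_mk hz, ← w.linkMu_mk hw, ← l.map_quad, ← m.map_quad, ← hx1, ← hx2]
    rfl

end PreformLinking

end Kreck

namespace Kreck

open StarDual

/-! ### Monoids of stable isomorphism classes -/

/-- The data needed to form a monoid of stable isomorphism classes: a sum, a zero, an isomorphism
relation, and a class of stabilizing objects. -/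
structure StableSystem (X : Type v) where
  add : X → X → X
  zero : X
  Iso : X → X → Prop
  Stab : X → Prop
  iso_equiv : Equivalence Iso
  iso_add : ∀ {x x' y y'}, Iso x x' → Iso y y' → Iso (add x y) (add x' y')
  iso_comm : ∀ x y, Iso (add x y) (add y x)
  iso_assoc : ∀ x y w, Iso (add (add x y) w) (add x (add y w))
  iso_zero : ∀ x, Iso (add zero x) x
  stab_zero : Stab zero
  stab_add : ∀ {x y}, Stab x → Stab y → Stab (add x y)

namespace StableSystem

variable {X : Type*} {Y : Type*} (A : StableSystem X) (B : StableSystem Y)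

/-- Stable isomorphism. -/
def StableIso (x y : X) : Prop :=
  ∃ h h', A.Stab h ∧ A.Stab h' ∧ A.Iso (A.add x h) (A.add y h')

theorem iso_comm₃ (x y w : X) : A.Iso (A.add (A.add x y) w) (A.add (A.add x w) y) :=
  A.iso_equiv.trans (A.iso_assoc _ _ _) (A.iso_equiv.trans
    (A.iso_add (A.iso_equiv.refl _) (A.iso_comm _ _)) (A.iso_equiv.symm (A.iso_assoc _ _ _)))

theorem iso_comm₄ (x y w v : X) :
    A.Iso (A.add (A.add x y) (A.add w v)) (A.add (A.add x w) (A.add y v)) :=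
  A.iso_equiv.trans (A.iso_equiv.symm (A.iso_assoc _ _ _)) (A.iso_equiv.trans
    (A.iso_add (A.iso_comm₃ _ _ _) (A.iso_equiv.refl _)) (A.iso_assoc _ _ _))

theorem stableIso_of_iso {x y : X} (h : A.Iso x y) : A.StableIso x y :=
  ⟨A.zero, A.zero, A.stab_zero, A.stab_zero, A.iso_add h (A.iso_equiv.refl _)⟩

theorem stableIso_equiv : Equivalence A.StableIso where
  refl x := A.stableIso_of_iso (A.iso_equiv.refl x)
  symm := fun ⟨h, h', s, s', i⟩ => ⟨h', h, s', s, A.iso_equiv.symm i⟩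
  trans := by
    rintro x y w ⟨h, h', s, s', i⟩ ⟨k, k', r, r', j⟩
    refine ⟨A.add h k, A.add k' h', A.stab_add s r, A.stab_add r' s', ?_⟩
    have e1 := A.iso_equiv.symm (A.iso_assoc x h k)
    have e2 := A.iso_add i (A.iso_equiv.refl k)
    have e3 := A.iso_comm₃ y h' k
    have e4 := A.iso_add j (A.iso_equiv.refl h')
    have e5 := A.iso_assoc w k' h'
    exact A.iso_equiv.trans e1 (A.iso_equiv.trans e2 (A.iso_equiv.trans e3
      (A.iso_equiv.trans e4 e5)))

theorem stableIso_add {x x' y y' : X} (h : A.StableIso x x') (k : A.StableIso y y') :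
    A.StableIso (A.add x y) (A.add x' y') := by
  obtain ⟨h, h', s, s', i⟩ := h
  obtain ⟨k, k', r, r', j⟩ := k
  exact ⟨A.add h k, A.add h' k', A.stab_add s r, A.stab_add s' r',
    A.iso_equiv.trans (A.iso_comm₄ _ _ _ _) (A.iso_equiv.trans (A.iso_add i j)
      (A.iso_comm₄ _ _ _ _))⟩

/-- Stable isomorphism as a setoid. -/
def setoid : Setoid X := ⟨A.StableIso, A.stableIso_equiv⟩

/-- The set of stable isomorphism classes. -/
def Class := Quotient A.setoid

variable {A} in
/-- The stable isomorphism class of an object. -/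
def cls (x : X) : A.Class := Quotient.mk A.setoid x

theorem cls_eq_of_iso {x y : X} (h : A.Iso x y) : (cls x : A.Class) = cls y :=
  Quotient.sound (A.stableIso_of_iso h)

instance : AddCommMonoid A.Class where
  add := Quotient.map₂ A.add fun _ _ h _ _ k => A.stableIso_add h k
  zero := cls A.zero
  nsmul := @nsmulRec _ ⟨cls A.zero⟩ ⟨Quotient.map₂ A.add fun _ _ h _ _ k => A.stableIso_add h k⟩
  add_assoc := by
    rintro ⟨x⟩ ⟨y⟩ ⟨w⟩; exact A.cls_eq_of_iso (A.iso_assoc x y w)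
  zero_add := by
    rintro ⟨x⟩; exact A.cls_eq_of_iso (A.iso_zero x)
  add_zero := by
    rintro ⟨x⟩; exact A.cls_eq_of_iso (A.iso_equiv.trans (A.iso_comm _ _) (A.iso_zero x))
  add_comm := by
    rintro ⟨x⟩ ⟨y⟩; exact A.cls_eq_of_iso (A.iso_comm x y)

theorem cls_add (x y : X) : (cls (A.add x y) : A.Class) = cls x + cls y := rfl

theorem cls_stab {x : X} (h : A.Stab x) : (cls x : A.Class) = 0 :=
  Quotient.sound ⟨A.zero, A.add A.zero x, A.stab_zero, A.stab_add A.stab_zero h,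
    A.iso_equiv.trans (A.iso_comm _ _) (A.iso_add (A.iso_equiv.refl _)
      (A.iso_equiv.symm (A.iso_zero x)))⟩

variable {A B}

/-- The homomorphism of monoids of stable isomorphism classes induced by an additive
construction. -/
def map (f : X → Y) (f_iso : ∀ {x y}, A.Iso x y → B.Iso (f x) (f y))
    (f_add : ∀ x y, B.Iso (f (A.add x y)) (B.add (f x) (f y)))
    (f_zero : B.Iso (f A.zero) B.zero) (f_stab : ∀ {x}, A.Stab x → B.Stab (f x)) :
    A.Class →+ B.Class where
  toFun := Quotient.map f fun x y ⟨h, h', s, s', i⟩ => ⟨f h, f h', f_stab s, f_stab s',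
    B.iso_equiv.trans (B.iso_equiv.symm (f_add x h)) (B.iso_equiv.trans (f_iso i) (f_add y h'))⟩
  map_zero' := B.cls_eq_of_iso f_zero
  map_add' := by
    rintro ⟨x⟩ ⟨y⟩; exact B.cls_eq_of_iso (f_add x y)

end StableSystem

/-! ### The asymmetric Witt group -/

section Asym

variable {Λ : Type u} [Ring Λ] [StarRing Λ]

/-- A non-singular asymmetric form over `Λ`. -/
structure AsymForm (Λ : Type u) [Ring Λ] [StarRing Λ] where
  M : Type u
  [addCommGroup : AddCommGroup M]
  [module : Module Λ M]
  [free : Module.Free Λ M]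
  [finite : Module.Finite Λ M]
  form : M →ₗ[Λ] StarDual Λ M
  nonsing : Function.Bijective form

attribute [instance] AsymForm.addCommGroup AsymForm.module AsymForm.free AsymForm.finite

namespace AsymForm

/-- A lagrangian: a direct summand `L` with `L = L^⊥ = {x | ρ(x)(L) = 0}`. -/
def IsLagrangian (A : AsymForm Λ) (L : Submodule Λ A.M) : Prop :=
  (∃ L', IsCompl L L') ∧ ∀ x, x ∈ L ↔ ∀ y ∈ L, A.form x y = 0

/-- A form is metabolic if it has a lagrangian. -/
def Metabolic (A : AsymForm Λ) : Prop := ∃ L, A.IsLagrangian L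

/-- Isomorphism of asymmetric forms. -/
def Iso (A B : AsymForm Λ) : Prop :=
  ∃ f : A.M ≃ₗ[Λ] B.M, ∀ x y, B.form (f x) (f y) = A.form x y

/-- The orthogonal sum. -/
abbrev add (A B : AsymForm Λ) : AsymForm Λ where
  M := A.M × B.M
  form := sumMap A.form B.form
  nonsing := prodEquiv.bijective.comp (A.nonsing.prodMap B.nonsing)

/-- The zero form. -/
abbrev zero (Λ : Type u) [Ring Λ] [StarRing Λ] : AsymForm Λ where
  M := PUnit
  form := 0
  nonsing := ⟨fun _ _ _ => rfl, fun x => ⟨0, StarDual.ext fun y => by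
    obtain rfl : y = 0 := rfl
    rw [map_zero, map_zero]⟩⟩

/-- The form `-ρ`. -/
abbrev neg (A : AsymForm Λ) : AsymForm Λ where
  M := A.M
  form := -A.form
  nonsing := (LinearEquiv.neg Λ (M := StarDual Λ A.M)).bijective.comp A.nonsing

theorem Metabolic.of_iso {A B : AsymForm Λ} (h : A.Iso B) (hB : B.Metabolic) : A.Metabolic := by
  obtain ⟨f, hf⟩ := h
  obtain ⟨L, ⟨L', hL⟩, hp⟩ := hB
  refine ⟨L.comap f.toLinearMap, ⟨L'.comap f.toLinearMap, ?_⟩, fun x => ?_⟩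
  · have := (Submodule.orderIsoMapComap f).symm.isCompl hL
    exact this
  · rw [Submodule.mem_comap, LinearEquiv.coe_coe, hp]
    constructor
    · intro h y hy
      rw [← hf]
      exact h _ hy
    · intro h y hy
      obtain ⟨y, rfl⟩ := f.surjective y
      rw [hf]
      exact h y hy

theorem Metabolic.add {A B : AsymForm Λ} (hA : A.Metabolic) (hB : B.Metabolic) :
    (A.add B).Metabolic := by
  obtain ⟨L, ⟨L', hL⟩, hp⟩ := hA
  obtain ⟨K, ⟨K', hK⟩, hk⟩ := hB
  refine ⟨L.prod K, ⟨L'.prod K', ?_⟩, fun x => ?_⟩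
  · constructor
    · rw [disjoint_iff, Submodule.prod_inf_prod, hL.inf_eq_bot, hK.inf_eq_bot, Submodule.prod_bot]
    · rw [codisjoint_iff, Submodule.prod_sup_prod, hL.sup_eq_top, hK.sup_eq_top,
        Submodule.prod_top]
  · rw [Submodule.mem_prod, hp, hk]
    constructor
    · rintro ⟨h1, h2⟩ y ⟨hy1, hy2⟩
      rw [sumMap_apply, h1 _ hy1, h2 _ hy2, add_zero]
    · intro h
      constructor
      · intro y hy
        have := h (y, 0) ⟨hy, K.zero_mem⟩
        rwa [sumMap_apply, map_zero, add_zero] at this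
      · intro y hy
        have := h (0, y) ⟨L.zero_mem, hy⟩
        rwa [sumMap_apply, map_zero, zero_add] at this

theorem Metabolic.zero : (AsymForm.zero Λ).Metabolic :=
  ⟨⊤, ⟨⊥, isCompl_top_bot⟩, fun _ => ⟨fun _ _ _ => rfl, fun _ => trivial⟩⟩

theorem Metabolic.neg {A : AsymForm Λ} (hA : A.Metabolic) : A.neg.Metabolic := by
  obtain ⟨L, hL, hp⟩ := hA
  refine ⟨L, hL, fun x => (hp x).trans ?_⟩
  change _ ↔ ∀ y ∈ L, -(A.form x y) = 0
  simp only [neg_eq_zero]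

theorem metabolic_add_neg (A : AsymForm Λ) : (A.neg.add A).Metabolic := by
  refine ⟨LinearMap.eqLocus (LinearMap.fst Λ A.M A.M) (LinearMap.snd Λ A.M A.M),
    ⟨LinearMap.ker (LinearMap.fst Λ A.M A.M), ?_⟩, fun x => ?_⟩
  · constructor
    · rw [Submodule.disjoint_def]
      rintro ⟨x, y⟩ (h1 : x = y) (h2 : x = 0)
      subst h1
      exact Prod.ext h2 h2
    · rw [codisjoint_iff, eq_top_iff]
      rintro ⟨x, y⟩ -
      rw [show ((x, y) : A.M × A.M) = (x, x) + (0, y - x) by simp]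
      exact Submodule.add_mem_sup (show x = x from rfl) (show (0 : A.M) = 0 from rfl)
  · change x.1 = x.2 ↔ ∀ y : A.M × A.M, y.1 = y.2 → -(A.form x.1 y.1) + A.form x.2 y.2 = 0
    constructor
    · intro h y hy
      rw [h, hy, neg_add_cancel]
    · intro h
      refine A.nonsing.1 (StarDual.ext fun y => ?_)
      have := h (y, y) rfl
      rwa [neg_add_eq_zero] at this

/-- Asymmetric forms up to isomorphism and addition of metabolic forms. -/
def system (Λ : Type u) [Ring Λ] [StarRing Λ] : StableSystem (AsymForm Λ) where
  add := add
  zero := zero Λ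
  Iso := Iso
  Stab := Metabolic
  iso_equiv := {
    refl := fun A => ⟨LinearEquiv.refl Λ _, fun _ _ => rfl⟩
    symm := by
      rintro A B ⟨f, hf⟩
      exact ⟨f.symm, fun x y => by
        rw [← hf, LinearEquiv.apply_symm_apply, LinearEquiv.apply_symm_apply]⟩
    trans := by
      rintro A B C ⟨f, hf⟩ ⟨g, hg⟩
      exact ⟨f.trans g, fun x y => by
        rw [LinearEquiv.trans_apply, LinearEquiv.trans_apply, hg, hf]⟩ }
  iso_add := by
    rintro A A' B B' ⟨f, hf⟩ ⟨g, hg⟩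
    exact ⟨LinearEquiv.prodCongr f g, fun x y =>
      congrArg₂ (· + ·) (hf x.1 y.1) (hg x.2 y.2)⟩
  iso_comm A B := ⟨LinearEquiv.prodComm Λ _ _, fun _ _ => add_comm _ _⟩
  iso_assoc A B C := ⟨LinearEquiv.prodAssoc Λ _ _ _, fun _ _ => (add_assoc _ _ _).symm⟩
  iso_zero A := ⟨LinearEquiv.uniqueProd, fun _ _ => (zero_add _).symm⟩
  stab_zero := Metabolic.zero
  stab_add := Metabolic.add

end AsymForm

/-- The asymmetric Witt group `LAsy^0(Λ)`. -/
abbrev LAsy0 (Λ : Type u) [Ring Λ] [StarRing Λ] := (AsymForm.system Λ).Class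

/-- The class of a non-singular asymmetric form. -/
abbrev LAsy0.mk (A : AsymForm Λ) : LAsy0 Λ := StableSystem.cls A

instance : AddCommGroup (LAsy0 Λ) where
  neg := StableSystem.map (A := AsymForm.system Λ) (B := AsymForm.system Λ) AsymForm.neg
    (by
      rintro A B ⟨f, hf⟩
      exact ⟨f, fun x y => congrArg (fun c => -c) (hf x y)⟩)
    (fun A B => ⟨LinearEquiv.refl Λ _, fun x y => by
      change -(A.form x.1 y.1) + -(B.form x.2 y.2) = -(A.form x.1 y.1 + B.form x.2 y.2)
      rw [neg_add]⟩)
    ⟨LinearEquiv.refl Λ _, fun _ _ => (neg_zero (G := Λ)).symm⟩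
    AsymForm.Metabolic.neg
  zsmul := @zsmulRec _ _ _ ⟨_⟩ nsmulRec
  neg_add_cancel := by
    rintro ⟨A⟩
    exact StableSystem.cls_stab _ A.metabolic_add_neg

end Asym

/-! ### The asymmetric signature of a flip-isomorphism -/

section Signature

variable {Λ : Type u} [Ring Λ] [StarRing Λ] {q : ℕ} {z w : Preform Λ q}

/-- The form `ρ = (0 0 α; 1 0 -ε; 0 1 εασα^*)` on `F ⊕ F^* ⊕ F`. -/
def Flip.rho (t : Flip z) : (z.F × StarDual Λ z.F × z.F) →ₗ[Λ]
    StarDual Λ (z.F × StarDual Λ z.F × z.F) :=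
  let a := LinearMap.fst Λ z.F (StarDual Λ z.F × z.F)
  let f := LinearMap.fst Λ (StarDual Λ z.F) z.F ∘ₗ LinearMap.snd Λ z.F (StarDual Λ z.F × z.F)
  let b := LinearMap.snd Λ (StarDual Λ z.F) z.F ∘ₗ LinearMap.snd Λ z.F (StarDual Λ z.F × z.F)
  prodEquiv.toLinearMap ∘ₗ LinearMap.prod (t.alpha.toLinearMap ∘ₗ b)
    (prodEquiv.toLinearMap ∘ₗ LinearMap.prod (eval ∘ₗ (a - eps q • b))
      (f + eps q • (t.alpha.toLinearMap ∘ₗ t.sigma ∘ₗ adj t.alpha.toLinearMap ∘ₗ b)))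

theorem Flip.rho_eq (t : Flip z) (x : z.F × StarDual Λ z.F × z.F) :
    t.rho x = prodEquiv (t.alpha x.2.2, prodEquiv (eval (x.1 - eps q • x.2.2),
      x.2.1 + eps q • t.alpha (t.sigma (adj t.alpha.toLinearMap x.2.2)))) := rfl

theorem Flip.rho_apply (t : Flip z) (x y : z.F × StarDual Λ z.F × z.F) :
    t.rho x y = t.alpha x.2.2 y.1 + (star (y.2.1 (x.1 - eps q • x.2.2)) +
      (x.2.1 y.2.2 + eps q • t.alpha (t.sigma (adj t.alpha.toLinearMap x.2.2)) y.2.2)) := by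
  rw [← units_smul_apply]; rfl

theorem Flip.rho_bijective (t : Flip z) : Function.Bijective t.rho := by
  constructor
  · rw [injective_iff_map_eq_zero]
    intro x hx
    rw [t.rho_eq, EmbeddingLike.map_eq_zero_iff, Prod.mk_eq_zero, EmbeddingLike.map_eq_zero_iff,
      EmbeddingLike.map_eq_zero_iff, Prod.mk_eq_zero] at hx
    obtain ⟨h1, h2, h3⟩ := hx
    have h2' := eval_bijective.1 (h2.trans (map_zero eval).symm)
    rw [h1] at h2' h3
    simp only [smul_zero, sub_zero, map_zero, add_zero] at h2' h3
    exact Prod.ext h2' (Prod.ext h3 h1)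
  · intro φ
    obtain ⟨⟨p, φ'⟩, rfl⟩ := prodEquiv.surjective φ
    obtain ⟨⟨r, s⟩, rfl⟩ := prodEquiv.surjective φ'
    obtain ⟨c, rfl⟩ := (eval_bijective (Λ := Λ) (M := z.F)).2 r
    refine ⟨(c + eps q • t.alpha.symm p, s - eps q • t.alpha (t.sigma
      (adj t.alpha.toLinearMap (t.alpha.symm p))), t.alpha.symm p), ?_⟩
    rw [t.rho_eq]
    simp

/-- The asymmetric signature of a flip-isomorphism, as an asymmetric form. -/
abbrev Flip.asymForm (t : Flip z) : AsymForm Λ where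
  M := z.F × StarDual Λ z.F × z.F
  form := t.rho
  nonsing := t.rho_bijective

/-- The asymmetric signature `σ^*(z, t) ∈ LAsy^0(Λ)` of a flip-isomorphism. -/
def Flip.asymSig (t : Flip z) : LAsy0 Λ := LAsy0.mk t.asymForm

theorem Flip.asymForm_add (t : Flip z) (u : Flip w) :
    (t.add u).asymForm.Iso (t.asymForm.add u.asymForm) := by
  let e : ((z.F × w.F) × StarDual Λ (z.F × w.F) × z.F × w.F) ≃ₗ[Λ]
      (z.F × StarDual Λ z.F × z.F) × (w.F × StarDual Λ w.F × w.F) :=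
    ((LinearEquiv.prodCongr (LinearEquiv.refl Λ (z.F × w.F))
      ((LinearEquiv.prodCongr prodEquiv.symm (LinearEquiv.refl Λ (z.F × w.F))).trans
        (LinearEquiv.prodProdProdComm Λ _ _ _ _))).trans
        (LinearEquiv.prodProdProdComm Λ _ _ _ _))
  refine ⟨e, fun x y => ?_⟩
  obtain ⟨x, rfl⟩ := e.symm.surjective x
  obtain ⟨y, rfl⟩ := e.symm.surjective y
  rw [LinearEquiv.apply_symm_apply, LinearEquiv.apply_symm_apply, sumMap_apply, t.rho_apply,
    u.rho_apply, (t.add u).rho_apply]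
  change _ = (t.alpha x.1.2.2 y.1.1 + u.alpha x.2.2.2 y.2.1) +
    (star (y.1.2.1 (x.1.1 - eps q • x.1.2.2) + y.2.2.1 (x.2.1 - eps q • x.2.2.2)) +
      ((x.1.2.1 y.1.2.2 + x.2.2.1 y.2.2.2) + eps q • ((t.add u).alpha ((t.add u).sigma
        (adj (t.add u).alpha.toLinearMap (x.1.2.2, x.2.2.2))) (y.1.2.2, y.2.2.2))))
  have h : adj (t.add u).alpha.toLinearMap (x.1.2.2, x.2.2.2) =
      prodEquiv (adj t.alpha.toLinearMap x.1.2.2, adj u.alpha.toLinearMap x.2.2.2) :=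
    StarDual.ext fun v => star_add _ _
  have h2 : (t.add u).sigma (prodEquiv (adj t.alpha.toLinearMap x.1.2.2,
      adj u.alpha.toLinearMap x.2.2.2)) = (t.sigma (adj t.alpha.toLinearMap x.1.2.2),
        u.sigma (adj u.alpha.toLinearMap x.2.2.2)) := by
    change Prod.map _ _ (prodEquiv.symm (prodEquiv _)) = _
    rw [LinearEquiv.symm_apply_apply]
    rfl
  rw [h, h2]
  change _ = _ + (_ + (_ + eps q • (t.alpha (t.sigma (adj t.alpha.toLinearMap x.1.2.2)) y.1.2.2 +
    u.alpha (u.sigma (adj u.alpha.toLinearMap x.2.2.2)) y.2.2.2)))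
  rw [star_add, smul_add]
  abel

theorem Flip.asymForm_zero :
    (Flip.zero (Λ := Λ) (q := q)).asymForm.Iso (AsymForm.zero Λ) := by
  refine ⟨{ toFun := fun _ => 0, invFun := fun _ => 0, map_add' := by simp, map_smul' := by simp
            left_inv := fun x => Prod.ext rfl (Prod.ext (StarDual.ext fun y => ?_) rfl)
            right_inv := fun _ => rfl }, fun x y => ?_⟩
  · obtain rfl : y = (0 : PUnit) := rfl
    exact (map_zero _).trans (map_zero x.2.1).symm
  · have hx : x = 0 := Prod.ext rfl (Prod.ext (StarDual.ext fun y => by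
      obtain rfl : y = (0 : PUnit) := rfl
      exact (map_zero x.2.1).trans (map_zero (0 : StarDual Λ PUnit)).symm) rfl)
    rw [hx]
    exact (congrArg (fun f : StarDual Λ _ => f y)
      (map_zero (Flip.zero (Λ := Λ) (q := q)).rho)).symm

theorem Flip.asymForm_hyp (L : Type u) [AddCommGroup L] [Module Λ L] [Module.Free Λ L]
    [Module.Finite Λ L] : (Flip.hyp0 (Λ := Λ) q L).asymForm.Metabolic := by
  let F := L × StarDual Λ L
  let p : F × StarDual Λ F × F →ₗ[Λ] StarDual Λ L × StarDual Λ L × StarDual Λ L :=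
    LinearMap.prodMap (LinearMap.snd Λ L (StarDual Λ L)) (LinearMap.prodMap
      (dualMap (LinearMap.inl Λ L (StarDual Λ L))) (LinearMap.snd Λ L (StarDual Λ L)))
  let p' : F × StarDual Λ F × F →ₗ[Λ] L × StarDual Λ (StarDual Λ L) × L :=
    LinearMap.prodMap (LinearMap.fst Λ L (StarDual Λ L)) (LinearMap.prodMap
      (dualMap (LinearMap.inr Λ L (StarDual Λ L))) (LinearMap.fst Λ L (StarDual Λ L)))
  have hp : ∀ x, x ∈ LinearMap.ker p ↔ x.1.2 = 0 ∧ (∀ l, x.2.1 (l, 0) = 0) ∧ x.2.2.2 = 0 := by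
    intro x
    rw [LinearMap.mem_ker]
    change (x.1.2, (dualMap (LinearMap.inl Λ L (StarDual Λ L)) x.2.1), x.2.2.2) = 0 ↔ _
    rw [Prod.mk_eq_zero, Prod.mk_eq_zero]
    refine and_congr_right fun _ => and_congr_left fun _ => ?_
    exact ⟨fun h l => congrArg (fun f => f l) h, fun h => StarDual.ext h⟩
  have hp' : ∀ x, x ∈ LinearMap.ker p' ↔ x.1.1 = 0 ∧ (∀ l, x.2.1 (0, l) = 0) ∧ x.2.2.1 = 0 := by
    intro x
    rw [LinearMap.mem_ker]
    change (x.1.1, (dualMap (LinearMap.inr Λ L (StarDual Λ L)) x.2.1), x.2.2.1) = 0 ↔ _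
    rw [Prod.mk_eq_zero, Prod.mk_eq_zero]
    refine and_congr_right fun _ => and_congr_left fun _ => ?_
    exact ⟨fun h l => congrArg (fun f => f l) h, fun h => StarDual.ext h⟩
  refine ⟨LinearMap.ker p, ⟨LinearMap.ker p', ?_⟩, fun x => ?_⟩
  · constructor
    · rw [Submodule.disjoint_def]
      intro x hx hx'
      obtain ⟨h1, h2, h3⟩ := (hp x).1 hx
      obtain ⟨k1, k2, k3⟩ := (hp' x).1 hx'
      refine Prod.ext (Prod.ext k1 h1) (Prod.ext (StarDual.ext fun y => ?_) (Prod.ext k3 h3))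
      have : y = (y.1, 0) + (0, y.2) := by simp
      rw [this, map_add, h2, k2, add_zero]
      rfl
    · rw [codisjoint_iff, eq_top_iff]
      intro x _
      obtain ⟨f, hf⟩ := prodEquiv.surjective x.2.1
      have e : x = ((x.1.1, 0), prodEquiv (0, f.2), (x.2.2.1, 0)) +
          ((0, x.1.2), prodEquiv (f.1, 0), (0, x.2.2.2)) := by
        refine Prod.ext (Prod.ext ?_ ?_) (Prod.ext ?_ (Prod.ext ?_ ?_))
        · simp
        · simp
        · change x.2.1 = prodEquiv (0, f.2) + prodEquiv (f.1, 0)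
          rw [← map_add, ← hf]
          simp
        · simp
        · simp
      rw [e]
      refine Submodule.add_mem_sup ((hp _).2 ⟨rfl, fun l => ?_, rfl⟩)
        ((hp' _).2 ⟨rfl, fun l => ?_, rfl⟩)
      · change (0 : Λ) + f.2 0 = 0
        rw [map_zero, add_zero]
      · change f.1 0 + (0 : Λ) = 0
        rw [map_zero, add_zero]
  · have key : ∀ x y : F × StarDual Λ F × F, (Flip.hyp0 (Λ := Λ) q L).rho x y =
        -eps q • x.2.2.2 y.1.1 - star (y.1.2 x.2.2.1) +
          (star (y.2.1 (x.1 - eps q • x.2.2)) + x.2.1 y.2.2) := by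
      intro x y
      rw [Flip.rho_apply, ← hypAlpha_apply]
      change _ + (_ + (_ + eps q • (hypAlpha (eps q) L 0) y.2.2)) = _
      rw [map_zero, StarDual.zero_apply, smul_zero, add_zero]
      rfl
    rw [hp]
    constructor
    · rintro ⟨h1, h2, h3⟩ y hy
      obtain ⟨k1, k2, k3⟩ := (hp y).1 hy
      change (Flip.hyp0 (Λ := Λ) q L).rho x y = 0
      rw [key, h3, k1]
      have e1 : x.1 - eps q • x.2.2 = (x.1.1 - eps q • x.2.2.1, 0) :=
        Prod.ext rfl (by change x.1.2 - eps q • x.2.2.2 = 0; rw [h1, h3, smul_zero, sub_zero])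
      have e2 : y.2.2 = (y.2.2.1, 0) := Prod.ext rfl k3
      rw [e1, k2, e2, h2]
      simp
    · intro h
      have h2 : ∀ l, x.2.1 (l, 0) = 0 := fun l => by
        have := h (0, 0, (l, 0)) ((hp _).2 ⟨rfl, fun _ => rfl, rfl⟩)
        change (Flip.hyp0 (Λ := Λ) q L).rho x _ = 0 at this
        rw [key] at this
        simpa using this
      have h3 : x.2.2.2 = 0 := StarDual.ext fun l => by
        have := h ((l, 0), 0, 0) ((hp _).2 ⟨rfl, fun _ => rfl, rfl⟩)
        change (Flip.hyp0 (Λ := Λ) q L).rho x _ = 0 at this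
        rw [key] at this
        have h4 : -eps q • x.2.2.2 l = 0 := by simpa using this
        rwa [smul_eq_zero_iff_eq] at h4
      refine ⟨?_, h2, h3⟩
      refine StarDual.ext fun l => ?_
      have := h (0, prodEquiv (0, eval l), 0) ((hp _).2 ⟨rfl, fun m => by
        change (0 : Λ) + eval l 0 = 0
        rw [map_zero, add_zero], rfl⟩)
      change (Flip.hyp0 (Λ := Λ) q L).rho x _ = 0 at this
      rw [key] at this
      change -eps q • x.2.2.2 0 - star ((0 : StarDual Λ L) x.2.2.1) +
        (star (0 + star ((x.1.2 - eps q • x.2.2.2) l)) + x.2.1 0) = 0 at this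
      simpa [h3] using this

end Signature

end Kreck

namespace Kreck

open StarDual

section Monoids

variable {Λ : Type u} [Ring Λ] [StarRing Λ] {S : Submonoid Λ} [IsCentralMul S] {q : ℕ}

/-! ### Strong isomorphisms and additional structure -/

/-- A strong isomorphism of split preformations also preserves the quadratic refinements. -/
def StrongIso.IsSplit {z z' : SplitPreform Λ q} (i : StrongIso z.toPreform z'.toPreform) : Prop :=
  QForm.pullback i.zeta.toLinearMap z'.theta = z.theta

/-- Compatibility of a strong isomorphism `(η, ζ)` with flip-isomorphisms:
`α' = η^{-*} α η⁻¹`, `β' = ζ β ζ⁻¹` and `σ' = η σ η^*`. -/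
structure StrongIso.CompatFlip {z z' : Preform Λ q} (i : StrongIso z z') (t : Flip z)
    (t' : Flip z') : Prop where
  alpha : ∀ x, t'.alpha (i.eta x) = dualEquiv i.eta (t.alpha x)
  beta : ∀ g, t'.beta (i.zeta g) = i.zeta (t.beta g)
  sigma : ∀ f, t'.sigma (dualEquiv i.eta f) = i.eta (t.sigma f)

/-- The condition `ν' = η ν η^*` for elements of `Q_{-ε}`. -/
def StrongIso.CompatNu {z z' : Preform Λ q} (i : StrongIso z z')
    (ν : QForm Λ (-eps q) (StarDual Λ z.F)) (ν' : QForm Λ (-eps q) (StarDual Λ z'.F)) : Prop :=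
  QForm.pullback (dualEquiv i.eta).toLinearMap ν' = ν

/-- Compatibility of a strong isomorphism `(η, ζ)` with isomorphisms `coker μ → coker γ`: the
isomorphisms correspond to each other under the isomorphisms of cokernels that are induced by
`η^{-*}` and `η`. -/
def StrongIso.CompatLink {z z' : Preform Λ q} (i : StrongIso z z')
    (l : z.cokerMu ≃ₗ[Λ] z.cokerGamma) (l' : z'.cokerMu ≃ₗ[Λ] z'.cokerGamma) : Prop :=
  ∀ x y, l (Submodule.Quotient.mk x) = Submodule.Quotient.mk y →
    l' (Submodule.Quotient.mk (dualEquiv i.eta x)) = Submodule.Quotient.mk (i.eta y)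

theorem dualMap_trans_symm {M N : Type u} [AddCommGroup M] [Module Λ M] [AddCommGroup N]
    [Module Λ N] (f : M ≃ₗ[Λ] N) (φ : StarDual Λ N) :
    dualEquiv f (dualEquiv f.symm φ) = φ := by
  refine StarDual.ext fun x => ?_
  rw [dualEquiv_apply, dualEquiv_apply, LinearEquiv.symm_symm, LinearEquiv.apply_symm_apply]

theorem dualMap_symm_trans {M N : Type u} [AddCommGroup M] [Module Λ M] [AddCommGroup N]
    [Module Λ N] (f : M ≃ₗ[Λ] N) (φ : StarDual Λ M) :
    dualEquiv f.symm (dualEquiv f φ) = φ := by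
  refine StarDual.ext fun x => ?_
  rw [dualEquiv_apply, dualEquiv_apply, LinearEquiv.symm_symm, LinearEquiv.symm_apply_apply]

namespace StrongIso

section Split

variable {z z' z'' w w' : SplitPreform Λ q}

theorem IsSplit.refl : IsSplit (StrongIso.refl z.toPreform) := QForm.pullback_id _

theorem IsSplit.symm {i : StrongIso z.toPreform z'.toPreform} (h : i.IsSplit) :
    IsSplit i.symm := by
  unfold IsSplit at *
  rw [← h, ← QForm.pullback_comp]
  have : i.zeta.toLinearMap ∘ₗ i.symm.zeta.toLinearMap = LinearMap.id :=
    LinearMap.ext fun x => i.zeta.apply_symm_apply x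
  rw [this, QForm.pullback_id]

theorem IsSplit.trans {i : StrongIso z.toPreform z'.toPreform}
    {j : StrongIso z'.toPreform z''.toPreform} (h : i.IsSplit) (k : j.IsSplit) :
    IsSplit (i.trans j) := by
  unfold IsSplit at *
  rw [← h, ← k, ← QForm.pullback_comp]
  rfl

theorem pullback_sum {M M' N N' : Type*} [AddCommGroup M] [Module Λ M] [AddCommGroup M']
    [Module Λ M'] [AddCommGroup N] [Module Λ N] [AddCommGroup N'] [Module Λ N'] {e : ℤˣ}
    (f : M →ₗ[Λ] N) (g : M' →ₗ[Λ] N') (ψ : QForm Λ e N) (ψ' : QForm Λ e N') :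
    QForm.pullback (LinearMap.prodMap f g) (ψ.sum ψ') =
      (QForm.pullback f ψ).sum (QForm.pullback g ψ') := by
  rw [QForm.sum, QForm.sum, map_add, ← QForm.pullback_comp, ← QForm.pullback_comp,
    ← QForm.pullback_comp, ← QForm.pullback_comp]
  rfl

theorem IsSplit.add {i : StrongIso z.toPreform z'.toPreform}
    {j : StrongIso w.toPreform w'.toPreform} (h : i.IsSplit) (k : j.IsSplit) :
    IsSplit (z := z.add w) (z' := z'.add w') (i.add j) := by
  unfold IsSplit at *
  refine Eq.trans ?_ (congrArg₂ QForm.sum h k)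
  exact pullback_sum _ _ _ _

theorem IsSplit.comm : IsSplit (z := z.add w) (z' := w.add z)
    (StrongIso.comm z.toPreform w.toPreform) := by
  unfold IsSplit
  change QForm.pullback _ (QForm.pullback _ _ + QForm.pullback _ _) =
    QForm.pullback _ _ + QForm.pullback _ _
  rw [map_add, ← QForm.pullback_comp, ← QForm.pullback_comp, add_comm]
  rfl

theorem IsSplit.assoc {v : SplitPreform Λ q} : IsSplit (z := (z.add w).add v)
    (z' := z.add (w.add v)) (StrongIso.assoc z.toPreform w.toPreform v.toPreform) := by
  unfold IsSplit
  change QForm.pullback _ (QForm.pullback _ _ + QForm.pullback _ (QForm.pullback _ _ +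
    QForm.pullback _ _)) = QForm.pullback _ (QForm.pullback _ _ + QForm.pullback _ _) +
    QForm.pullback _ _
  simp only [map_add, ← QForm.pullback_comp]
  rw [← add_assoc]
  rfl

theorem IsSplit.zeroAdd : IsSplit (z := (SplitPreform.zero Λ q).add z) (z' := z)
    (StrongIso.zeroAdd z.toPreform) := by
  unfold IsSplit
  change _ = QForm.pullback _ 0 + QForm.pullback _ _
  rw [map_zero, zero_add]
  rfl

end Split

section CompatFlip

variable {z z' z'' w w' : Preform Λ q}

theorem CompatFlip.refl (t : Flip z) : (StrongIso.refl z).CompatFlip t t :=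
  ⟨fun _ => rfl, fun _ => rfl, fun _ => rfl⟩

theorem CompatFlip.symm {i : StrongIso z z'} {t : Flip z} {t' : Flip z'} (h : i.CompatFlip t t') :
    i.symm.CompatFlip t' t where
  alpha x := by
    obtain ⟨x, rfl⟩ := i.eta.surjective x
    rw [h.alpha]
    change t.alpha (i.eta.symm (i.eta x)) = dualEquiv i.eta.symm _
    rw [LinearEquiv.symm_apply_apply, dualMap_symm_trans]
  beta g := by
    obtain ⟨g, rfl⟩ := i.zeta.surjective g
    rw [h.beta]
    change t.beta (i.zeta.symm (i.zeta g)) = i.zeta.symm _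
    rw [LinearEquiv.symm_apply_apply, LinearEquiv.symm_apply_apply]
  sigma f := by
    obtain ⟨f, rfl⟩ := (dualEquiv i.eta).surjective f
    rw [h.sigma]
    change t.sigma (dualEquiv i.eta.symm _) = i.eta.symm _
    rw [LinearEquiv.symm_apply_apply, dualMap_symm_trans]

theorem CompatFlip.trans {i : StrongIso z z'} {j : StrongIso z' z''} {t : Flip z} {t' : Flip z'}
    {t'' : Flip z''} (h : i.CompatFlip t t') (k : j.CompatFlip t' t'') :
    (i.trans j).CompatFlip t t'' where
  alpha x := by
    change t''.alpha (j.eta (i.eta x)) = dualEquiv j.eta (dualEquiv i.eta _)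
    rw [k.alpha, h.alpha]
  beta g := by
    change t''.beta (j.zeta (i.zeta g)) = j.zeta (i.zeta _)
    rw [k.beta, h.beta]
  sigma f := by
    change t''.sigma (dualEquiv j.eta (dualEquiv i.eta f)) = j.eta (i.eta _)
    rw [k.sigma, h.sigma]

theorem dualEquiv_prod {M M' N N' : Type u} [AddCommGroup M] [Module Λ M] [AddCommGroup M']
    [Module Λ M'] [AddCommGroup N] [Module Λ N] [AddCommGroup N'] [Module Λ N']
    (f : M ≃ₗ[Λ] N) (g : M' ≃ₗ[Λ] N') (x : StarDual Λ M × StarDual Λ M') :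
    dualEquiv (LinearEquiv.prodCongr f g) (prodEquiv x) =
      prodEquiv (dualEquiv f x.1, dualEquiv g x.2) := rfl

theorem Flip.add_sigma (t : Flip z) (u : Flip w) (x : StarDual Λ z.F × StarDual Λ w.F) :
    (t.add u).sigma (prodEquiv x) = (t.sigma x.1, u.sigma x.2) := by
  change Prod.map _ _ (prodEquiv.symm (prodEquiv x)) = _
  rw [LinearEquiv.symm_apply_apply]
  rfl

theorem CompatFlip.add {i : StrongIso z z'} {j : StrongIso w w'} {t : Flip z} {t' : Flip z'}
    {u : Flip w} {u' : Flip w'} (h : i.CompatFlip t t') (k : j.CompatFlip u u') :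
    (i.add j).CompatFlip (t.add u) (t'.add u') where
  alpha x := by
    change prodEquiv (t'.alpha (i.eta x.1), u'.alpha (j.eta x.2)) = _
    rw [h.alpha, k.alpha]
    rfl
  beta g := by
    change (t'.beta (i.zeta g.1), u'.beta (j.zeta g.2)) = _
    rw [h.beta, k.beta]
    rfl
  sigma f := by
    obtain ⟨f, rfl⟩ := prodEquiv.surjective f
    change (t'.add u').sigma (prodEquiv (dualEquiv i.eta f.1, dualEquiv j.eta f.2)) = _
    rw [Flip.add_sigma, Flip.add_sigma, h.sigma, k.sigma]
    rfl

theorem CompatFlip.comm (t : Flip z) (u : Flip w) :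
    (StrongIso.comm z w).CompatFlip (t.add u) (u.add t) where
  alpha x := StarDual.ext fun y => add_comm _ _
  beta g := rfl
  sigma f := by
    obtain ⟨f, rfl⟩ := prodEquiv.surjective f
    have : dualEquiv (StrongIso.comm z w).eta (prodEquiv f) = prodEquiv (f.2, f.1) :=
      StarDual.ext fun y => add_comm _ _
    rw [this, Flip.add_sigma, Flip.add_sigma]
    rfl

theorem CompatFlip.assoc {v : Preform Λ q} (t : Flip z) (u : Flip w) (r : Flip v) :
    (StrongIso.assoc z w v).CompatFlip ((t.add u).add r) (t.add (u.add r)) where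
  alpha x := StarDual.ext fun y => (add_assoc _ _ _).symm
  beta g := rfl
  sigma f := by
    obtain ⟨⟨f, k⟩, rfl⟩ := prodEquiv.surjective f
    obtain ⟨f, rfl⟩ := prodEquiv.surjective f
    have : dualEquiv (StrongIso.assoc z w v).eta (prodEquiv (prodEquiv f, k)) =
        prodEquiv (f.1, prodEquiv (f.2, k)) :=
      StarDual.ext fun y => add_assoc _ _ _
    rw [this, Flip.add_sigma, Flip.add_sigma, Flip.add_sigma, Flip.add_sigma]
    rfl

theorem CompatFlip.zeroAdd (t : Flip z) :
    (StrongIso.zeroAdd z).CompatFlip (Flip.zero.add t) t where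
  alpha x := StarDual.ext fun y => (zero_add _).symm
  beta g := rfl
  sigma f := by
    obtain ⟨f, rfl⟩ := prodEquiv.surjective f
    have : dualEquiv (StrongIso.zeroAdd z).eta (prodEquiv f) = f.2 := by
      refine StarDual.ext fun y => ?_
      change f.1 0 + f.2 y = _
      rw [map_zero, zero_add]
    rw [this, Flip.add_sigma]
    rfl

end CompatFlip

section CompatNu

variable {z z' z'' w w' : Preform Λ q}

theorem CompatNu.refl (ν : QForm Λ (-eps q) (StarDual Λ z.F)) :
    (StrongIso.refl z).CompatNu ν ν := QForm.pullback_id _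

theorem CompatNu.symm {i : StrongIso z z'} {ν : QForm Λ (-eps q) (StarDual Λ z.F)}
    {ν' : QForm Λ (-eps q) (StarDual Λ z'.F)} (h : i.CompatNu ν ν') : i.symm.CompatNu ν' ν := by
  unfold CompatNu at *
  rw [← h, ← QForm.pullback_comp]
  have : (dualEquiv i.eta).toLinearMap ∘ₗ (dualEquiv i.symm.eta).toLinearMap = LinearMap.id :=
    LinearMap.ext fun x => dualMap_trans_symm i.eta x
  rw [this, QForm.pullback_id]

theorem CompatNu.trans {i : StrongIso z z'} {j : StrongIso z' z''}
    {ν : QForm Λ (-eps q) (StarDual Λ z.F)} {ν' : QForm Λ (-eps q) (StarDual Λ z'.F)}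
    {ν'' : QForm Λ (-eps q) (StarDual Λ z''.F)} (h : i.CompatNu ν ν') (k : j.CompatNu ν' ν'') :
    (i.trans j).CompatNu ν ν'' := by
  unfold CompatNu at *
  rw [← h, ← k, ← QForm.pullback_comp]
  rfl

/-- The sum of elements of `Q_{-ε}` of dual modules. -/
abbrev nuAdd (ν : QForm Λ (-eps q) (StarDual Λ z.F)) (ν' : QForm Λ (-eps q) (StarDual Λ w.F)) :
    QForm Λ (-eps q) (StarDual Λ (z.F × w.F)) :=
  QForm.pullback prodEquiv.symm.toLinearMap (ν.sum ν')

theorem CompatNu.add {i : StrongIso z z'} {j : StrongIso w w'}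
    {ν : QForm Λ (-eps q) (StarDual Λ z.F)} {ν' : QForm Λ (-eps q) (StarDual Λ z'.F)}
    {κ : QForm Λ (-eps q) (StarDual Λ w.F)} {κ' : QForm Λ (-eps q) (StarDual Λ w'.F)}
    (h : i.CompatNu ν ν') (k : j.CompatNu κ κ') :
    (i.add j).CompatNu (nuAdd ν κ) (nuAdd ν' κ') := by
  unfold CompatNu at *
  rw [← h, ← k, nuAdd, nuAdd, ← pullback_sum, ← QForm.pullback_comp, ← QForm.pullback_comp]
  have : prodEquiv.symm.toLinearMap ∘ₗ (dualEquiv (i.add j).eta).toLinearMap =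
      LinearMap.prodMap (dualEquiv i.eta).toLinearMap (dualEquiv j.eta).toLinearMap ∘ₗ
        prodEquiv.symm.toLinearMap := by
    refine LinearMap.ext fun f => ?_
    obtain ⟨f, rfl⟩ := prodEquiv.surjective f
    change prodEquiv.symm (prodEquiv (dualEquiv i.eta f.1, dualEquiv j.eta f.2)) =
      (dualEquiv i.eta (prodEquiv.symm (prodEquiv f)).1,
        dualEquiv j.eta (prodEquiv.symm (prodEquiv f)).2)
    rw [LinearEquiv.symm_apply_apply, LinearEquiv.symm_apply_apply]
  rw [this]

theorem CompatNu.comm (ν : QForm Λ (-eps q) (StarDual Λ z.F))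
    (κ : QForm Λ (-eps q) (StarDual Λ w.F)) :
    (StrongIso.comm z w).CompatNu (nuAdd ν κ) (nuAdd κ ν) := by
  unfold CompatNu
  rw [nuAdd, nuAdd]
  simp only [QForm.sum, map_add, ← QForm.pullback_comp]
  rw [add_comm]
  rfl

theorem CompatNu.assoc {v : Preform Λ q} (ν : QForm Λ (-eps q) (StarDual Λ z.F))
    (κ : QForm Λ (-eps q) (StarDual Λ w.F)) (τ : QForm Λ (-eps q) (StarDual Λ v.F)) :
    (StrongIso.assoc z w v).CompatNu (nuAdd (z := z.add w) (nuAdd ν κ) τ)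
      (nuAdd (w := w.add v) ν (nuAdd κ τ)) := by
  unfold CompatNu
  rw [nuAdd, nuAdd, nuAdd, nuAdd]
  simp only [QForm.sum, map_add, ← QForm.pullback_comp]
  rw [← add_assoc]
  rfl

theorem CompatNu.zeroAdd (ν : QForm Λ (-eps q) (StarDual Λ z.F)) :
    (StrongIso.zeroAdd z).CompatNu (nuAdd (z := Preform.zero Λ q) 0 ν) ν := by
  unfold CompatNu
  rw [nuAdd, QForm.sum, map_zero, zero_add, ← QForm.pullback_comp]
  have : LinearMap.snd Λ (StarDual Λ (Preform.zero Λ q).F) (StarDual Λ z.F) ∘ₗ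
      prodEquiv.symm.toLinearMap = (dualEquiv (StrongIso.zeroAdd z).eta).toLinearMap := by
    refine LinearMap.ext fun f => StarDual.ext fun x => rfl
  rw [this]

end CompatNu

section CompatLink

variable {z z' z'' w w' : Preform Λ q}

theorem CompatLink.refl (l : z.cokerMu ≃ₗ[Λ] z.cokerGamma) :
    (StrongIso.refl z).CompatLink l l := fun _ _ h => h

theorem eta_range {i : StrongIso z z'} {x y : z.F}
    (h : (Submodule.Quotient.mk x : z.cokerGamma) = Submodule.Quotient.mk y) :
    (Submodule.Quotient.mk (i.eta x) : z'.cokerGamma) = Submodule.Quotient.mk (i.eta y) := by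
  rw [Submodule.Quotient.eq] at *
  obtain ⟨g, hg⟩ := h
  exact ⟨i.zeta g, by rw [← i.gamma_comm, hg, map_sub]⟩

theorem CompatLink.symm {i : StrongIso z z'} {l : z.cokerMu ≃ₗ[Λ] z.cokerGamma}
    {l' : z'.cokerMu ≃ₗ[Λ] z'.cokerGamma} (h : i.CompatLink l l') : i.symm.CompatLink l' l := by
  intro x' y' h'
  obtain ⟨y, hy⟩ := Submodule.Quotient.mk_surjective _ (l (Submodule.Quotient.mk
    (dualEquiv i.symm.eta x')))
  have h1 := h _ _ hy.symm
  have h2 : dualEquiv i.eta (dualEquiv i.symm.eta x') = x' := dualMap_trans_symm i.eta x'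
  rw [h2, h'] at h1
  have h3 := eta_range (i := i.symm) h1
  have h4 : i.symm.eta (i.eta y) = y := i.eta.symm_apply_apply y
  rw [h4] at h3
  rw [← hy, h3]

theorem CompatLink.trans {i : StrongIso z z'} {j : StrongIso z' z''}
    {l : z.cokerMu ≃ₗ[Λ] z.cokerGamma} {l' : z'.cokerMu ≃ₗ[Λ] z'.cokerGamma}
    {l'' : z''.cokerMu ≃ₗ[Λ] z''.cokerGamma} (h : i.CompatLink l l') (k : j.CompatLink l' l'') :
    (i.trans j).CompatLink l l'' := fun x y hxy => k _ _ (h x y hxy)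

theorem CompatLink.add {i : StrongIso z z'} {j : StrongIso w w'}
    {l : z.cokerMu ≃ₗ[Λ] z.cokerGamma} {l' : z'.cokerMu ≃ₗ[Λ] z'.cokerGamma}
    {m : w.cokerMu ≃ₗ[Λ] w.cokerGamma} {m' : w'.cokerMu ≃ₗ[Λ] w'.cokerGamma}
    (h : i.CompatLink l l') (k : j.CompatLink m m') :
    (i.add j).CompatLink (sumCoker l m) (sumCoker l' m') := by
  intro x y hxy
  obtain ⟨x, rfl⟩ := prodEquiv.surjective x
  have h1 := (sumCoker_mk l m x y).1 hxy
  exact (sumCoker_mk l' m' (dualEquiv i.eta x.1, dualEquiv j.eta x.2) _).2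
    ⟨h _ _ h1.1, k _ _ h1.2⟩

theorem CompatLink.comm (l : z.cokerMu ≃ₗ[Λ] z.cokerGamma) (m : w.cokerMu ≃ₗ[Λ] w.cokerGamma) :
    (StrongIso.comm z w).CompatLink (sumCoker l m) (sumCoker m l) := by
  intro x y hxy
  obtain ⟨x, rfl⟩ := prodEquiv.surjective x
  have h1 := (sumCoker_mk l m x y).1 hxy
  have : dualEquiv (StrongIso.comm z w).eta (prodEquiv x) = prodEquiv (x.2, x.1) :=
    StarDual.ext fun y => add_comm _ _
  rw [this]
  exact (sumCoker_mk m l (x.2, x.1) _).2 ⟨h1.2, h1.1⟩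

theorem CompatLink.assoc {v : Preform Λ q} (l : z.cokerMu ≃ₗ[Λ] z.cokerGamma)
    (m : w.cokerMu ≃ₗ[Λ] w.cokerGamma) (n : v.cokerMu ≃ₗ[Λ] v.cokerGamma) :
    (StrongIso.assoc z w v).CompatLink (sumCoker (sumCoker l m) n)
      (sumCoker l (sumCoker m n)) := by
  intro x y hxy
  obtain ⟨⟨x, k⟩, rfl⟩ := prodEquiv.surjective x
  obtain ⟨x, rfl⟩ := prodEquiv.surjective x
  have h1 := (sumCoker_mk (sumCoker l m) n (prodEquiv x, k) y).1 hxy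
  have h2 := (sumCoker_mk l m x y.1).1 h1.1
  have : dualEquiv (StrongIso.assoc z w v).eta (prodEquiv (prodEquiv x, k)) =
      prodEquiv (x.1, prodEquiv (x.2, k)) := StarDual.ext fun y => add_assoc _ _ _
  rw [this]
  exact (sumCoker_mk l (sumCoker m n) (x.1, prodEquiv (x.2, k)) _).2
    ⟨h2.1, (sumCoker_mk m n (x.2, k) _).2 ⟨h2.2, h1.2⟩⟩

theorem CompatLink.zeroAdd (l₀ : (Preform.zero Λ q).cokerMu ≃ₗ[Λ] (Preform.zero Λ q).cokerGamma)
    (l : z.cokerMu ≃ₗ[Λ] z.cokerGamma) :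
    (StrongIso.zeroAdd z).CompatLink (sumCoker l₀ l) l := by
  intro x y hxy
  obtain ⟨x, rfl⟩ := prodEquiv.surjective x
  have h1 := (sumCoker_mk l₀ l x y).1 hxy
  have : dualEquiv (StrongIso.zeroAdd z).eta (prodEquiv x) = x.2 := by
    refine StarDual.ext fun y => ?_
    change x.1 0 + x.2 y = _
    rw [map_zero, zero_add]
  rw [this]
  exact h1.2

end CompatLink

/-- The sum of two hyperbolic preformations `y^L` and `y^{L'}` is `y^{L ⊕ L'}`. -/
def hyp0Add (q : ℕ) (L L' : Type u) [AddCommGroup L] [Module Λ L] [Module.Free Λ L]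
    [Module.Finite Λ L] [AddCommGroup L'] [Module Λ L'] [Module.Free Λ L'] [Module.Finite Λ L'] :
    StrongIso ((Preform.hyp0 (Λ := Λ) q L).add (Preform.hyp0 q L')) (Preform.hyp0 q (L × L')) :=
  (hypAdd (isSymm_zero _) (isSymm_zero _)).trans (hypZero _ _ sumDual_zero)

section Hyp

variable (L L' : Type u) [AddCommGroup L] [Module Λ L] [Module.Free Λ L]
    [Module.Finite Λ L] [AddCommGroup L'] [Module Λ L'] [Module.Free Λ L'] [Module.Finite Λ L']

theorem hyp0Add_isSplit : IsSplit (z := (SplitPreform.hyp0 (Λ := Λ) q L).add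
    (SplitPreform.hyp0 q L')) (z' := SplitPreform.hyp0 q (L × L')) (hyp0Add q L L') := by
  unfold IsSplit
  change QForm.mk _ _ = QForm.mk _ (_ + _)
  congr 1
  refine LinearMap.ext fun x => StarDual.ext fun y => ?_
  change (x.1.2 y.1.1 + x.2.2 y.2.1) + 0 = (x.1.2 y.1.1 + 0) + (x.2.2 y.2.1 + 0)
  rw [add_zero, add_zero, add_zero]

theorem hyp0Add_compatFlip : (hyp0Add q L L').CompatFlip
    ((Flip.hyp0 (Λ := Λ) q L).add (Flip.hyp0 q L')) (Flip.hyp0 q (L × L')) where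
  alpha x := by
    refine StarDual.ext fun y => ?_
    obtain ⟨y, rfl⟩ := (shuffle L L').surjective y
    change hypAlpha (eps q) (L × L') (shuffle L L' x) (shuffle L L' y) =
      ((Flip.hyp0 (Λ := Λ) q L).add (Flip.hyp0 q L')).alpha x ((shuffle L L').symm (shuffle L L' y))
    rw [LinearEquiv.symm_apply_apply, hypAlpha_apply]
    change _ = hypAlpha (eps q) L x.1 y.1 + hypAlpha (eps q) L' x.2 y.2
    rw [hypAlpha_apply, hypAlpha_apply]
    change -eps q • (x.1.2 y.1.1 + x.2.2 y.2.1) - star (y.1.2 x.1.1 + y.2.2 x.2.1) = _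
    rw [star_add, smul_add]
    abel
  beta g := by
    refine Prod.ext rfl (StarDual.ext fun y => ?_)
    change -(g.1.2 y.1 + g.2.2 y.2) = -(g.1.2 y.1) + -(g.2.2 y.2)
    rw [neg_add]
  sigma f := ((hyp0Add q L L').eta.map_zero).symm

theorem hyp0Add_compatNu : (hyp0Add q L L').CompatNu
    (nuAdd (z := Preform.hyp0 (Λ := Λ) q L) (w := Preform.hyp0 q L') 0 0) 0 := by
  unfold CompatNu
  rw [map_zero, nuAdd, QForm.sum, map_zero, map_zero, add_zero, map_zero]

theorem zeroHyp_isSplit : IsSplit (z := SplitPreform.zero Λ q)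
    (z' := SplitPreform.hyp0 q PUnit) zeroHyp := by
  unfold IsSplit
  rw [QForm.pullback_mk]
  change QForm.mk _ _ = QForm.mk _ 0
  congr 1
  refine LinearMap.ext fun x => StarDual.ext fun y => ?_
  change (0 : Λ) + 0 = 0
  rw [add_zero]

theorem zeroHyp_compatFlip : (zeroHyp (Λ := Λ) (q := q)).CompatFlip Flip.zero
    (Flip.hyp0 q PUnit) where
  alpha x := by
    obtain rfl : x = 0 := rfl
    rw [map_zero, map_zero, map_zero, map_zero]
  beta x := by
    obtain rfl : x = 0 := rfl
    rw [map_zero, map_zero]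
  sigma _ := rfl

end Hyp

end StrongIso

end Monoids

end Kreck

namespace Kreck

open StarDual

/-! ### The `l`-monoids and elementary classes -/

section LMonoid

/-- A ring is weakly finite if `Λ^n ≅ Λ^n ⊕ K` implies `K = 0`. -/
def WeaklyFinite (Λ : Type u) [Ring Λ] : Prop :=
  ∀ (n : ℕ) (K : Type u) [AddCommGroup K] [Module Λ K],
    Nonempty ((Fin n → Λ) ≃ₗ[Λ] (Fin n → Λ) × K) → Subsingleton K

variable {Λ : Type u} [Ring Λ] [StarRing Λ] {q : ℕ}

/-- `U` is an `h`-lagrangian of a preformation. -/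
structure Preform.IsHLagrangian (z : Preform Λ q) (U : Submodule Λ z.G) : Prop where
  free : Module.Free Λ U
  finite : Module.Finite Λ U
  form_zero : ∀ u ∈ U, ∀ u' ∈ U, z.mu u (z.gamma u') = 0
  gamma_inj : Set.InjOn z.gamma U
  mu_inj : Set.InjOn z.mu U
  gamma_summand : ∃ V, IsCompl (U.map z.gamma) V
  mu_summand : ∃ V, IsCompl (U.map z.mu) V
  /-- Restriction `f ↦ f|U₀` induces an isomorphism `F^* / U₁ → U₀^*`. -/
  restrict_iso : ∃ e : (StarDual Λ z.F ⧸ U.map z.mu) ≃ₗ[Λ] StarDual Λ (U.map z.gamma),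
    ∀ f : StarDual Λ z.F, e (Submodule.Quotient.mk f) = dualMap (U.map z.gamma).subtype f

/-- A preformation is elementary if it has an `h`-lagrangian. -/
def Preform.Elementary (z : Preform Λ q) : Prop := ∃ U, z.IsHLagrangian U

/-- A split preformation is elementary if it has an `h`-lagrangian on which the quadratic
refinement vanishes. -/
def SplitPreform.Elementary (z : SplitPreform Λ q) : Prop :=
  ∃ U, z.toPreform.IsHLagrangian U ∧ ∀ u ∈ U, z.theta.value u = 0

/-- Regular preformations up to strong isomorphism and addition of boundaries of hyperbolic
`(-ε)`-symmetric forms `H^{-ε}(L, φ)`. -/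
def Preform.system (Λ : Type u) [Ring Λ] [StarRing Λ] (q : ℕ) : StableSystem (Preform Λ q) where
  add := Preform.add
  zero := Preform.zero Λ q
  Iso z z' := Nonempty (StrongIso z z')
  Stab z := ∃ (L : Type u) (_ : AddCommGroup L) (_ : Module Λ L) (_ : Module.Free Λ L)
    (_ : Module.Finite Λ L) (φ : StarDual Λ L →ₗ[Λ] StarDual Λ (StarDual Λ L))
    (hφ : IsSymm (-eps q) φ), Nonempty (StrongIso z (Preform.hyp q L φ hφ))
  iso_equiv := ⟨fun z => ⟨StrongIso.refl z⟩, fun ⟨i⟩ => ⟨i.symm⟩, fun ⟨i⟩ ⟨j⟩ => ⟨i.trans j⟩⟩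
  iso_add := fun ⟨i⟩ ⟨j⟩ => ⟨i.add j⟩
  iso_comm z w := ⟨StrongIso.comm z w⟩
  iso_assoc z w v := ⟨StrongIso.assoc z w v⟩
  iso_zero z := ⟨StrongIso.zeroAdd z⟩
  stab_zero := ⟨PUnit, inferInstance, inferInstance, inferInstance, inferInstance, 0,
    isSymm_zero _, ⟨StrongIso.zeroHyp⟩⟩
  stab_add := by
    rintro z w ⟨L, _, _, _, _, φ, hφ, ⟨i⟩⟩ ⟨L', _, _, _, _, φ', hφ', ⟨j⟩⟩
    exact ⟨L × L', inferInstance, inferInstance, inferInstance, inferInstance, _, _,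
      ⟨(i.add j).trans (StrongIso.hypAdd hφ hφ')⟩⟩

/-- Regular split preformations up to strong isomorphism and addition of boundaries of hyperbolic
`(-ε)`-quadratic forms. -/
def SplitPreform.system (Λ : Type u) [Ring Λ] [StarRing Λ] (q : ℕ) :
    StableSystem (SplitPreform Λ q) where
  add := SplitPreform.add
  zero := SplitPreform.zero Λ q
  Iso z z' := ∃ i : StrongIso z.toPreform z'.toPreform, i.IsSplit
  Stab z := ∃ (L : Type u) (_ : AddCommGroup L) (_ : Module Λ L) (_ : Module.Free Λ L)
    (_ : Module.Finite Λ L) (i : StrongIso z.toPreform (SplitPreform.hyp0 q L).toPreform),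
    i.IsSplit
  iso_equiv := ⟨fun z => ⟨_, StrongIso.IsSplit.refl (z := z)⟩, fun ⟨_, h⟩ => ⟨_, h.symm⟩,
    fun ⟨_, h⟩ ⟨_, k⟩ => ⟨_, h.trans k⟩⟩
  iso_add := fun ⟨_, h⟩ ⟨_, k⟩ => ⟨_, h.add k⟩
  iso_comm z w := ⟨_, StrongIso.IsSplit.comm (z := z) (w := w)⟩
  iso_assoc z w v := ⟨_, StrongIso.IsSplit.assoc (z := z) (w := w) (v := v)⟩
  iso_zero z := ⟨_, StrongIso.IsSplit.zeroAdd (z := z)⟩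
  stab_zero := ⟨PUnit, inferInstance, inferInstance, inferInstance, inferInstance, _,
    StrongIso.zeroHyp_isSplit⟩
  stab_add := by
    rintro z w ⟨L, _, _, _, _, i, hi⟩ ⟨L', _, _, _, _, j, hj⟩
    exact ⟨L × L', inferInstance, inferInstance, inferInstance, inferInstance, _,
      (hi.add hj).trans (StrongIso.hyp0Add_isSplit L L')⟩

/-- The monoid `l^{2q+2}(Λ)` of regular preformations. -/
abbrev LMonoid (Λ : Type u) [Ring Λ] [StarRing Λ] (q : ℕ) := (Preform.system Λ q).Class

/-- The monoid `l_{2q+2}(Λ)` of regular split preformations. -/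
abbrev SplitLMonoid (Λ : Type u) [Ring Λ] [StarRing Λ] (q : ℕ) := (SplitPreform.system Λ q).Class

/-- The class `[z] ∈ l^{2q+2}(Λ)`. -/
abbrev Preform.cls (z : Preform Λ q) : LMonoid Λ q := StableSystem.cls z

/-- The class `[z] ∈ l_{2q+2}(Λ)`. -/
abbrev SplitPreform.cls (z : SplitPreform Λ q) : SplitLMonoid Λ q := StableSystem.cls z

/-- A class in `l^{2q+2}(Λ)` is elementary if it has an elementary representative. -/
def LMonoid.Elementary (c : LMonoid Λ q) : Prop := ∃ z : Preform Λ q, z.cls = c ∧ z.Elementary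

/-- A class in `l_{2q+2}(Λ)` is elementary if it has an elementary representative. -/
def SplitLMonoid.Elementary (c : SplitLMonoid Λ q) : Prop :=
  ∃ z : SplitPreform Λ q, z.cls = c ∧ z.Elementary

end LMonoid

/-! ### The flip-`l`-monoids and the linking-`l`-monoids -/

section PairMonoids

variable {Λ : Type u} [Ring Λ] [StarRing Λ]

/-- A pair `(z, t)` of a preformation `z` such that `γ` and `μ` are `S`-isomorphisms, and a
flip-isomorphism `t` of `z`. -/
structure FlipPair (S : Submonoid Λ) [IsCentralMul S] (q : ℕ) where
  z : Preform Λ q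
  isS : z.IsS S
  flip : Flip z

/-- The split version of `FlipPair`. -/
structure SplitFlipPair (S : Submonoid Λ) [IsCentralMul S] (q : ℕ) where
  z : SplitPreform Λ q
  isS : z.IsS S
  flip : SplitFlip z

/-- A pair `(z, l)` of a preformation `z` such that `γ` and `μ` are `S`-isomorphisms, and an
isometry `l : L^μ → L^γ` of symmetric linking forms. -/
structure LinkPair (S : Submonoid Λ) [IsCentralMul S] (q : ℕ) where
  z : Preform Λ q
  isS : z.IsS S
  iso : (z.linkMu isS).Isometry (z.linkGamma isS)

/-- A pair `(z, l)` of a split preformation `z` such that `γ` and `μ` are `S`-isomorphisms, and an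
isometry `l : L_μ → L_γ` of split quadratic linking forms. -/
structure SplitLinkPair (S : Submonoid Λ) [IsCentralMul S] (q : ℕ) where
  z : SplitPreform Λ q
  isS : z.IsS S
  iso : (z.linkMu isS).Isometry (z.linkGamma isS)

variable (S : Submonoid Λ) [IsCentralMul S] (q : ℕ)

/-- Pairs `(z, t)` up to isomorphism and addition of the pairs `(y^L, t^L)`. -/
noncomputable def FlipPair.system : StableSystem (FlipPair S q) where
  add x y := ⟨x.z.add y.z, x.isS.add y.isS, x.flip.add y.flip⟩
  zero := ⟨Preform.zero Λ q, Preform.IsS.zero, Flip.zero⟩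
  Iso x y := ∃ i : StrongIso x.z y.z, i.CompatFlip x.flip y.flip
  Stab x := ∃ (L : Type u) (_ : AddCommGroup L) (_ : Module Λ L) (_ : Module.Free Λ L)
    (_ : Module.Finite Λ L) (i : StrongIso x.z (Preform.hyp0 q L)),
    i.CompatFlip x.flip (Flip.hyp0 q L)
  iso_equiv := ⟨fun x => ⟨_, StrongIso.CompatFlip.refl x.flip⟩, fun ⟨_, h⟩ => ⟨_, h.symm⟩,
    fun ⟨_, h⟩ ⟨_, k⟩ => ⟨_, h.trans k⟩⟩
  iso_add := fun ⟨_, h⟩ ⟨_, k⟩ => ⟨_, h.add k⟩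
  iso_comm x y := ⟨_, StrongIso.CompatFlip.comm x.flip y.flip⟩
  iso_assoc x y w := ⟨_, StrongIso.CompatFlip.assoc x.flip y.flip w.flip⟩
  iso_zero x := ⟨_, StrongIso.CompatFlip.zeroAdd x.flip⟩
  stab_zero := ⟨PUnit, inferInstance, inferInstance, inferInstance, inferInstance, _,
    StrongIso.zeroHyp_compatFlip⟩
  stab_add := by
    rintro z w ⟨L, _, _, _, _, i, hi⟩ ⟨L', _, _, _, _, j, hj⟩
    exact ⟨L × L', inferInstance, inferInstance, inferInstance, inferInstance, _,
      (hi.add hj).trans (StrongIso.hyp0Add_compatFlip L L')⟩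

/-- Isomorphisms of pairs `(z, t)` of split preformations and flip-isomorphisms. -/
structure SplitFlipPair.IsIso {z z' : SplitPreform Λ q}
    (i : StrongIso z.toPreform z'.toPreform) (t : SplitFlip z) (t' : SplitFlip z') : Prop where
  split : i.IsSplit
  flip : i.CompatFlip t.toFlip t'.toFlip
  nu : i.CompatNu t.nu t'.nu

/-- Pairs `(z, t)` of split preformations and flip-isomorphisms up to isomorphism and addition of
the pairs `(y^L, t^L)`. -/
noncomputable def SplitFlipPair.system : StableSystem (SplitFlipPair S q) where
  add x y := ⟨x.z.add y.z, x.isS.add y.isS, x.flip.add y.flip⟩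
  zero := ⟨SplitPreform.zero Λ q, Preform.IsS.zero, SplitFlip.zero⟩
  Iso x y := ∃ i, SplitFlipPair.IsIso q i x.flip y.flip
  Stab x := ∃ (L : Type u) (_ : AddCommGroup L) (_ : Module Λ L) (_ : Module.Free Λ L)
    (_ : Module.Finite Λ L) (i : _), SplitFlipPair.IsIso q i x.flip (SplitFlip.hyp0 q L)
  iso_equiv := ⟨fun x => ⟨_, StrongIso.IsSplit.refl, StrongIso.CompatFlip.refl _,
      StrongIso.CompatNu.refl _⟩,
    fun ⟨_, h⟩ => ⟨_, h.1.symm, h.2.symm, h.3.symm⟩,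
    fun ⟨_, h⟩ ⟨_, k⟩ => ⟨_, h.1.trans k.1, h.2.trans k.2, h.3.trans k.3⟩⟩
  iso_add := fun ⟨_, h⟩ ⟨_, k⟩ => ⟨_, h.1.add k.1, h.2.add k.2, h.3.add k.3⟩
  iso_comm x y := ⟨_, StrongIso.IsSplit.comm (z := x.z) (w := y.z),
    StrongIso.CompatFlip.comm _ _, StrongIso.CompatNu.comm _ _⟩
  iso_assoc x y w := ⟨_, StrongIso.IsSplit.assoc (z := x.z) (w := y.z) (v := w.z),
    StrongIso.CompatFlip.assoc _ _ _, StrongIso.CompatNu.assoc _ _ _⟩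
  iso_zero x := ⟨_, StrongIso.IsSplit.zeroAdd (z := x.z), StrongIso.CompatFlip.zeroAdd _,
    StrongIso.CompatNu.zeroAdd _⟩
  stab_zero := ⟨PUnit, inferInstance, inferInstance, inferInstance, inferInstance, _,
    StrongIso.zeroHyp_isSplit, StrongIso.zeroHyp_compatFlip, map_zero _⟩
  stab_add := by
    rintro z w ⟨L, _, _, _, _, i, hi⟩ ⟨L', _, _, _, _, j, hj⟩
    exact ⟨L × L', inferInstance, inferInstance, inferInstance, inferInstance, _,
      (hi.1.add hj.1).trans (StrongIso.hyp0Add_isSplit L L'),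
      (hi.2.add hj.2).trans (StrongIso.hyp0Add_compatFlip L L'),
      (hi.3.add hj.3).trans (StrongIso.hyp0Add_compatNu L L')⟩

/-- Pairs `(z, l)` up to isomorphism and addition of the pairs `(y^L, 0)`; the cokernels of `y^L`
vanish, so that it carries only one isometry. -/
noncomputable def LinkPair.system : StableSystem (LinkPair S q) where
  add x y := ⟨x.z.add y.z, x.isS.add y.isS, sumIsometry x.iso y.iso⟩
  zero := ⟨Preform.zero Λ q, Preform.IsS.zero, Flip.zero.isometry Preform.IsS.zero⟩
  Iso x y := ∃ i : StrongIso x.z y.z, i.CompatLink x.iso.toLinearEquiv y.iso.toLinearEquiv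
  Stab x := ∃ (L : Type u) (_ : AddCommGroup L) (_ : Module Λ L) (_ : Module.Free Λ L)
    (_ : Module.Finite Λ L), Nonempty (StrongIso x.z (Preform.hyp0 q L))
  iso_equiv := ⟨fun x => ⟨_, StrongIso.CompatLink.refl _⟩, fun ⟨_, h⟩ => ⟨_, h.symm⟩,
    fun ⟨_, h⟩ ⟨_, k⟩ => ⟨_, h.trans k⟩⟩
  iso_add := fun ⟨_, h⟩ ⟨_, k⟩ => ⟨_, h.add k⟩
  iso_comm x y := ⟨_, StrongIso.CompatLink.comm _ _⟩
  iso_assoc x y w := ⟨_, StrongIso.CompatLink.assoc _ _ _⟩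
  iso_zero x := ⟨_, StrongIso.CompatLink.zeroAdd _ _⟩
  stab_zero := ⟨PUnit, inferInstance, inferInstance, inferInstance, inferInstance,
    ⟨StrongIso.zeroHyp⟩⟩
  stab_add := by
    rintro z w ⟨L, _, _, _, _, ⟨i⟩⟩ ⟨L', _, _, _, _, ⟨j⟩⟩
    exact ⟨L × L', inferInstance, inferInstance, inferInstance, inferInstance,
      ⟨(i.add j).trans (StrongIso.hyp0Add q L L')⟩⟩

/-- Pairs `(z, l)` of split preformations and isometries `L_μ → L_γ` up to isomorphism and
addition of the pairs `(y^L, 0)`. -/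
noncomputable def SplitLinkPair.system : StableSystem (SplitLinkPair S q) where
  add x y := ⟨x.z.add y.z, x.isS.add y.isS, sumSplitIsometry x.iso y.iso⟩
  zero := ⟨SplitPreform.zero Λ q, Preform.IsS.zero, SplitFlip.zero.isometry Preform.IsS.zero⟩
  Iso x y := ∃ i : StrongIso x.z.toPreform y.z.toPreform, i.IsSplit ∧
    i.CompatLink x.iso.toLinearEquiv y.iso.toLinearEquiv
  Stab x := ∃ (L : Type u) (_ : AddCommGroup L) (_ : Module Λ L) (_ : Module.Free Λ L)
    (_ : Module.Finite Λ L) (i : StrongIso x.z.toPreform (SplitPreform.hyp0 q L).toPreform),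
    i.IsSplit
  iso_equiv := ⟨fun x => ⟨_, StrongIso.IsSplit.refl, StrongIso.CompatLink.refl _⟩,
    fun ⟨_, h⟩ => ⟨_, h.1.symm, h.2.symm⟩,
    fun ⟨_, h⟩ ⟨_, k⟩ => ⟨_, h.1.trans k.1, h.2.trans k.2⟩⟩
  iso_add := fun ⟨_, h⟩ ⟨_, k⟩ => ⟨_, h.1.add k.1, h.2.add k.2⟩
  iso_comm x y := ⟨_, StrongIso.IsSplit.comm (z := x.z) (w := y.z),
    StrongIso.CompatLink.comm _ _⟩
  iso_assoc x y w := ⟨_, StrongIso.IsSplit.assoc (z := x.z) (w := y.z) (v := w.z),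
    StrongIso.CompatLink.assoc _ _ _⟩
  iso_zero x := ⟨_, StrongIso.IsSplit.zeroAdd (z := x.z), StrongIso.CompatLink.zeroAdd _ _⟩
  stab_zero := ⟨PUnit, inferInstance, inferInstance, inferInstance, inferInstance, _,
    StrongIso.zeroHyp_isSplit⟩
  stab_add := by
    rintro z w ⟨L, _, _, _, _, i, hi⟩ ⟨L', _, _, _, _, j, hj⟩
    exact ⟨L × L', inferInstance, inferInstance, inferInstance, inferInstance, _,
      (hi.add hj).trans (StrongIso.hyp0Add_isSplit L L')⟩

/-- The flip-`l`-monoid `fl_S^{2q+2}(Λ)`. -/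
abbrev FlipMonoid := (FlipPair.system S q).Class

/-- The split flip-`l`-monoid `fl^S_{2q+2}(Λ)`. -/
abbrev SplitFlipMonoid := (SplitFlipPair.system S q).Class

/-- The linking-`l`-monoid `ll_S^{2q+2}(Λ)`. -/
abbrev LinkMonoid := (LinkPair.system S q).Class

/-- The split linking-`l`-monoid `ll^S_{2q+2}(Λ)`. -/
abbrev SplitLinkMonoid := (SplitLinkPair.system S q).Class

variable {S} {q}

/-- The class `[(z, t)] ∈ fl_S^{2q+2}(Λ)`. -/
noncomputable abbrev FlipMonoid.mk (z : Preform Λ q) (hz : z.IsS S) (t : Flip z) :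
    FlipMonoid S q := StableSystem.cls (⟨z, hz, t⟩ : FlipPair S q)

/-- The class `[(z, t)] ∈ fl^S_{2q+2}(Λ)`. -/
noncomputable abbrev SplitFlipMonoid.mk (z : SplitPreform Λ q) (hz : z.IsS S) (t : SplitFlip z) :
    SplitFlipMonoid S q := StableSystem.cls (⟨z, hz, t⟩ : SplitFlipPair S q)

/-- The class `[(z, l)] ∈ ll_S^{2q+2}(Λ)`. -/
noncomputable abbrev LinkMonoid.mk (z : Preform Λ q) (hz : z.IsS S)
    (l : (z.linkMu hz).Isometry (z.linkGamma hz)) : LinkMonoid S q :=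
  StableSystem.cls (⟨z, hz, l⟩ : LinkPair S q)

/-- The class `[(z, l)] ∈ ll^S_{2q+2}(Λ)`. -/
noncomputable abbrev SplitLinkMonoid.mk (z : SplitPreform Λ q) (hz : z.IsS S)
    (l : (z.linkMu hz).Isometry (z.linkGamma hz)) : SplitLinkMonoid S q :=
  StableSystem.cls (⟨z, hz, l⟩ : SplitLinkPair S q)

/-! ### The homomorphisms `L` and `σ^*` -/

theorem StrongIso.CompatFlip.adjEquiv_eta {z z' : Preform Λ q} {i : StrongIso z z'} {t : Flip z}
    {t' : Flip z'} (h : i.CompatFlip t t') (x : z.F) :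
    adjEquiv t'.alpha (i.eta x) = dualEquiv i.eta (adjEquiv t.alpha x) := by
  refine StarDual.ext fun y => ?_
  obtain ⟨y, rfl⟩ := i.eta.surjective y
  rw [adjEquiv_apply, h.alpha, dualEquiv_apply, dualEquiv_apply, LinearEquiv.symm_apply_apply,
    LinearEquiv.symm_apply_apply, adjEquiv_apply]

theorem StrongIso.CompatFlip.asymForm_iso {z z' : Preform Λ q} {i : StrongIso z z'} {t : Flip z}
    {t' : Flip z'} (h : i.CompatFlip t t') : t.asymForm.Iso t'.asymForm := by
  refine ⟨LinearEquiv.prodCongr i.eta (LinearEquiv.prodCongr (dualEquiv i.eta) i.eta),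
    fun x y => ?_⟩
  change t'.rho _ _ = t.rho _ _
  rw [t.rho_apply, t'.rho_apply]
  change t'.alpha (i.eta x.2.2) (i.eta y.1) +
    (star (dualEquiv i.eta y.2.1 (i.eta x.1 - eps q • i.eta x.2.2)) +
    (dualEquiv i.eta x.2.1 (i.eta y.2.2) + eps q • t'.alpha (t'.sigma
      (adjEquiv t'.alpha (i.eta x.2.2))) (i.eta y.2.2))) = _
  have e : i.eta x.1 - eps q • i.eta x.2.2 = i.eta (x.1 - eps q • x.2.2) := by
    rcases Int.units_eq_one_or (eps q) with h | h <;> rw [h] <;> simp [Units.smul_def]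
  rw [h.adjEquiv_eta, h.sigma, h.alpha, h.alpha, e]
  simp only [dualEquiv_apply, LinearEquiv.symm_apply_apply]
  rfl

theorem StrongIso.CompatFlip.compatLink {z z' : Preform Λ q} {i : StrongIso z z'} {t : Flip z}
    {t' : Flip z'} (h : i.CompatFlip t t') : i.CompatLink t.cokerEquiv t'.cokerEquiv := by
  intro x y hxy
  rw [Flip.cokerEquiv_mk] at hxy
  rw [Flip.cokerEquiv_mk, ← StrongIso.eta_range (i := i) hxy]
  congr 1
  rw [LinearEquiv.symm_apply_eq, h.adjEquiv_eta, LinearEquiv.apply_symm_apply]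

theorem Flip.add_compatLink {z w : Preform Λ q} (t : Flip z) (u : Flip w) :
    (StrongIso.refl (z.add w)).CompatLink (t.add u).cokerEquiv
      (sumCoker t.cokerEquiv u.cokerEquiv) := by
  intro x y hxy
  obtain ⟨x, rfl⟩ := prodEquiv.surjective x
  rw [Flip.cokerEquiv_mk] at hxy
  have e : (adjEquiv (t.add u).alpha).symm (prodEquiv x) =
      ((adjEquiv t.alpha).symm x.1, (adjEquiv u.alpha).symm x.2) := by
    rw [LinearEquiv.symm_apply_eq]
    refine StarDual.ext fun v => ?_
    rw [adjEquiv_apply]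
    change x.1 v.1 + x.2 v.2 = star (t.alpha v.1 ((adjEquiv t.alpha).symm x.1) +
      u.alpha v.2 ((adjEquiv u.alpha).symm x.2))
    rw [star_add, ← adjEquiv_apply, ← adjEquiv_apply, LinearEquiv.apply_symm_apply,
      LinearEquiv.apply_symm_apply]
  rw [e] at hxy
  exact ((sumCoker_mk t.cokerEquiv u.cokerEquiv x _).2 ⟨rfl, rfl⟩).trans hxy

variable (S) (q)

/-- The homomorphism `L : fl_S^{2q+2}(Λ) → ll_S^{2q+2}(Λ)`, `[(z, t)] ↦ [(z, [α^{-*}])]`. -/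
noncomputable def FlipMonoid.L : FlipMonoid S q →+ LinkMonoid S q :=
  StableSystem.map (fun x => ⟨x.z, x.isS, x.flip.isometry x.isS⟩)
    (fun ⟨i, h⟩ => ⟨i, h.compatLink⟩)
    (fun x y => ⟨_, x.flip.add_compatLink y.flip⟩)
    ⟨_, StrongIso.CompatLink.refl _⟩
    (fun ⟨L, _, _, _, _, i, _⟩ => ⟨L, _, _, ‹_›, ‹_›, ⟨i⟩⟩)

/-- The homomorphism `σ^* : fl_S^{2q+2}(Λ) → LAsy^0(Λ)`, `[(z, t)] ↦ σ^*(z, t)`. -/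
noncomputable def FlipMonoid.sig : FlipMonoid S q →+ LAsy0 Λ :=
  StableSystem.map (B := AsymForm.system Λ) (fun x => x.flip.asymForm)
    (fun ⟨_, h⟩ => h.asymForm_iso)
    (fun x y => x.flip.asymForm_add y.flip)
    Flip.asymForm_zero
    (fun ⟨L, _, _, _, _, _, h⟩ => AsymForm.Metabolic.of_iso h.asymForm_iso (Flip.asymForm_hyp L))

/-- The homomorphism `L : fl^S_{2q+2}(Λ) → ll^S_{2q+2}(Λ)`, `[(z, t)] ↦ [(z, [α^{-*}])]`. -/
noncomputable def SplitFlipMonoid.L : SplitFlipMonoid S q →+ SplitLinkMonoid S q :=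
  StableSystem.map (fun x => ⟨x.z, x.isS, x.flip.isometry x.isS⟩)
    (fun ⟨i, h⟩ => ⟨i, h.split, h.flip.compatLink⟩)
    (fun x y => ⟨_, StrongIso.IsSplit.refl, x.flip.toFlip.add_compatLink y.flip.toFlip⟩)
    ⟨_, StrongIso.IsSplit.refl, StrongIso.CompatLink.refl _⟩
    (fun ⟨L, _, _, _, _, i, h⟩ => ⟨L, _, _, ‹_›, ‹_›, i, h.split⟩)

/-- The homomorphism `σ^* : fl^S_{2q+2}(Λ) → LAsy^0(Λ)`, `[(z, t)] ↦ σ^*(z, t)`. -/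
noncomputable def SplitFlipMonoid.sig : SplitFlipMonoid S q →+ LAsy0 Λ :=
  StableSystem.map (B := AsymForm.system Λ) (fun x => x.flip.asymForm)
    (fun ⟨_, h⟩ => h.flip.asymForm_iso)
    (fun x y => x.flip.toFlip.asymForm_add y.flip.toFlip)
    Flip.asymForm_zero
    (fun ⟨L, _, _, _, _, _, h⟩ =>
      AsymForm.Metabolic.of_iso h.flip.asymForm_iso (Flip.asymForm_hyp L))

/-- The homomorphism `ll^S_{2q+2}(Λ) → ll_S^{2q+2}(Λ)` that forgets quadratic refinements. -/
noncomputable def SplitLinkMonoid.forget : SplitLinkMonoid S q →+ LinkMonoid S q :=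
  StableSystem.map (fun x => ⟨x.z.toPreform, x.isS, x.iso.toIsometry⟩)
    (fun ⟨i, _, h⟩ => ⟨i, h⟩)
    (fun _ _ => ⟨_, StrongIso.CompatLink.refl _⟩)
    ⟨_, StrongIso.CompatLink.refl _⟩
    (fun ⟨L, _, _, _, _, i, _⟩ => ⟨L, _, _, ‹_›, ‹_›, ⟨i⟩⟩)

variable {S} {q}

theorem FlipMonoid.L_mk (z : Preform Λ q) (hz : z.IsS S) (t : Flip z) :
    FlipMonoid.L S q (FlipMonoid.mk z hz t) = LinkMonoid.mk z hz (t.isometry hz) := rfl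

theorem FlipMonoid.sig_mk (z : Preform Λ q) (hz : z.IsS S) (t : Flip z) :
    FlipMonoid.sig S q (FlipMonoid.mk z hz t) = t.asymSig := rfl

theorem SplitFlipMonoid.L_mk (z : SplitPreform Λ q) (hz : z.IsS S) (t : SplitFlip z) :
    SplitFlipMonoid.L S q (SplitFlipMonoid.mk z hz t) =
      SplitLinkMonoid.mk z hz (t.isometry hz) := rfl

theorem SplitFlipMonoid.sig_mk (z : SplitPreform Λ q) (hz : z.IsS S) (t : SplitFlip z) :
    SplitFlipMonoid.sig S q (SplitFlipMonoid.mk z hz t) = t.asymSig := rfl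

theorem SplitLinkMonoid.forget_mk (z : SplitPreform Λ q) (hz : z.IsS S)
    (l : (z.linkMu hz).Isometry (z.linkGamma hz)) :
    SplitLinkMonoid.forget S q (SplitLinkMonoid.mk z hz l) =
      LinkMonoid.mk z.toPreform hz l.toIsometry := rfl

end PairMonoids

end Kreck

open Kreck

namespace Kreck

open StarDual

/-! ### Witt equivalences of asymmetric forms -/

section Witt

variable {Λ : Type u} [Ring Λ] [StarRing Λ]

/-! Regard `μ : G → F^*` and `γ : G → F` as two-term complexes. Both maps are injective, so the
complexes resolve `coker μ` and `coker γ`, and a flip-isomorphism is a chain isomorphism `(α^{-*},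
β)` from the first to the second, with `σ` measuring the failure of `α` to respect the pairings on
the nose. Isomorphisms of cokernels are chain homotopy classes of chain equivalences, so the theorem
asks how the asymmetric signature behaves under chain homotopy and under stabilization.

Homotopy invariance. If `t` and `t'` induce the same map of cokernels, then `α'^{-*} - α^{-*} = γκ`
for some `κ : F^* → G` (`Flip.exists_homotopy`), hence `β' - β = κμ`. Because `μ` becomes invertible
over `S⁻¹Λ` and `F` has no `S`-torsion, `σ' - σ` is then forced (`Flip.sigma_homotopy`). In suitable
coordinates the form of `t` admits a map `j : G → F ⊕ F ⊕ F^*` with isotropic image whose left and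
right orthogonals agree, and after a shear the form of `t'` becomes `(v, w) ↦ ρ(v)(w + j(k w))` with
`k` built from `κ` (`Flip.coordForm_shear`). If `j` were a split injection, both forms would reduce
to the same form on `j(G)^⊥ / j(G)` and so be Witt equivalent. In general `j` is not split; adding a
metabolic form on `G ⊕ G^*` replaces it by the split injection `i ↦ (j i, i, 0)`, and the reduction
argument applies (`AsymForm.inflate_eq`). This gives `Flip.asymSig_eq`.

Surjectivity. Lifts of an isometry and of its inverse to `F^* → F` and `F → F^*` are homotopy
inverse to each other, and the homotopies assemble to an isomorphism `F^* ⊕ G ≅ F ⊕ G`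
(`exists_stable_equiv`). After addition of `y^G` it supplies an honest isomorphism `α^{-*}`. An
isomorphism lifting an isometry always extends to a flip-isomorphism (`exists_flip`): `σ` is the
difference of the two `S⁻¹Λ`-valued pairings, and this difference has values in `Λ` exactly because
cokernels are mapped isometrically. Hence `L` is onto; homotopy invariance together with transport
along stable isomorphisms shows that `σ^*` factors through `L` (`Flip.asymSig_eq_of_link_eq`).

Vanishing. An elementary class yields, after adding the boundary of a hyperbolic form, a submodule
`U ⊂ G` for which `γ(U)` is a direct summand with annihilator `μ(U)`. Any isometry has a lift
sending `μ(u)` to `γ(u)` for `u ∈ U`; the resulting stable flip-isomorphism is the identity on a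
lagrangian, and its asymmetric form then has the lagrangian `γ(U) ⊕ μ(U) ⊕ γ(U)`, for the enlarged
`U` (`Flip.metabolic`, `Preform.IsWeakLagrangian.sig_eq_zero`). Existence of an isometry comes from
an explicit flip-isomorphism with `σ = 0` built from `U` (`Preform.IsWeakLagrangian.exists_flip`);
its `β` carries `θ` to `-θ` on values, which covers the split case. The hyperbolic summand is
removed again because its cokernels vanish. -/

theorem LAsy0.mk_eq_of_metabolic {A B : AsymForm Λ} (h : (A.neg.add B).Metabolic) :
    LAsy0.mk A = LAsy0.mk B := by
  have h1 : -LAsy0.mk A + LAsy0.mk B = 0 := StableSystem.cls_stab _ h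
  exact neg_add_eq_zero.1 h1

theorem LAsy0.mk_eq_of_iso {A B : AsymForm Λ} (h : A.Iso B) : LAsy0.mk A = LAsy0.mk B :=
  StableSystem.cls_eq_of_iso _ h

/-- The asymmetric form induced by an isomorphism of modules. -/
abbrev AsymForm.pull (A : AsymForm Λ) {N : Type u} [AddCommGroup N] [Module Λ N] [Module.Free Λ N]
    [Module.Finite Λ N] (e : N ≃ₗ[Λ] A.M) : AsymForm Λ where
  M := N
  form := dualMap e.toLinearMap ∘ₗ A.form ∘ₗ e.toLinearMap
  nonsing := (dualEquiv e).symm.bijective.comp (A.nonsing.comp e.bijective)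

theorem AsymForm.pull_iso (A : AsymForm Λ) {N : Type u} [AddCommGroup N] [Module Λ N]
    [Module.Free Λ N] [Module.Finite Λ N] (e : N ≃ₗ[Λ] A.M) : (A.pull e).Iso A :=
  ⟨e, fun _ _ => rfl⟩

/-- The graph of a linear map, spread over a product decomposition, is a direct summand. -/
theorem exists_isCompl_ker_sub {M X Y : Type*} [AddCommGroup M] [Module Λ M] [AddCommGroup X]
    [Module Λ X] [AddCommGroup Y] [Module Λ Y] (e : M ≃ₗ[Λ] X × Y) (f : X →ₗ[Λ] Y) :
    ∃ L', IsCompl (LinearMap.ker (LinearMap.snd Λ X Y ∘ₗ e.toLinearMap -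
      f ∘ₗ LinearMap.fst Λ X Y ∘ₗ e.toLinearMap)) L' := by
  refine ⟨LinearMap.ker (LinearMap.fst Λ X Y ∘ₗ e.toLinearMap), ?_, ?_⟩
  · rw [Submodule.disjoint_def]
    intro m h1 h2
    rw [LinearMap.mem_ker] at h1 h2
    change (e m).2 - f (e m).1 = 0 at h1
    change (e m).1 = 0 at h2
    rw [h2, map_zero, sub_zero] at h1
    exact e.map_eq_zero_iff.1 (Prod.ext h2 h1)
  · rw [codisjoint_iff, eq_top_iff]
    intro m _
    rw [show m = e.symm ((e m).1, f (e m).1) + e.symm (0, (e m).2 - f (e m).1) by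
      rw [← map_add]; simp]
    refine Submodule.add_mem_sup ?_ ?_
    · rw [LinearMap.mem_ker]
      change (e (e.symm _)).2 - f (e (e.symm _)).1 = 0
      simp
    · rw [LinearMap.mem_ker]
      change (e (e.symm _)).1 = 0
      simp

/-! ### Stabilization by `G ⊕ G^*` and sublagrangian reduction -/

variable {M G : Type u} [AddCommGroup M] [Module Λ M] [Module.Free Λ M] [Module.Finite Λ M]
  [AddCommGroup G] [Module Λ G] [Module.Free Λ G] [Module.Finite Λ G]

/-- The map of the form `(v, w, c), (m, l, d) ↦ ρ(v)(m) + c(l + k(m)) + star (d(b(w)))`. -/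
def inflateForm (ρ : M →ₗ[Λ] StarDual Λ M) (k : M →ₗ[Λ] G) (b : G ≃ₗ[Λ] G) :
    (M × G × StarDual Λ G) →ₗ[Λ] StarDual Λ (M × G × StarDual Λ G) :=
  let v := LinearMap.fst Λ M (G × StarDual Λ G)
  let w := LinearMap.fst Λ G (StarDual Λ G) ∘ₗ LinearMap.snd Λ M (G × StarDual Λ G)
  let c := LinearMap.snd Λ G (StarDual Λ G) ∘ₗ LinearMap.snd Λ M (G × StarDual Λ G)
  prodEquiv.toLinearMap ∘ₗ LinearMap.prod (ρ ∘ₗ v + dualMap k ∘ₗ c)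
    (prodEquiv.toLinearMap ∘ₗ LinearMap.prod c (eval ∘ₗ b.toLinearMap ∘ₗ w))

theorem inflateForm_eq (ρ : M →ₗ[Λ] StarDual Λ M) (k : M →ₗ[Λ] G) (b : G ≃ₗ[Λ] G)
    (x : M × G × StarDual Λ G) : inflateForm ρ k b x =
      prodEquiv (ρ x.1 + dualMap k x.2.2, prodEquiv (x.2.2, eval (b x.2.1))) := rfl

theorem inflateForm_apply (ρ : M →ₗ[Λ] StarDual Λ M) (k : M →ₗ[Λ] G) (b : G ≃ₗ[Λ] G)
    (x y : M × G × StarDual Λ G) : inflateForm ρ k b x y =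
      ρ x.1 y.1 + x.2.2 (y.2.1 + k y.1) + star (y.2.2 (b x.2.1)) := by
  change (ρ x.1 y.1 + x.2.2 (k y.1)) + (x.2.2 y.2.1 + star (y.2.2 (b x.2.1))) = _
  rw [map_add]
  abel

/-- The form is triangular: its components on the `G`- and `G^*`-summands return `c` and `b w`,
after which the component on `M` determines `v` through `ρ`. -/
theorem inflateForm_bijective {ρ : M →ₗ[Λ] StarDual Λ M} (hρ : Function.Bijective ρ)
    (k : M →ₗ[Λ] G) (b : G ≃ₗ[Λ] G) : Function.Bijective (inflateForm ρ k b) := by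
  constructor
  · rw [injective_iff_map_eq_zero]
    intro x hx
    rw [inflateForm_eq, EmbeddingLike.map_eq_zero_iff, Prod.mk_eq_zero,
      EmbeddingLike.map_eq_zero_iff, Prod.mk_eq_zero] at hx
    obtain ⟨h1, h2, h3⟩ := hx
    rw [h2, map_zero, add_zero] at h1
    have h4 := b.map_eq_zero_iff.1 (eval_bijective.1 (h3.trans (map_zero eval).symm))
    exact Prod.ext (hρ.1 (h1.trans (map_zero ρ).symm)) (Prod.ext h4 h2)
  · intro φ
    obtain ⟨⟨p, φ'⟩, rfl⟩ := prodEquiv.surjective φ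
    obtain ⟨⟨r, s⟩, rfl⟩ := prodEquiv.surjective φ'
    obtain ⟨w, rfl⟩ := (eval_bijective (Λ := Λ) (M := G)).2 s
    obtain ⟨v, hv⟩ := hρ.2 (p - dualMap k r)
    refine ⟨(v, b.symm w, r), ?_⟩
    rw [inflateForm_eq, hv]
    simp

/-- The sum of a form and a metabolic form on `G ⊕ G^*`, twisted by `k`. -/
abbrev AsymForm.inflate (A : AsymForm Λ) (k : A.M →ₗ[Λ] G) (b : G ≃ₗ[Λ] G) : AsymForm Λ where
  M := A.M × G × StarDual Λ G
  form := inflateForm A.form k b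
  nonsing := inflateForm_bijective A.nonsing k b

/-- The diagonal of the two copies of `A.M`, enlarged by `G`, is a lagrangian of `(-A) ⊕ A.inflate k
b`. The twist `k` enters only through terms containing the `G^*`-coordinate, which is zero there. -/
theorem AsymForm.inflate_mk (A : AsymForm Λ) (k : A.M →ₗ[Λ] G) (b : G ≃ₗ[Λ] G) :
    LAsy0.mk A = LAsy0.mk (A.inflate k b) := by
  refine LAsy0.mk_eq_of_metabolic ?_
  -- Regrouped in this way, the lagrangian `{(v, v, w, 0)}` is the graph of `(v, w) ↦ (v, 0)`, so it
  -- is a direct summand.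
  let e : (A.M × A.M × G × StarDual Λ G) ≃ₗ[Λ] (A.M × G) × (A.M × StarDual Λ G) :=
    { toFun := fun x => ((x.1, x.2.2.1), (x.2.1, x.2.2.2))
      invFun := fun y => (y.1.1, y.2.1, y.1.2, y.2.2)
      map_add' := fun _ _ => rfl
      map_smul' := fun _ _ => rfl
      left_inv := fun _ => rfl
      right_inv := fun _ => rfl }
  let f : (A.M × G) →ₗ[Λ] (A.M × StarDual Λ G) :=
    LinearMap.prod (LinearMap.fst Λ A.M G) 0
  refine ⟨_, exists_isCompl_ker_sub e f, fun x => ?_⟩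
  have hmem : ∀ x : A.M × A.M × G × StarDual Λ G, x ∈ LinearMap.ker
      (LinearMap.snd Λ (A.M × G) (A.M × StarDual Λ G) ∘ₗ e.toLinearMap -
      f ∘ₗ LinearMap.fst Λ (A.M × G) (A.M × StarDual Λ G) ∘ₗ e.toLinearMap) ↔
      x.2.1 = x.1 ∧ x.2.2.2 = 0 := fun x => by
    rw [LinearMap.mem_ker]
    change (x.2.1, x.2.2.2) - (x.1, (0 : StarDual Λ G)) = 0 ↔ _
    rw [sub_eq_zero, Prod.mk_inj]
  have hform : ∀ x y : A.M × A.M × G × StarDual Λ G, (A.neg.add (A.inflate k b)).form x y =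
      A.form (x.2.1 - x.1) y.2.1 + A.form x.1 (y.2.1 - y.1) +
        x.2.2.2 (y.2.2.1 + k y.2.1) + star (y.2.2.2 (b x.2.2.1)) := fun x y => by
    change -(A.form x.1 y.1) + inflateForm A.form k b x.2 y.2 = _
    rw [inflateForm_apply, map_sub, map_sub, StarDual.sub_apply]
    abel
  rw [hmem]
  constructor
  · rintro ⟨h1, h2⟩ y hy
    obtain ⟨k1, k2⟩ := (hmem y).1 hy
    rw [hform, h1, h2, k1, k2]
    simp
  · intro h
    have h2 : x.2.2.2 = 0 := StarDual.ext fun l => by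
      have := h (0, 0, l, 0) ((hmem _).2 ⟨rfl, rfl⟩)
      rw [hform] at this
      simpa using this
    refine ⟨?_, h2⟩
    rw [← sub_eq_zero]
    refine A.nonsing.1 (StarDual.ext fun m => ?_)
    have := h (m, m, 0, 0) ((hmem _).2 ⟨rfl, rfl⟩)
    rw [hform, h2] at this
    simpa using this

/-- After inflation, `I = {(j i, i, 0)}` is a split isotropic submodule. By `hb` and the bijectivity
of `b`, its left and right orthogonals for the inflated `A` coincide and equal `I^⊥ = {(v, w, -ψ
v)}`, where `ψ v = A(v) ∘ j`. On `I^⊥` the inflated forms of `A` and `B` agree: `B` exceeds `A` by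
`A(v)(j(k m)) = ψ(v)(k m)`, and the twisted inflation contributes `c(k m) = -ψ(v)(k m)`. So both
forms reduce to the same form on `I^⊥ / I`. -/
theorem AsymForm.inflate_eq (A B : AsymForm Λ) (u : A.M ≃ₗ[Λ] B.M) (j : G →ₗ[Λ] A.M)
    (k : A.M →ₗ[Λ] G) (b : G ≃ₗ[Λ] G) (h0 : ∀ i l, A.form (j i) (j l) = 0)
    (hb : ∀ i m, A.form (j i) m = star (A.form m (j (b i))))
    (hB : ∀ v w, B.form (u v) (u w) = A.form v (w + j (k w))) :
    LAsy0.mk A = LAsy0.mk B := by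
  -- Only `B` is inflated with the twist `k`; the twist is what compensates for `j ∘ k` in `hB`.
  rw [← LAsy0.mk_eq_of_iso (B.pull_iso u), A.inflate_mk (0 : A.M →ₗ[Λ] G) b,
    (B.pull u).inflate_mk k b]
  refine LAsy0.mk_eq_of_metabolic ?_
  let N := A.M × G × StarDual Λ G
  let e : (N × N) ≃ₗ[Λ] (A.M × G × G) × (A.M × StarDual Λ G × StarDual Λ G) :=
    { toFun := fun x => ((x.1.1, x.1.2.1, x.2.2.1), (x.2.1, x.1.2.2, x.2.2.2))
      invFun := fun y => ((y.1.1, y.1.2.1, y.2.2.1), (y.2.1, y.1.2.2, y.2.2.2))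
      map_add' := fun _ _ => rfl
      map_smul' := fun _ _ => rfl
      left_inv := fun _ => rfl
      right_inv := fun _ => rfl }
  let ψ : A.M →ₗ[Λ] StarDual Λ G := dualMap j ∘ₗ A.form
  let p₁ := LinearMap.fst Λ A.M (G × G)
  let p₂ := LinearMap.fst Λ G G ∘ₗ LinearMap.snd Λ A.M (G × G)
  let p₃ := LinearMap.snd Λ G G ∘ₗ LinearMap.snd Λ A.M (G × G)
  -- The graph of `f` is the set of pairs `(x, y)` with `x ∈ I^⊥` and `y - x ∈ I`, the usual
  -- lagrangian identifying two reductions. It is parametrized by `v` and by the `G`-coordinates of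
  -- `x` and `y`.
  let f : (A.M × G × G) →ₗ[Λ] (A.M × StarDual Λ G × StarDual Λ G) :=
    LinearMap.prod (p₁ + j ∘ₗ (p₃ - p₂)) (LinearMap.prod (-(ψ ∘ₗ p₁)) (-(ψ ∘ₗ p₁)))
  refine ⟨_, exists_isCompl_ker_sub e f, fun x => ?_⟩
  have hmem : ∀ x : N × N, x ∈ LinearMap.ker
      (LinearMap.snd Λ (A.M × G × G) (A.M × StarDual Λ G × StarDual Λ G) ∘ₗ e.toLinearMap -
      f ∘ₗ LinearMap.fst Λ (A.M × G × G) (A.M × StarDual Λ G × StarDual Λ G) ∘ₗ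
        e.toLinearMap) ↔
      x.2.1 = x.1.1 + j (x.2.2.1 - x.1.2.1) ∧ x.1.2.2 = -ψ x.1.1 ∧ x.2.2.2 = -ψ x.1.1 :=
    fun x => by
      rw [LinearMap.mem_ker]
      change (x.2.1, x.1.2.2, x.2.2.2) -
        (x.1.1 + j (x.2.2.1 - x.1.2.1), -ψ x.1.1, -ψ x.1.1) = 0 ↔ _
      rw [sub_eq_zero, Prod.mk_inj, Prod.mk_inj]
  have hψ : ∀ v i, ψ v i = A.form v (j i) := fun _ _ => rfl
  have hψj : ∀ i, ψ (j i) = 0 := fun i => StarDual.ext fun l => h0 i l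
  have hform : ∀ x y : N × N,
      ((A.inflate (0 : A.M →ₗ[Λ] G) b).neg.add ((B.pull u).inflate k b)).form x y =
      -(A.form x.1.1 y.1.1 + x.1.2.2 y.1.2.1 + star (y.1.2.2 (b x.1.2.1))) +
        (A.form x.2.1 y.2.1 + ψ x.2.1 (k y.2.1) + x.2.2.2 (y.2.2.1 + k y.2.1) +
          star (y.2.2.2 (b x.2.2.1))) := fun x y => by
    change -(inflateForm A.form 0 b x.1 y.1) + inflateForm (B.pull u).form k b x.2 y.2 = _
    rw [inflateForm_apply, inflateForm_apply]
    change _ + (B.form (u _) (u _) + _ + _) = _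
    rw [hB, map_add (A.form x.2.1), LinearMap.zero_apply, add_zero, hψ]
  -- the form on pairs whose second member lies in the lagrangian
  have hL : ∀ (x : N × N) (m : A.M) (l l' : G),
      ((A.inflate (0 : A.M →ₗ[Λ] G) b).neg.add ((B.pull u).inflate k b)).form x
        ((m, l, -ψ m), (m + j (l' - l), l', -ψ m)) =
      A.form (x.2.1 - x.1.1 - j (x.2.2.1 - x.1.2.1)) m + ψ x.2.1 (l' - l) +
        (ψ x.2.1 + x.2.2.2) (k (m + j (l' - l))) - x.1.2.2 l + x.2.2.2 l' := fun x m l l' => by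
    rw [hform]
    simp only [StarDual.neg_apply, StarDual.add_apply, StarDual.sub_apply, map_sub, map_add, hψ,
      star_neg, ← hb]
    abel
  rw [hmem]
  constructor
  · rintro ⟨h1, h2, h3⟩ y hy
    obtain ⟨k1, k2, k3⟩ := (hmem y).1 hy
    have hy' : y = ((y.1.1, y.1.2.1, -ψ y.1.1),
        (y.1.1 + j (y.2.2.1 - y.1.2.1), y.2.2.1, -ψ y.1.1)) :=
      Prod.ext (Prod.ext rfl (Prod.ext rfl k2)) (Prod.ext k1 (Prod.ext rfl k3))
    rw [hy', hL, h1, h2, h3]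
    have : ψ (x.1.1 + j (x.2.2.1 - x.1.2.1)) = ψ x.1.1 := by rw [map_add, hψj, add_zero]
    rw [this]
    simp
  · intro h
    have hx : ∀ m l l', A.form (x.2.1 - x.1.1 - j (x.2.2.1 - x.1.2.1)) m + ψ x.2.1 (l' - l) +
        (ψ x.2.1 + x.2.2.2) (k (m + j (l' - l))) - x.1.2.2 l + x.2.2.2 l' = 0 :=
      fun m l l' => (hL x m l l').symm.trans (h _ ((hmem _).2 ⟨rfl, rfl, rfl⟩))
    have hδ : ∀ i, A.form (x.2.1 - x.1.1 - j (x.2.2.1 - x.1.2.1)) (j i) =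
        ψ x.2.1 i - ψ x.1.1 i := fun i => by
      rw [← hψ, map_sub, hψj, sub_zero, map_sub, StarDual.sub_apply]
    -- The test vector is `(i, 0)` with `i = (j l, l, 0) ∈ I`. Here, as for `h3`, `m` is chosen so
    -- that `m + j(l' - l) = 0`, which removes the term with `k`.
    have h2 : x.1.2.2 = -ψ x.1.1 := StarDual.ext fun l => by
      have := hx (j l) l 0
      rw [zero_sub, map_neg j, add_neg_cancel, hδ] at this
      simp only [map_neg, map_zero, add_zero] at this
      rw [StarDual.neg_apply, ← sub_eq_zero, ← neg_eq_zero, ← this]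
      abel
    have h3 : x.2.2.2 = -ψ x.1.1 := StarDual.ext fun l => by
      have := hx (-j l) 0 l
      rw [sub_zero, neg_add_cancel, map_neg, hδ] at this
      simp only [map_zero, add_zero, sub_zero] at this
      rw [StarDual.neg_apply, ← sub_eq_zero, ← this]
      abel
    refine ⟨?_, h2, h3⟩
    -- With `h2` and `h3` inserted, the remaining condition on the difference `δ` reads `A(δ)(m +
    -- j(k m)) = 0` for all `m`, that is `B(u δ)(u m) = 0`. It is therefore the nonsingularity of
    -- `B` that applies.
    have h4 : x.2.1 - x.1.1 - j (x.2.2.1 - x.1.2.1) = 0 := by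
      refine (B.pull u).nonsing.1 (StarDual.ext fun m => ?_)
      rw [map_zero]
      have e1 := hx m 0 0
      simp only [sub_self, map_zero, add_zero, sub_zero, h3] at e1
      change B.form (u _) (u m) = 0
      rw [hB, map_add, hδ, ← e1, StarDual.add_apply, StarDual.neg_apply]
      abel
    rw [sub_sub, sub_eq_zero] at h4
    exact h4

end Witt

end Kreck

namespace Kreck

open StarDual

/-! ### Homotopic flip-isomorphisms have the same asymmetric signature -/

section Homotopy

variable {Λ : Type u} [Ring Λ] [StarRing Λ] {S : Submonoid Λ} [IsCentralMul S] {q : ℕ}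
  {z : Preform Λ q}

theorem map_units_smul {M N : Type*} [AddCommGroup M] [Module Λ M] [AddCommGroup N] [Module Λ N]
    (f : M →ₗ[Λ] N) (e : ℤˣ) (x : M) : f (e • x) = e • f x := by
  rcases Int.units_eq_one_or e with rfl | rfl <;> simp [Units.smul_def]

theorem dual_units_smul {M : Type*} [AddCommGroup M] [Module Λ M]
    (f : StarDual Λ M) (e : ℤˣ) (x : M) : f (e • x) = e • f x := by
  rcases Int.units_eq_one_or e with rfl | rfl <;> simp [Units.smul_def]

/-- The isomorphism `α^{-*} : F^* → F`. -/
noncomputable def Flip.co (t : Flip z) : StarDual Λ z.F ≃ₗ[Λ] z.F := (adjEquiv t.alpha).symm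

theorem Flip.alpha_co (t : Flip z) (x : z.F) (p : StarDual Λ z.F) :
    t.alpha x (t.co p) = star (p x) := by
  rw [← star_star (t.alpha x (t.co p)), ← adjEquiv_apply, Flip.co, LinearEquiv.apply_symm_apply]

theorem Flip.adj_co (t : Flip z) (p : StarDual Λ z.F) : adj t.alpha.toLinearMap (t.co p) = p :=
  StarDual.ext fun x => by
    rw [adj_apply, LinearEquiv.coe_coe, t.alpha_co, star_star]

theorem Flip.apply_co (t : Flip z) (f p : StarDual Λ z.F) :
    f (t.co p) = star (p (t.alpha.symm f)) := by
  rw [← t.alpha_co, LinearEquiv.apply_symm_apply]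

theorem Flip.co_mu (t : Flip z) (g : z.G) : t.co (z.mu g) = z.gamma (t.beta g) := t.cond_mu g

/-- The first flip condition solved by `α⁻¹`. It is the means of eliminating `σμ` from all later
calculations. -/
theorem Flip.gamma_add (t : Flip z) (g : z.G) :
    z.gamma g + t.sigma (z.mu g) = eps q • t.alpha.symm (z.mu (t.beta g)) := by
  have := congrArg t.alpha.symm (t.cond_gamma g)
  rw [← map_add, LinearEquiv.symm_apply_apply] at this
  rw [this]
  exact map_units_smul t.alpha.symm.toLinearMap _ _

theorem Flip.apply_sigma (t : Flip z) (f g : StarDual Λ z.F) :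
    g (t.sigma f) = -eps q • star (f (t.sigma g)) := by
  have := isSymm_iff.1 t.sigma_symm g f
  simp only [LinearMap.comp_apply, eval_apply, star_star] at this
  rw [this, units_smul_smul_self]

/-- The coordinates `F ⊕ F ⊕ F^*` on the module of the asymmetric signature. -/
noncomputable def Flip.coords (t : Flip z) :
    (z.F × z.F × StarDual Λ z.F) ≃ₗ[Λ] z.F × StarDual Λ z.F × z.F :=
  LinearEquiv.prodCongr (t.alpha.trans t.co) (LinearEquiv.prodCongr t.alpha t.co)

/-- The asymmetric signature in the coordinates `F ⊕ F ⊕ F^*`. -/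
noncomputable abbrev Flip.coordForm (t : Flip z) : AsymForm Λ := t.asymForm.pull t.coords

/-- Pulling `ρ` back along `(α^{-*}α, α, α^{-*})` turns every entry but one into a plain evaluation
and replaces `ασα^*` by `σ`. The dependence on the flip-isomorphism is thus confined to a single `α`
and a single `σ`. -/
theorem Flip.coordForm_apply (t : Flip z) (v w : z.F × z.F × StarDual Λ z.F) :
    t.coordForm.form v w = v.2.2 w.1 + t.alpha v.1 w.2.1 - eps q • v.2.2 w.2.1 +
      star (w.2.2 v.2.1) + eps q • star (w.2.2 (t.sigma v.2.2)) := by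
  change t.rho (t.co (t.alpha v.1), t.alpha v.2.1, t.co v.2.2)
    (t.co (t.alpha w.1), t.alpha w.2.1, t.co w.2.2) = _
  rw [t.rho_apply]
  change t.alpha (t.co v.2.2) (t.co (t.alpha w.1)) +
    (star (t.alpha w.2.1 (t.co (t.alpha v.1) - eps q • t.co v.2.2)) +
      (t.alpha v.2.1 (t.co w.2.2) + eps q • t.alpha (t.sigma
        (adj t.alpha.toLinearMap (t.co v.2.2))) (t.co w.2.2))) = _
  rw [t.adj_co, t.alpha_co, t.alpha_co, t.alpha_co, t.alpha_co, map_sub, dual_units_smul,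
    t.alpha_co, t.alpha_co, star_star, star_sub, star_units_smul, star_star, star_star]
  abel

/-! ### The isotropic map `G → F ⊕ F ⊕ F^*` -/

variable (t : Flip z)

/-- The map `G → F ⊕ F ⊕ F^*` with isotropic image. -/
noncomputable def Flip.iso : z.G →ₗ[Λ] z.F × z.F × StarDual Λ z.F :=
  LinearMap.prod (z.gamma + t.sigma ∘ₗ z.mu + eps q • (t.alpha.symm.toLinearMap ∘ₗ z.mu))
    (LinearMap.prod (eps q • z.gamma) z.mu)

theorem Flip.iso_apply (i : z.G) : t.iso i =
    (z.gamma i + t.sigma (z.mu i) + eps q • t.alpha.symm (z.mu i), eps q • z.gamma i, z.mu i) :=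
  rfl

/-- The two terms with `σ` cancel because `σ` is `(-ε)`-symmetric, and the two terms pairing the
`F^*`-coordinate of `v` with `γ l` cancel because of the factor `ε` in the second coordinate of
`t.iso`. -/
theorem Flip.coordForm_iso_right (v : z.F × z.F × StarDual Λ z.F) (l : z.G) :
    t.coordForm.form v (t.iso l) = eps q • v.2.2 (t.alpha.symm (z.mu l)) +
      eps q • t.alpha v.1 (z.gamma l) + star (z.mu l v.2.1) := by
  rw [t.coordForm_apply, t.iso_apply]
  simp only [map_add, dual_units_smul]
  rw [t.apply_sigma v.2.2 (z.mu l), star_units_smul, star_star, smul_smul, smul_smul, mul_neg,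
    Int.units_mul_self, one_smul, Units.neg_smul, one_smul]
  abel

theorem Flip.coordForm_iso_left (w : z.F × z.F × StarDual Λ z.F) (i : z.G) :
    t.coordForm.form (t.iso i) w = z.mu i w.1 + eps q • z.mu (t.beta i) w.2.1 +
      star (w.2.2 (t.alpha.symm (z.mu (t.beta i)))) := by
  rw [t.coordForm_apply, t.iso_apply, t.gamma_add, ← smul_add, ← map_add]
  have h : t.sigma (z.mu i) = eps q • t.alpha.symm (z.mu (t.beta i)) - z.gamma i := by
    rw [← t.gamma_add]; abel
  change z.mu i w.1 + t.alpha (eps q • t.alpha.symm (z.mu (t.beta i) + z.mu i)) w.2.1 -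
    eps q • z.mu i w.2.1 + star (w.2.2 (eps q • z.gamma i)) +
      eps q • star (w.2.2 (t.sigma (z.mu i))) = _
  have h' : ∀ x, t.alpha (eps q • x) = eps q • t.alpha x := map_units_smul t.alpha.toLinearMap _
  rw [h, h']
  simp only [LinearEquiv.apply_symm_apply, units_smul_apply, StarDual.add_apply,
    dual_units_smul, map_sub, star_sub, star_units_smul, smul_add, smul_sub, units_smul_smul_self]
  abel

/-- Pairing with the image of `t.iso` from the left or from the right agrees up to the automorphism
`εβ` of `G`; this follows by comparing the two preceding formulas through `α^{-*}μ = γβ`. It is the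
condition `hb` of `AsymForm.inflate_eq`. -/
theorem Flip.coordForm_iso_star (i : z.G) (w : z.F × z.F × StarDual Λ z.F) (b : z.G)
    (hb : b = eps q • t.beta i) :
    t.coordForm.form (t.iso i) w = star (t.coordForm.form w (t.iso b)) := by
  rw [hb, map_units_smul, dual_units_smul, t.coordForm_iso_left, t.coordForm_iso_right, t.mu_eq i]
  simp only [star_units_smul, star_add, star_star, smul_add, units_smul_smul_self]
  abel

/-- Once `α⁻¹μ` is removed by means of `α^{-*}μ = γβ`, only terms in `γ^*μ` evaluated at `i`, `l`
and their images under `β` remain, and these cancel in pairs by the `(-ε)`-symmetry of `γ^*μ`. -/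
theorem Flip.coordForm_iso_iso (i l : z.G) : t.coordForm.form (t.iso i) (t.iso l) = 0 := by
  have h1 : ∀ i l, z.mu i (t.alpha.symm (z.mu l)) = star (z.mu l (z.gamma (t.beta i))) :=
    fun i l => by rw [← t.co_mu, t.apply_co, star_star]
  rw [t.coordForm_iso_left, t.iso_apply, t.gamma_add, ← smul_add, ← map_add, dual_units_smul,
    map_add, map_add, h1, h1, h1, dual_units_smul, star_star, units_smul_smul_self,
    z.mu_gamma (t.beta i) l, z.mu_gamma (t.beta i) (t.beta l)]
  simp only [smul_add, Units.neg_smul]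
  abel

/-! ### Chain homotopies between flip-isomorphisms -/

variable (t' : Flip z)

/-- Equality on `coker μ` says that `α'^{-*} - α^{-*}` takes values in `γ(G)`, and `F^*` is
projective. -/
theorem Flip.exists_homotopy (h : t.cokerEquiv = t'.cokerEquiv) :
    ∃ κ : StarDual Λ z.F →ₗ[Λ] z.G, ∀ f, t'.co f - t.co f = z.gamma (κ f) := by
  have h1 : ∀ f, (t'.co - t.co : StarDual Λ z.F →ₗ[Λ] z.F) f ∈ LinearMap.range z.gamma := fun f => by
    have h2 := congrArg (fun l => l (Submodule.Quotient.mk f)) h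
    simp only [Flip.cokerEquiv_mk] at h2
    exact (Submodule.Quotient.eq _).1 h2.symm
  obtain ⟨κ, hκ⟩ := Module.projective_lifting_property z.gamma.rangeRestrict
    ((t'.co - t.co : StarDual Λ z.F →ₗ[Λ] z.F).codRestrict _ h1) z.gamma.surjective_rangeRestrict
  exact ⟨κ, fun f => (congrArg Subtype.val (LinearMap.congr_fun hκ f)).symm⟩

section

variable {t t'} {κ : StarDual Λ z.F →ₗ[Λ] z.G}

theorem Flip.beta_homotopy (hz : z.IsS S) (hκ : ∀ f, t'.co f - t.co f = z.gamma (κ f)) (g : z.G) :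
    t'.beta g - t.beta g = κ (z.mu g) :=
  hz.gamma.injective (by rw [← hκ, t.co_mu, t'.co_mu, map_sub])

/-- The dual `κ^*μ^* : F → F` of `μκ : F^* → F^*`. -/
noncomputable def dualEnd (φ : StarDual Λ z.F →ₗ[Λ] StarDual Λ z.F) : z.F →ₗ[Λ] z.F :=
  (evalEquiv z.F).symm.toLinearMap ∘ₗ dualMap φ ∘ₗ (evalEquiv z.F).toLinearMap

theorem apply_dualEnd (φ : StarDual Λ z.F →ₗ[Λ] StarDual Λ z.F) (p : StarDual Λ z.F) (x : z.F) :
    p (dualEnd φ x) = φ p x := by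
  rw [← star_star (p _), ← evalEquiv_apply]
  change star ((evalEquiv z.F) ((evalEquiv z.F).symm _) p) = _
  rw [LinearEquiv.apply_symm_apply]
  exact star_star _

theorem dual_separates {M : Type*} [AddCommGroup M] [Module Λ M] [Module.Free Λ M]
    [Module.Finite Λ M] {x y : M} (h : ∀ p : StarDual Λ M, p x = p y) : x = y :=
  (eval_bijective (Λ := Λ)).1 (StarDual.ext fun p => by rw [eval_apply, eval_apply, h])

/-- Every element of `F^*` has a multiple by an element of `S` in `μ(G)`, and `F` has no
`S`-torsion. -/
theorem eq_zero_of_comp_mu (hz : z.IsS S) {D : StarDual Λ z.F →ₗ[Λ] z.F}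
    (hD : ∀ g, D (z.mu g) = 0) : D = 0 := LinearMap.ext fun h => by
  obtain ⟨s, g, hs⟩ := hz.mu.exists_denom h
  exact regular_smul s (by rw [← map_smul, hs, hD])

/-- A flip-isomorphism determines `σμ = εα⁻¹μβ - γ`, and `σ` is determined by `σμ`. Hence the
homotopy `κ` fixes `σ' - σ`, and it suffices to verify the formula on the image of `μ`. -/
theorem Flip.sigma_homotopy (hz : z.IsS S) (hκ : ∀ f, t'.co f - t.co f = z.gamma (κ f))
    (h : StarDual Λ z.F) : t'.sigma h - t.sigma h =
      eps q • t.alpha.symm (z.mu (κ h)) - dualEnd (z.mu ∘ₗ κ) (t'.co h) := by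
  have key : t'.sigma - t.sigma - eps q • (t.alpha.symm.toLinearMap ∘ₗ z.mu ∘ₗ κ) +
      dualEnd (z.mu ∘ₗ κ) ∘ₗ t'.co.toLinearMap = 0 := by
    refine eq_zero_of_comp_mu hz fun g => ?_
    change t'.sigma (z.mu g) - t.sigma (z.mu g) - eps q • t.alpha.symm (z.mu (κ (z.mu g))) +
      dualEnd (z.mu ∘ₗ κ) (t'.co (z.mu g)) = 0
    -- Against `p ∈ F^*` the left side is `μ(κ p)(γβ' g)`. The `(-ε)`-symmetry of `γ^*μ` moves `κ p`
    -- under `γ`, where `γκ = α'^{-*} - α^{-*}` applies.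
    have h1 : dualEnd (z.mu ∘ₗ κ) (t'.co (z.mu g)) = eps q • (t.alpha.symm (z.mu (t'.beta g)) -
        t'.alpha.symm (z.mu (t'.beta g))) := by
      refine dual_separates (Λ := Λ) (M := z.F) fun p => ?_
      rw [apply_dualEnd, t'.co_mu, LinearMap.comp_apply, z.mu_gamma, ← hκ, map_sub, t'.apply_co,
        t.apply_co, dual_units_smul, map_sub, star_sub, star_star, star_star, Units.neg_smul,
        ← smul_neg, neg_sub]
    have h2 := t.gamma_add g
    have h3 := t'.gamma_add g
    rw [h1, eq_sub_of_add_eq' h2, eq_sub_of_add_eq' h3, ← Flip.beta_homotopy hz hκ, map_sub,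
      map_sub, smul_sub, smul_sub]
    abel
  have := LinearMap.congr_fun key h
  rw [LinearMap.add_apply, LinearMap.sub_apply, LinearMap.sub_apply] at this
  change t'.sigma h - t.sigma h - eps q • t.alpha.symm (z.mu (κ h)) +
    dualEnd (z.mu ∘ₗ κ) (t'.co h) = 0 at this
  rw [eq_sub_iff_add_eq, ← sub_eq_zero, ← this]
  abel

/-- The isomorphism of the modules of two asymmetric signatures defined by a homotopy. -/
noncomputable def Flip.shear (t t' : Flip z) (κ : StarDual Λ z.F →ₗ[Λ] z.G) :
    (z.F × z.F × StarDual Λ z.F) ≃ₗ[Λ] z.F × z.F × StarDual Λ z.F :=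
  let s : (z.F × StarDual Λ z.F) →ₗ[Λ] z.F :=
    (t'.sigma - t.sigma) ∘ₗ LinearMap.snd Λ z.F (StarDual Λ z.F) -
      eps q • (dualEnd (z.mu ∘ₗ κ) ∘ₗ LinearMap.fst Λ z.F (StarDual Λ z.F))
  { toFun := fun v => (v.1 + s v.2, v.2)
    invFun := fun v => (v.1 - s v.2, v.2)
    map_add' := fun v w => Prod.ext (by simp only [Prod.fst_add, Prod.snd_add, map_add]; abel) rfl
    map_smul' := fun a v => Prod.ext (by simp) rfl
    left_inv := fun v => Prod.ext (add_sub_cancel_right _ _) rfl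
    right_inv := fun v => Prod.ext (sub_add_cancel _ _) rfl }

theorem Flip.shear_apply (v : z.F × z.F × StarDual Λ z.F) : Flip.shear t t' κ v =
    (v.1 + ((t'.sigma v.2.2 - t.sigma v.2.2) - eps q • dualEnd (z.mu ∘ₗ κ) v.2.1), v.2) := rfl

/-- The shear of the first coordinate absorbs the change of `σ` and the `(μκ)^*`-part of the change
of `α`. What is left over is exactly the pairing with an element of the isotropic image, which is
the form of hypothesis `hB` in `AsymForm.inflate_eq`. -/
theorem Flip.coordForm_shear (hz : z.IsS S) (hκ : ∀ f, t'.co f - t.co f = z.gamma (κ f))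
    (v w : z.F × z.F × StarDual Λ z.F) :
    t'.coordForm.form (Flip.shear t t' κ v) (Flip.shear t t' κ w) =
      t.coordForm.form v (w + t.iso (-eps q • κ (t'.co.symm w.2.1))) := by
  -- Writing the second coordinate as `α'^{-*} h` turns `α'` into an evaluation of `h`. The
  -- difference between `α` and `α'` then shows up as `γ(κ h)`.
  obtain ⟨h, hh⟩ : ∃ h, t'.co h = w.2.1 := t'.co.surjective _
  have hα : ∀ x, t'.alpha x w.2.1 = star (h x) := fun x => by rw [← hh, t'.alpha_co]
  have e1 : t.alpha v.1 (z.gamma (κ h)) = t.alpha v.1 w.2.1 - star (h v.1) := by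
    rw [← hκ, map_sub, t.alpha_co, hh]
  have e2 : ∀ p f : StarDual Λ z.F, star (f (t'.sigma p - t.sigma p)) =
      -eps q • p (t'.sigma f - t.sigma f) := fun p f => by
    rw [map_sub, map_sub, t'.apply_sigma p f, t.apply_sigma p f, star_sub, star_units_smul,
      star_units_smul, star_star, star_star, smul_sub]
  have e3 : star (h (dualEnd (z.mu ∘ₗ κ) v.2.1)) = star (z.mu (κ h) v.2.1) := by
    rw [apply_dualEnd]; rfl
  have e4 : v.2.2 (dualEnd (z.mu ∘ₗ κ) w.2.1) = eps q • v.2.2 (t.alpha.symm (z.mu (κ h))) -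
      v.2.2 (t'.sigma h - t.sigma h) := by
    rw [Flip.sigma_homotopy hz hκ, hh, map_sub, dual_units_smul]
    abel
  have e5 : star (w.2.2 (t'.sigma v.2.2)) = star (w.2.2 (t.sigma v.2.2)) +
      -eps q • v.2.2 (t'.sigma w.2.2 - t.sigma w.2.2) := by
    rw [← e2, map_sub, star_sub]; abel
  rw [← hh, LinearEquiv.symm_apply_apply, map_add, map_units_smul, dual_units_smul,
    t.coordForm_iso_right, e1, t'.coordForm_apply, t.coordForm_apply, Flip.shear_apply,
    Flip.shear_apply]
  change v.2.2 (w.1 + ((t'.sigma w.2.2 - t.sigma w.2.2) - eps q • dualEnd (z.mu ∘ₗ κ) w.2.1)) +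
    t'.alpha (v.1 + ((t'.sigma v.2.2 - t.sigma v.2.2) - eps q • dualEnd (z.mu ∘ₗ κ) v.2.1)) w.2.1 -
    eps q • v.2.2 w.2.1 + star (w.2.2 v.2.1) + eps q • star (w.2.2 (t'.sigma v.2.2)) = _
  rw [hα, map_add, map_add, map_sub, map_sub h, star_add, star_sub, dual_units_smul,
    dual_units_smul, star_units_smul, e2, e3, e4, e5]
  simp only [smul_add, smul_sub, smul_neg, smul_smul, neg_mul, Int.units_mul_self, Units.neg_smul,
    one_smul]
  abel

end

/-- Sublagrangian reduction with `j = t.iso`, `b = εβ` and `k = -εκα'^*` on the middle coordinate.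
-/
theorem Flip.asymSig_eq (hz : z.IsS S) (h : t.cokerEquiv = t'.cokerEquiv) :
    t.asymSig = t'.asymSig := by
  obtain ⟨κ, hκ⟩ := t.exists_homotopy t' h
  have h1 : LAsy0.mk t.coordForm = LAsy0.mk t'.coordForm :=
    AsymForm.inflate_eq t.coordForm t'.coordForm (Flip.shear t t' κ) t.iso
      (-eps q • (κ ∘ₗ t'.co.symm.toLinearMap ∘ₗ LinearMap.fst Λ z.F (StarDual Λ z.F) ∘ₗ
        LinearMap.snd Λ z.F (z.F × StarDual Λ z.F)))
      (LinearEquiv.trans t.beta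
        { toFun := fun g => eps q • g
          invFun := fun g => eps q • g
          map_add' := fun g g' => smul_add _ g g'
          map_smul' := fun _ _ => smul_comm _ _ _
          left_inv := fun g => units_smul_smul_self _ g
          right_inv := fun g => units_smul_smul_self _ g })
      t.coordForm_iso_iso (fun i m => t.coordForm_iso_star i m _ rfl)
      (Flip.coordForm_shear hz hκ)
  rw [LAsy0.mk_eq_of_iso (t.asymForm.pull_iso t.coords),
    LAsy0.mk_eq_of_iso (t'.asymForm.pull_iso t'.coords)] at h1
  exact h1

end Homotopy

end Kreck

namespace Kreck

open StarDual

/-! ### Flip-isomorphisms inducing a given isometry -/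

section FlipOfEquiv

variable {Λ : Type u} [Ring Λ] [StarRing Λ] {S : Submonoid Λ} [IsCentralMul S] {q : ℕ}

theorem toLoc_injective : Function.Injective (toLoc S) := fun a b h => by
  rw [toLoc_apply, toLoc_apply, loc_eq_iff] at h
  simpa using h

/-- A symmetric sesquilinear form with values in `S⁻¹Λ` is integral if its values are. -/
theorem exists_integral_form {X : Type*} [AddCommGroup X] [Module Λ X] {e : ℤˣ}
    (D : X → X → Loc S) (add_right : ∀ x y y', D x (y + y') = D x y + D x y')
    (smul_right : ∀ (c : Λ) x y, D x (c • y) = c • D x y)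
    (symm : ∀ x y, D x y = e • locStar S (D y x)) (int : ∀ x y, ∃ a, toLoc S a = D x y) :
    ∃ φ : X →ₗ[Λ] StarDual Λ X, IsSymm e φ ∧ ∀ x y, toLoc S (φ x y) = D x y := by
  -- Since `Λ → S⁻¹Λ` is injective, the lifts to `Λ` are unique and inherit every identity of `D`.
  -- Additivity and semilinearity on the left come from linearity on the right together with the
  -- symmetry.
  choose d hd using int
  have hs : ∀ x y, d x y = e • star (d y x) := fun x y => toLoc_injective (S := S) (by
    rw [toLoc_units_smul, ← locStar_toLoc, hd, hd, ← symm])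
  have hadd : ∀ x y y', d x (y + y') = d x y + d x y' := fun x y y' =>
    toLoc_injective (S := S) (by rw [map_add, hd, hd, hd, add_right])
  have hsmul : ∀ (c : Λ) x y, d x (c • y) = c * d x y := fun c x y =>
    toLoc_injective (S := S) (by rw [← smul_eq_mul, map_smul, hd, hd, smul_right])
  refine ⟨{
    toFun := fun x => of { toFun := d x, map_add' := hadd x, map_smul' := fun c y => hsmul c x y }
    map_add' := fun x x' => StarDual.ext fun y => ?_
    map_smul' := fun c x => StarDual.ext fun y => ?_ }, isSymm_iff.2 hs, hd⟩
  · change d (x + x') y = d x y + d x' y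
    rw [hs, hadd, star_add, smul_add, ← hs, ← hs]
  · change d (c • x) y = d x y * star c
    rw [hs, hsmul, star_mul, ← smul_mul_assoc, ← hs]

/-- Taking `α = A^{-*}` gives `α^{-*} = A`: this is how a prescribed isomorphism `F^* → F` becomes
the second map of a flip-isomorphism. -/
theorem adjEquiv_adjEquiv_symm {M : Type*} [AddCommGroup M] [Module Λ M] [Module.Free Λ M]
    [Module.Finite Λ M] (A : StarDual Λ M ≃ₗ[Λ] M) : adjEquiv (adjEquiv A.symm) = A.symm := by
  refine LinearEquiv.ext fun y => StarDual.ext fun x => ?_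
  rw [adjEquiv_apply, adjEquiv_apply, star_star]

variable {z : Preform Λ q}

/-- An isomorphism `F^* → F` that lifts an isomorphism of cokernels restricts to an automorphism
of `G`. -/
theorem exists_beta (hz : z.IsS S) (l : z.cokerMu ≃ₗ[Λ] z.cokerGamma) (A : StarDual Λ z.F ≃ₗ[Λ] z.F)
    (hA : ∀ x, l (Submodule.Quotient.mk x) = Submodule.Quotient.mk (A x)) :
    ∃ β : z.G ≃ₗ[Λ] z.G, ∀ g, A (z.mu g) = z.gamma (β g) := by
  -- As `l` is injective, `A x` lies in `γ(G)` if and only if `x` lies in `μ(G)`. The automorphism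
  -- of `G` is `A` restricted to `μ(G) → γ(G)`, both ends being copies of `G`.
  have hrange : (LinearMap.range z.mu).map (A : StarDual Λ z.F →ₗ[Λ] z.F) =
      LinearMap.range z.gamma := by
    ext x
    obtain ⟨x, rfl⟩ := A.surjective x
    rw [Submodule.mem_map_equiv, LinearEquiv.symm_apply_apply,
      ← Submodule.Quotient.mk_eq_zero (LinearMap.range z.gamma), ← hA,
      LinearEquiv.map_eq_zero_iff, Submodule.Quotient.mk_eq_zero]
  let β := (LinearEquiv.ofInjective z.mu hz.mu.injective).trans
    ((A.submoduleMap (LinearMap.range z.mu)).trans ((LinearEquiv.ofEq _ _ hrange).trans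
      (LinearEquiv.ofInjective z.gamma hz.gamma.injective).symm))
  refine ⟨β, fun g => ?_⟩
  have : LinearEquiv.ofInjective z.gamma hz.gamma.injective (β g) =
      LinearEquiv.ofEq _ _ hrange (A.submoduleMap (LinearMap.range z.mu)
        (LinearEquiv.ofInjective z.mu hz.mu.injective g)) := LinearEquiv.apply_symm_apply _ _
  exact (congrArg Subtype.val this).symm

/-- An isomorphism `F^* → F` that lifts an isometry of linking forms is part of a
flip-isomorphism. -/
theorem exists_flip (hz : z.IsS S) (l : (z.linkMu hz).Isometry (z.linkGamma hz))
    (A : StarDual Λ z.F ≃ₗ[Λ] z.F)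
    (hA : ∀ x, l.toLinearEquiv (Submodule.Quotient.mk x) = Submodule.Quotient.mk (A x)) :
    ∃ t : Flip z, t.cokerEquiv = l.toLinearEquiv ∧ t.co = A := by
  obtain ⟨β, hβ⟩ := exists_beta hz l.toLinearEquiv A hA
  -- The pairings on `coker γ` and `coker μ` lift to forms with values in `S⁻¹Λ`. That `l` is an
  -- isometry says precisely that the difference of these lifts, compared through `A`, has values in
  -- `Λ`.
  obtain ⟨φ, hφ, hφ'⟩ := exists_integral_form (S := S) (e := -eps q)
    (fun x y => pair hz.gamma (eps q • adj z.mu) (A x) (A y) - pair hz.mu (dualMap z.gamma) x y)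
    (fun x y y' => by rw [map_add, pair_add_right, pair_add_right]; abel)
    (fun c x y => by rw [map_smul, pair_smul_right, pair_smul_right]; exact (smul_sub c (_ : Loc S) _).symm)
    (fun x y => by
      rw [map_sub, smul_sub, ← pair_symm hz.gamma z.adj_mu_gamma,
        ← pair_symm hz.mu z.dualMap_gamma_mu])
    (fun x y => by
      have h := l.map_form (Submodule.Quotient.mk x) (Submodule.Quotient.mk y)
      rw [hA, hA, z.linkGamma_mk, z.linkMu_mk] at h
      exact (Submodule.Quotient.eq _).1 h)
  have hco : (adjEquiv (adjEquiv A.symm)).symm = A := by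
    rw [adjEquiv_adjEquiv_symm, LinearEquiv.symm_symm]
  -- The sign `-ε` makes `σ` satisfy `x(σ y) = φ(x)(y)`, by the `(-ε)`-symmetry of `φ`.
  let σ : StarDual Λ z.F →ₗ[Λ] z.F := (evalEquiv z.F).symm.toLinearMap ∘ₗ (-eps q • φ)
  have hσ : ∀ x, eval (σ x) = -eps q • φ x := fun x =>
    LinearEquiv.apply_symm_apply (evalEquiv z.F) _
  have hσ' : ∀ x y : StarDual Λ z.F, x (σ y) = φ x y := fun x y => by
    rw [← star_star (x _), ← eval_apply, hσ, units_smul_apply, star_units_smul]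
    exact (isSymm_iff.1 hφ x y).symm
  have hα : ∀ (x : z.F) (p : StarDual Λ z.F), adjEquiv A.symm x (A p) = star (p x) := fun x p => by
    rw [adjEquiv_apply, LinearEquiv.symm_apply_apply]
  refine ⟨⟨adjEquiv A.symm, β, σ, ?_, fun g => ?_, fun g => ?_⟩, ?_, ?_⟩
  · refine isSymm_iff.2 fun x y => ?_
    change eval (σ x) y = -eps q • star (eval (σ y) x)
    rw [hσ, hσ, units_smul_apply, units_smul_apply,
      star_units_smul, isSymm_iff.1 hφ x y]
  · refine StarDual.ext fun x => ?_
    -- At `x = A p` the flip condition is the conjugate of the defining equation of `φ` at `(p, μ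
    -- g)`: both pairings have denominator `1` there, namely `ε` times the conjugate of `μ(β g)(A
    -- p)`, and `p(γ g)`.
    obtain ⟨p, rfl⟩ := A.surjective x
    rw [StarDual.add_apply, hα, hα, units_smul_apply, hσ']
    have h := hφ' p (z.mu g)
    rw [hβ, pair_right_range, pair_right_range, ← map_sub] at h
    rw [toLoc_injective h, LinearMap.smul_apply, units_smul_apply, adj_apply, ← star_add,
      dualMap_apply, add_sub_cancel, star_units_smul, star_star]
  · rw [hco, hβ]
  · refine LinearEquiv.ext fun x => ?_
    obtain ⟨x, rfl⟩ := Submodule.Quotient.mk_surjective _ x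
    rw [Flip.cokerEquiv_mk, hA, hco]
  · exact hco

end FlipOfEquiv

/-! ### Stabilization -/

section Stabilize

variable {Λ : Type u} [Ring Λ] [StarRing Λ] {S : Submonoid Λ} [IsCentralMul S] {q : ℕ}

theorem exists_factor {G F X : Type*} [AddCommGroup G] [Module Λ G] [AddCommGroup F] [Module Λ F]
    [AddCommGroup X] [Module Λ X] [Module.Projective Λ X] (γ : G →ₗ[Λ] F) (f : X →ₗ[Λ] F)
    (h : ∀ x, f x ∈ LinearMap.range γ) : ∃ κ : X →ₗ[Λ] G, ∀ x, f x = γ (κ x) := by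
  obtain ⟨κ, hκ⟩ := Module.projective_lifting_property γ.rangeRestrict (f.codRestrict _ h)
    γ.surjective_rangeRestrict
  exact ⟨κ, fun x => (congrArg Subtype.val (LinearMap.congr_fun hκ x)).symm⟩

/-- A homomorphism of quotients lifts to projective modules. -/
theorem exists_quotient_lift {X Y : Type*} [AddCommGroup X] [Module Λ X] [Module.Projective Λ X]
    [AddCommGroup Y] [Module Λ Y] {P : Submodule Λ X} {Q : Submodule Λ Y}
    (l : (X ⧸ P) →ₗ[Λ] Y ⧸ Q) :
    ∃ a : X →ₗ[Λ] Y, ∀ x, l (Submodule.Quotient.mk x) = Submodule.Quotient.mk (a x) := by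
  obtain ⟨a, ha⟩ := Module.projective_lifting_property Q.mkQ (l ∘ₗ P.mkQ) (Submodule.mkQ_surjective _)
  exact ⟨a, fun x => (LinearMap.congr_fun ha x).symm⟩

variable {z : Preform Λ q}

/-- The homotopy-theoretic data for lifts `a` and `a'` of an isomorphism of cokernels and its
inverse yield an isomorphism `F^* ⊕ G ≅ F ⊕ G`. -/
theorem exists_stable_equiv (hz : z.IsS S) (l : z.cokerMu ≃ₗ[Λ] z.cokerGamma)
    (a : StarDual Λ z.F →ₗ[Λ] z.F) (a' : z.F →ₗ[Λ] StarDual Λ z.F)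
    (ha : ∀ x, l (Submodule.Quotient.mk x) = Submodule.Quotient.mk (a x))
    (ha' : ∀ y, l.symm (Submodule.Quotient.mk y) = Submodule.Quotient.mk (a' y)) :
    ∃ E : (StarDual Λ z.F × z.G) ≃ₗ[Λ] z.F × z.G,
      (∀ x g, (E (x, g)).1 = a x + z.gamma g) ∧
      ∀ x, z.mu (E (x, 0)).2 = a' (a x) - x := by
  -- `(a, b)` and `(a', b')` are chain maps between the complexes `μ` and `γ` that are homotopy
  -- inverse to each other, with homotopies `h` for `a'a - 1` and `h'` for `aa' - 1`.
  obtain ⟨b, hb⟩ := exists_factor z.gamma (a ∘ₗ z.mu) fun g => by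
    rw [← Submodule.Quotient.mk_eq_zero, LinearMap.comp_apply, ← ha, LinearEquiv.map_eq_zero_iff,
      Submodule.Quotient.mk_eq_zero]
    exact ⟨g, rfl⟩
  obtain ⟨b', hb'⟩ := exists_factor z.mu (a' ∘ₗ z.gamma) fun g => by
    rw [← Submodule.Quotient.mk_eq_zero, LinearMap.comp_apply, ← ha', LinearEquiv.map_eq_zero_iff,
      Submodule.Quotient.mk_eq_zero]
    exact ⟨g, rfl⟩
  obtain ⟨h, hh⟩ := exists_factor z.mu (a' ∘ₗ a - LinearMap.id) fun x =>
    (Submodule.Quotient.eq _).1 (by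
      change _ = Submodule.Quotient.mk x
      rw [LinearMap.comp_apply, ← ha', ← ha, LinearEquiv.symm_apply_apply])
  obtain ⟨h', hh'⟩ := exists_factor z.gamma (a ∘ₗ a' - LinearMap.id) fun x =>
    (Submodule.Quotient.eq _).1 (by
      change _ = Submodule.Quotient.mk x
      rw [LinearMap.comp_apply, ← ha, ← ha', LinearEquiv.apply_symm_apply])
  replace hb : ∀ g, z.gamma (b g) = a (z.mu g) := fun g => (hb g).symm
  replace hb' : ∀ g, z.mu (b' g) = a' (z.gamma g) := fun g => (hb' g).symm
  replace hh : ∀ x, z.mu (h x) = a' (a x) - x := fun x => (hh x).symm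
  replace hh' : ∀ x, z.gamma (h' x) = a (a' x) - x := fun x => (hh' x).symm
  -- The matrices `(a γ; h b')` and `(a' -μ; -h' b)` are mutually inverse. The first rows of the
  -- products are the homotopy relations; the second rows are checked after applying the injective
  -- maps `μ` and `γ`.
  let f : (StarDual Λ z.F × z.G) →ₗ[Λ] z.F × z.G :=
    LinearMap.prod (LinearMap.coprod a z.gamma) (LinearMap.coprod h b')
  let f' : (z.F × z.G) →ₗ[Λ] StarDual Λ z.F × z.G :=
    LinearMap.prod (LinearMap.coprod a' (-z.mu)) (LinearMap.coprod (-h') b)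
  have e : ∀ x, f x = (a x.1 + z.gamma x.2, h x.1 + b' x.2) := fun _ => rfl
  have e' : ∀ x, f' x = (a' x.1 + -z.mu x.2, -h' x.1 + b x.2) := fun _ => rfl
  have h1 : ∀ x, f (f' x) = x := fun x => by
    rw [e', e]
    refine Prod.ext ?_ (hz.mu.injective ?_)
    · simp only [map_add, map_neg, hb, hh']
      abel
    · simp only [map_add, map_neg, hb', hh, hb, hh', map_sub]
      abel
  have h2 : ∀ x, f' (f x) = x := fun x => by
    rw [e, e']
    refine Prod.ext ?_ (hz.gamma.injective ?_)
    · simp only [map_add, hb', hh]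
      abel
    · simp only [map_add, map_neg, hb', hh, hb, hh', map_sub]
      abel
  refine ⟨LinearEquiv.ofLinearMap f f' (LinearMap.ext h1) (LinearMap.ext h2), fun x g => rfl,
    fun x => ?_⟩
  change z.mu (h x + b' 0) = _
  rw [map_zero, add_zero, hh]

theorem hyp_cokerGamma_subsingleton (L : Type u) [AddCommGroup L] [Module Λ L] [Module.Free Λ L]
    [Module.Finite Λ L] (φ : StarDual Λ L →ₗ[Λ] StarDual Λ (StarDual Λ L))
    (hφ : IsSymm (-eps q) φ) : Subsingleton (Preform.hyp q L φ hφ).cokerGamma :=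
  ⟨fun x y => by
    obtain ⟨x, rfl⟩ := Submodule.Quotient.mk_surjective _ x
    obtain ⟨y, rfl⟩ := Submodule.Quotient.mk_surjective _ y
    exact (Submodule.Quotient.eq _).2 ⟨x - y, rfl⟩⟩

/-- The hyperbolic form is nonsingular for every `φ`, being triangular with respect to `L ⊕ L^*`.
Its boundary therefore has trivial cokernels. -/
theorem hyp_mu_bijective (L : Type u) [AddCommGroup L] [Module Λ L] [Module.Free Λ L]
    [Module.Finite Λ L] (φ : StarDual Λ L →ₗ[Λ] StarDual Λ (StarDual Λ L))
    (hφ : IsSymm (-eps q) φ) : Function.Bijective (Preform.hyp q L φ hφ).mu := by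
  have e : ∀ x : L × StarDual Λ L, (Preform.hyp q L φ hφ).mu x =
    prodEquiv (x.2, -eps q • eval x.1 + φ x.2) := fun _ => rfl
  constructor
  · rw [injective_iff_map_eq_zero]
    intro x hx
    rw [e, EmbeddingLike.map_eq_zero_iff, Prod.mk_eq_zero] at hx
    obtain ⟨h1, h2⟩ := hx
    rw [h1, map_zero, add_zero, smul_eq_zero_iff_eq] at h2
    exact Prod.ext (eval_bijective.1 (h2.trans (map_zero eval).symm)) h1
  · intro f
    obtain ⟨⟨p, r⟩, rfl⟩ := prodEquiv.surjective f
    obtain ⟨x, hx⟩ := (eval_bijective (Λ := Λ) (M := L)).2 (-eps q • (r - φ p))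
    refine ⟨(x, p), ?_⟩
    rw [e, hx, units_smul_smul_self, sub_add_cancel]

theorem Preform.IsS.hyp (L : Type u) [AddCommGroup L] [Module Λ L] [Module.Free Λ L]
    [Module.Finite Λ L] (φ : StarDual Λ L →ₗ[Λ] StarDual Λ (StarDual Λ L))
    (hφ : IsSymm (-eps q) φ) : (Preform.hyp q L φ hφ).IsS S where
  gamma := IsSIso.of_bijective Function.bijective_id
  mu := IsSIso.of_bijective (hyp_mu_bijective L φ hφ)

/-- The isomorphism `F^* ⊕ G^* ⊕ G^{**} ≅ F ⊕ G ⊕ G^*` defined by an isomorphism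
`F^* ⊕ G ≅ F ⊕ G`. -/
noncomputable def stableEquiv {V F G : Type u} [AddCommGroup V] [Module Λ V]
    [AddCommGroup F] [Module Λ F] [AddCommGroup G] [Module Λ G] [Module.Free Λ G]
    [Module.Finite Λ G] (E : (V × G) ≃ₗ[Λ] F × G) :
    (V × StarDual Λ G × StarDual Λ (StarDual Λ G)) ≃ₗ[Λ] F × G × StarDual Λ G where
  toFun x := ((E (x.1, (evalEquiv G).symm x.2.2)).1, (E (x.1, (evalEquiv G).symm x.2.2)).2, x.2.1)
  invFun y := ((E.symm (y.1, y.2.1)).1, y.2.2, evalEquiv G (E.symm (y.1, y.2.1)).2)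
  map_add' x y := by
    have : (x.1 + y.1, (evalEquiv G).symm x.2.2 + (evalEquiv G).symm y.2.2) =
      (x.1, (evalEquiv G).symm x.2.2) + (y.1, (evalEquiv G).symm y.2.2) := rfl
    simp only [Prod.fst_add, Prod.snd_add, map_add, this]
    rfl
  map_smul' c x := by
    have : (c • x.1, c • (evalEquiv G).symm x.2.2) = c • (x.1, (evalEquiv G).symm x.2.2) := rfl
    simp only [Prod.smul_fst, Prod.smul_snd, map_smul, this]
    rfl
  left_inv x := by simp
  right_inv y := by simp

/-- After addition of `y^G`, every isometry of linking forms is induced by a flip-isomorphism. -/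
theorem exists_stable_flip (hz : z.IsS S) (l : (z.linkMu hz).Isometry (z.linkGamma hz))
    (a : StarDual Λ z.F →ₗ[Λ] z.F) (a' : z.F →ₗ[Λ] StarDual Λ z.F)
    (ha : ∀ x, l.toLinearEquiv (Submodule.Quotient.mk x) = Submodule.Quotient.mk (a x))
    (ha' : ∀ y, l.toLinearEquiv.symm (Submodule.Quotient.mk y) = Submodule.Quotient.mk (a' y)) :
    ∃ t : Flip (z.add (Preform.hyp0 q z.G)),
      t.cokerEquiv = sumCoker l.toLinearEquiv (Flip.hyp0 q z.G).cokerEquiv ∧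
      ∀ x f, a' (a x) = x → t.co (prodEquiv (x, prodEquiv (f, 0))) = (a x, 0, f) := by
  obtain ⟨E, hE, hE'⟩ := exists_stable_equiv hz l.toLinearEquiv a a' ha ha'
  have hy : (Preform.hyp0 (Λ := Λ) q z.G).IsS S := Preform.IsS.hyp _ _ _
  -- The summand `G^{**} = G` of the dual of `F ⊕ (G ⊕ G^*)` plays the role of `G` in `F^* ⊕ G ≅ F ⊕
  -- G`, while `G^*` is carried identically to `G^*`.
  let A : StarDual Λ (z.F × z.G × StarDual Λ z.G) ≃ₗ[Λ] z.F × z.G × StarDual Λ z.G :=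
    prodEquiv.symm.trans ((LinearEquiv.prodCongr (LinearEquiv.refl Λ _) prodEquiv.symm).trans
      (stableEquiv E))
  have hA : ∀ x f r, A (prodEquiv (x, prodEquiv (f, r))) =
      ((E (x, (evalEquiv z.G).symm r)).1, (E (x, (evalEquiv z.G).symm r)).2, f) := fun x f r => by
    change stableEquiv E ((prodEquiv.symm (prodEquiv _)).1,
      prodEquiv.symm (prodEquiv.symm (prodEquiv _)).2) = _
    rw [LinearEquiv.symm_apply_apply, LinearEquiv.symm_apply_apply]
    rfl
  have : Subsingleton (Preform.hyp0 (Λ := Λ) q z.G).cokerGamma :=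
    hyp_cokerGamma_subsingleton _ _ _
  obtain ⟨t, ht, hco⟩ := exists_flip (hz.add hy)
    (sumIsometry l ((Flip.hyp0 q z.G).isometry hy)) A fun x => by
      obtain ⟨⟨x, x'⟩, rfl⟩ := prodEquiv.surjective x
      obtain ⟨⟨f, r⟩, rfl⟩ := prodEquiv.surjective x'
      -- The cokernels of `y^G` vanish, so only the `F`-component matters. Modulo `γ(G)` that
      -- component is `a x`.
      refine (sumCoker_mk _ _ _ _).2 ⟨?_, Subsingleton.elim _ _⟩
      rw [hA]
      change l.toLinearEquiv (Submodule.Quotient.mk x) = Submodule.Quotient.mk (E _).1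
      rw [hE, ha]
      exact (Submodule.Quotient.eq _).2 ⟨-(evalEquiv z.G).symm r, by rw [map_neg]; abel⟩
  refine ⟨t, ht, fun x f hx => ?_⟩
  rw [hco, hA, map_zero]
  -- The `G`-component at `(x, 0)` is the homotopy `h x` with `μ(h x) = a'(a x) - x`, which vanishes
  -- where the two lifts are strictly inverse to each other. This control is needed for flips that
  -- fix a lagrangian.
  refine Prod.ext ?_ (Prod.ext (hz.mu.injective ?_) rfl)
  · change (E (x, 0)).1 = _
    rw [hE, map_zero, add_zero]
  · change z.mu (E (x, 0)).2 = _
    rw [hE', hx, sub_self, map_zero]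

/-- In the linking monoid the pair consisting of `y^G` and its only isometry is zero, so stabilizing
by `y^G` does not change the class. -/
theorem LinkMonoid.mk_eq_L (hz : z.IsS S) (l : (z.linkMu hz).Isometry (z.linkGamma hz))
    (hs : (z.add (Preform.hyp0 q z.G)).IsS S) (t : Flip (z.add (Preform.hyp0 q z.G)))
    (ht : t.cokerEquiv = sumCoker l.toLinearEquiv (Flip.hyp0 q z.G).cokerEquiv) :
    FlipMonoid.L S q (FlipMonoid.mk _ hs t) = LinkMonoid.mk z hz l := by
  have hy : (Preform.hyp0 (Λ := Λ) q z.G).IsS S := Preform.IsS.hyp _ _ _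
  have h1 : FlipMonoid.L S q (FlipMonoid.mk _ hs t) = LinkMonoid.mk z hz l +
      LinkMonoid.mk _ hy ((Flip.hyp0 q z.G).isometry hy) :=
    StableSystem.cls_eq_of_iso _ ⟨StrongIso.refl _, fun x y h => by
      change t.cokerEquiv _ = _ at h
      rw [ht] at h
      exact h⟩
  have h2 : LinkMonoid.mk _ hy ((Flip.hyp0 q z.G).isometry hy) = 0 :=
    StableSystem.cls_stab _ ⟨z.G, _, _, inferInstance, inferInstance, ⟨StrongIso.refl _⟩⟩
  rw [h1, h2, add_zero]

theorem FlipMonoid.L_surjective : Function.Surjective (FlipMonoid.L (Λ := Λ) S q) := by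
  rintro ⟨z, hz, l⟩
  obtain ⟨a, ha⟩ := exists_quotient_lift l.toLinearEquiv.toLinearMap
  obtain ⟨a', ha'⟩ := exists_quotient_lift l.toLinearEquiv.symm.toLinearMap
  obtain ⟨t, ht, -⟩ := exists_stable_flip hz l a a' ha ha'
  exact ⟨FlipMonoid.mk _ (hz.add (Preform.IsS.hyp _ _ _)) t, LinkMonoid.mk_eq_L hz l _ t ht⟩

end Stabilize

end Kreck

namespace Kreck

open StarDual

/-! ### The asymmetric signature on the linking-`l`-monoid -/

section Signature

variable {Λ : Type u} [Ring Λ] [StarRing Λ] {S : Submonoid Λ} [IsCentralMul S] {q : ℕ}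
  {z z' : Preform Λ q}

/-- Flip-isomorphisms are transported by strong isomorphisms. -/
theorem StrongIso.exists_compatFlip (i : StrongIso z z') (t' : Flip z') :
    ∃ t : Flip z, i.CompatFlip t t' := by
  let α : z.F ≃ₗ[Λ] StarDual Λ z.F := i.eta.trans (t'.alpha.trans (dualEquiv i.eta).symm)
  let β : z.G ≃ₗ[Λ] z.G := i.zeta.trans (t'.beta.trans i.zeta.symm)
  let σ : StarDual Λ z.F →ₗ[Λ] z.F :=
    i.eta.symm.toLinearMap ∘ₗ t'.sigma ∘ₗ (dualEquiv i.eta).toLinearMap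
  have hα : ∀ x, t'.alpha (i.eta x) = dualEquiv i.eta (α x) := fun x =>
    (LinearEquiv.apply_symm_apply _ _).symm
  have hβ : ∀ g, t'.beta (i.zeta g) = i.zeta (β g) := fun g =>
    (LinearEquiv.apply_symm_apply _ _).symm
  have hσ : ∀ f, t'.sigma (dualEquiv i.eta f) = i.eta (σ f) := fun f =>
    (LinearEquiv.apply_symm_apply _ _).symm
  refine ⟨⟨α, β, σ, isSymm_iff.2 fun f g => ?_, fun g => ?_, fun g => ?_⟩, hα, hβ, hσ⟩
  · exact isSymm_iff.1 t'.sigma_symm (dualEquiv i.eta f) (dualEquiv i.eta g)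
  · refine (dualEquiv i.eta).injective ?_
    have h := map_units_smul (dualEquiv i.eta).toLinearMap (eps q) (z.mu (β g))
    rw [LinearEquiv.coe_coe] at h
    rw [map_add, ← hα, ← hα, ← hσ, i.gamma_comm, i.mu_comm, t'.cond_gamma, h, i.mu_comm, hβ]
  · rw [LinearEquiv.symm_apply_eq]
    refine StarDual.ext fun x => ?_
    have h := t'.mu_eq (i.zeta g) (i.eta x)
    rw [hα, hβ, ← i.gamma_comm, ← i.mu_comm, dualEquiv_apply, dualEquiv_apply,
      LinearEquiv.symm_apply_apply, LinearEquiv.symm_apply_apply] at h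
    rw [h, adjEquiv_apply]

/-- A strong isomorphism induces isomorphisms on both cokernels, so the isomorphism `l'` pulls back
in only one way. -/
theorem StrongIso.CompatLink.left_unique {i : StrongIso z z'}
    {l m : z.cokerMu ≃ₗ[Λ] z.cokerGamma} {l' : z'.cokerMu ≃ₗ[Λ] z'.cokerGamma}
    (h : i.CompatLink l l') (k : i.CompatLink m l') : l = m := by
  refine LinearEquiv.ext fun x => ?_
  obtain ⟨x, rfl⟩ := Submodule.Quotient.mk_surjective _ x
  obtain ⟨y, hy⟩ := Submodule.Quotient.mk_surjective _ (l (Submodule.Quotient.mk x))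
  have h1 := k.symm _ _ (h _ _ hy.symm)
  have h2 : dualEquiv i.symm.eta (dualEquiv i.eta x) = x := dualMap_symm_trans i.eta x
  have h3 : i.symm.eta (i.eta y) = y := i.eta.symm_apply_apply y
  rw [h2, h3] at h1
  rw [h1, hy]

theorem StrongIso.cokerGamma_subsingleton (i : StrongIso z z') [Subsingleton z'.cokerGamma] :
    Subsingleton z.cokerGamma := ⟨fun x y => by
  obtain ⟨x, rfl⟩ := Submodule.Quotient.mk_surjective _ x
  obtain ⟨y, rfl⟩ := Submodule.Quotient.mk_surjective _ y
  have h := StrongIso.eta_range (i := i.symm) (Subsingleton.elim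
    (Submodule.Quotient.mk (i.eta x) : z'.cokerGamma) (Submodule.Quotient.mk (i.eta y)))
  have h3 : ∀ y, i.symm.eta (i.eta y) = y := i.eta.symm_apply_apply
  rwa [h3, h3] at h⟩

theorem Flip.asymSig_add (t : Flip z) (u : Flip z') :
    (t.add u).asymSig = t.asymSig + u.asymSig :=
  StableSystem.cls_eq_of_iso _ (t.asymForm_add u)

theorem StrongIso.CompatFlip.asymSig_eq {i : StrongIso z z'} {t : Flip z} {t' : Flip z'}
    (h : i.CompatFlip t t') : t.asymSig = t'.asymSig :=
  StableSystem.cls_eq_of_iso _ h.asymForm_iso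

/-- A stabilizing object carries a flip-isomorphism with vanishing asymmetric signature. -/
theorem exists_flip_of_stab {h : LinkPair S q} (hs : (LinkPair.system S q).Stab h) :
    ∃ u : Flip h.z, u.asymSig = 0 ∧ u.cokerEquiv = h.iso.toLinearEquiv := by
  obtain ⟨L, _, _, _, _, ⟨i⟩⟩ := hs
  obtain ⟨u, hu⟩ := i.exists_compatFlip (Flip.hyp0 q L)
  have := hyp_cokerGamma_subsingleton (Λ := Λ) (q := q) L 0 (isSymm_zero _)
  have := i.cokerGamma_subsingleton
  -- Any two isomorphisms of the vanishing cokernels agree, so the transported `t^L` induces the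
  -- given isometry.
  refine ⟨u, ?_, LinearEquiv.ext fun x => Subsingleton.elim _ _⟩
  rw [hu.asymSig_eq]
  exact StableSystem.cls_stab _ (Flip.asymForm_hyp L)

/-- Equality in the linking monoid is an isomorphism after stabilization. Stabilizers carry
flip-isomorphisms of signature zero, and flip-isomorphisms can be pulled back along strong
isomorphisms, so everything reduces to two flip-isomorphisms of one preformation inducing the same
map of cokernels. -/
theorem Flip.asymSig_eq_of_link_eq (hz : z.IsS S) (hz' : z'.IsS S) (t : Flip z) (t' : Flip z')
    (h : LinkMonoid.mk z hz (t.isometry hz) = LinkMonoid.mk z' hz' (t'.isometry hz')) :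
    t.asymSig = t'.asymSig := by
  obtain ⟨x, x', hx, hx', j, hj⟩ := Quotient.exact h
  obtain ⟨u, hu, hul⟩ := exists_flip_of_stab hx
  obtain ⟨u', hu', hul'⟩ := exists_flip_of_stab hx'
  obtain ⟨r, hr⟩ := j.exists_compatFlip (t'.add u')
  have h1 : (t.add u).asymSig = r.asymSig := by
    refine Flip.asymSig_eq (t.add u) r (hz.add x.isS) ?_
    -- Both `t ⊕ u` and `r` correspond under `j` to the same isomorphism of cokernels: the former by
    -- the assumed equality of classes, the latter by construction.
    refine StrongIso.CompatLink.left_unique (i := j)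
      (l' := sumCoker t'.cokerEquiv x'.iso.toLinearEquiv) (fun f y hfy => ?_) fun f y hfy => ?_
    · refine hj f y ?_
      have := t.add_compatLink u f y hfy
      rw [hul] at this
      exact this
    · have := t'.add_compatLink u' _ _ (hr.compatLink f y hfy)
      rw [hul'] at this
      exact this
  rw [← add_zero t.asymSig, ← hu, ← Flip.asymSig_add, h1, hr.asymSig_eq]
  exact (Flip.asymSig_add t' u').trans (by rw [hu', add_zero])

theorem FlipMonoid.sig_eq_of_L_eq {x y : FlipMonoid S q}
    (h : FlipMonoid.L S q x = FlipMonoid.L S q y) :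
    FlipMonoid.sig S q x = FlipMonoid.sig S q y := by
  obtain ⟨⟨z, hz, t⟩⟩ := x
  obtain ⟨⟨z', hz', t'⟩⟩ := y
  exact Flip.asymSig_eq_of_link_eq hz hz' t t' h

variable (S q) in
/-- The asymmetric signature on the linking-`l`-monoid. -/
noncomputable def LinkMonoid.sig : LinkMonoid (Λ := Λ) S q →+ LAsy0 Λ where
  toFun x := FlipMonoid.sig S q (FlipMonoid.L_surjective x).choose
  map_zero' := by
    rw [← map_zero (FlipMonoid.sig S q)]
    refine FlipMonoid.sig_eq_of_L_eq ?_
    rw [(FlipMonoid.L_surjective _).choose_spec, map_zero]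
  map_add' x y := by
    rw [← map_add]
    refine FlipMonoid.sig_eq_of_L_eq ?_
    rw [map_add, (FlipMonoid.L_surjective _).choose_spec, (FlipMonoid.L_surjective _).choose_spec,
      (FlipMonoid.L_surjective _).choose_spec]

theorem LinkMonoid.sig_L (x : FlipMonoid S q) :
    LinkMonoid.sig S q (FlipMonoid.L S q x) = FlipMonoid.sig S q x :=
  FlipMonoid.sig_eq_of_L_eq (FlipMonoid.L_surjective _).choose_spec

end Signature

end Kreck

namespace Kreck

open StarDual

/-! ### Weak lagrangians and the vanishing of asymmetric signatures -/

section WeakLagrangian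

variable {Λ : Type u} [Ring Λ] [StarRing Λ] {S : Submonoid Λ} [IsCentralMul S] {q : ℕ}
  {z z' : Preform Λ q}

/-- A submodule `U ⊂ G` is a weak lagrangian of a preformation if `γ` is a split injection on `U`,
`γ^*μ` vanishes on `U`, and the annihilator of `γ(U)` is contained in `μ(U)`. -/
structure Preform.IsWeakLagrangian (z : Preform Λ q) (U : Submodule Λ z.G) : Prop where
  form_zero : ∀ u ∈ U, ∀ u' ∈ U, z.mu u (z.gamma u') = 0
  exists_retraction : ∃ r : z.F →ₗ[Λ] z.G, (∀ x, r x ∈ U) ∧ ∀ u ∈ U, r (z.gamma u) = u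
  annihilator : ∀ f : StarDual Λ z.F, (∀ u ∈ U, f (z.gamma u) = 0) → ∃ u ∈ U, z.mu u = f

/-- The retraction is the projection onto the summand `γ(U)` followed by the inverse of `γ` on `U`.
Injectivity of `F^* / U₁ → U₀^*` is the annihilator condition. Freeness of `U` and the splitting of
`μ(U)` are dropped, since the conditions kept are all that the arguments below use. -/
theorem Preform.IsHLagrangian.isWeakLagrangian {U : Submodule Λ z.G} (hU : z.IsHLagrangian U) :
    z.IsWeakLagrangian U where
  form_zero := hU.form_zero
  exists_retraction := by
    obtain ⟨V, hV⟩ := hU.gamma_summand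
    have hbij : Function.Bijective (z.gamma.submoduleMap U) := by
      refine ⟨fun u u' h => Subtype.ext (hU.gamma_inj u.2 u'.2 (congrArg Subtype.val h)), ?_⟩
      rintro ⟨_, u, hu, rfl⟩
      exact ⟨⟨u, hu⟩, rfl⟩
    let e := LinearEquiv.ofBijective _ hbij
    refine ⟨U.subtype ∘ₗ e.symm.toLinearMap ∘ₗ (U.map z.gamma).projectionOnto V hV,
      fun x => Subtype.prop _, fun u hu => ?_⟩
    have h1 : (U.map z.gamma).projectionOnto V hV (z.gamma u) = e ⟨u, hu⟩ :=
      Submodule.projectionOnto_apply_of_mem_left hV ⟨u, hu, rfl⟩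
    rw [LinearMap.comp_apply, LinearMap.comp_apply, h1, LinearEquiv.coe_coe,
      LinearEquiv.symm_apply_apply]
    rfl
  annihilator f hf := by
    obtain ⟨e, he⟩ := hU.restrict_iso
    have h1 : e (Submodule.Quotient.mk f) = 0 := by
      rw [he]
      refine StarDual.ext ?_
      rintro ⟨_, u, hu, rfl⟩
      exact hf u hu
    exact (Submodule.Quotient.mk_eq_zero _).1 (e.map_eq_zero_iff.1 h1)

theorem Preform.IsWeakLagrangian.map {U : Submodule Λ z.G} (hU : z.IsWeakLagrangian U)
    (i : StrongIso z z') : z'.IsWeakLagrangian (U.comap i.zeta.symm.toLinearMap) where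
  form_zero u hu u' hu' := by
    have h := hU.form_zero _ hu _ hu'
    rw [← i.zeta.apply_symm_apply u, ← i.zeta.apply_symm_apply u', ← i.mu_comm, ← i.gamma_comm,
      dualEquiv_apply, LinearEquiv.symm_apply_apply]
    exact h
  exists_retraction := by
    obtain ⟨r, hr, hr'⟩ := hU.exists_retraction
    refine ⟨i.zeta.toLinearMap ∘ₗ r ∘ₗ i.eta.symm.toLinearMap, fun x => ?_, fun u hu => ?_⟩
    · rw [Submodule.mem_comap]
      change i.zeta.symm (i.zeta _) ∈ U
      rw [LinearEquiv.symm_apply_apply]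
      exact hr _
    · obtain ⟨u, rfl⟩ := i.zeta.surjective u
      rw [Submodule.mem_comap, LinearEquiv.coe_coe, LinearEquiv.symm_apply_apply] at hu
      rw [← i.gamma_comm]
      change i.zeta (r (i.eta.symm (i.eta _))) = _
      rw [LinearEquiv.symm_apply_apply, hr' u hu]
  annihilator f hf := by
    obtain ⟨f, rfl⟩ := (dualEquiv i.eta).surjective f
    obtain ⟨u, hu, h⟩ := hU.annihilator f fun u hu => by
      have := hf (i.zeta u) (by
        rw [Submodule.mem_comap, LinearEquiv.coe_coe, LinearEquiv.symm_apply_apply]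
        exact hu)
      rwa [← i.gamma_comm, dualEquiv_apply, LinearEquiv.symm_apply_apply] at this
    refine ⟨i.zeta u, ?_, ?_⟩
    · rw [Submodule.mem_comap, LinearEquiv.coe_coe, LinearEquiv.symm_apply_apply]
      exact hu
    · rw [← i.mu_comm, h]

theorem Preform.IsWeakLagrangian.add {U : Submodule Λ z.G} (hU : z.IsWeakLagrangian U)
    {U' : Submodule Λ z'.G} (hU' : z'.IsWeakLagrangian U') :
    (z.add z').IsWeakLagrangian (U.prod U') where
  form_zero u hu u' hu' := by
    change z.mu u.1 (z.gamma u'.1) + z'.mu u.2 (z'.gamma u'.2) = 0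
    rw [hU.form_zero _ hu.1 _ hu'.1, hU'.form_zero _ hu.2 _ hu'.2, add_zero]
  exists_retraction := by
    obtain ⟨r, hr, h⟩ := hU.exists_retraction
    obtain ⟨r', hr', h'⟩ := hU'.exists_retraction
    exact ⟨LinearMap.prodMap r r', fun x => ⟨hr _, hr' _⟩,
      fun u hu => Prod.ext (h _ hu.1) (h' _ hu.2)⟩
  annihilator f hf := by
    obtain ⟨⟨f, f'⟩, rfl⟩ := prodEquiv.surjective f
    obtain ⟨u, hu, h⟩ := hU.annihilator f fun u hu => by
      have := hf (u, 0) ⟨hu, U'.zero_mem⟩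
      change f (z.gamma u) + f' (z'.gamma 0) = 0 at this
      rwa [map_zero, map_zero, add_zero] at this
    obtain ⟨u', hu', h'⟩ := hU'.annihilator f' fun u hu => by
      have := hf (0, u) ⟨U.zero_mem, hu⟩
      change f (z.gamma 0) + f' (z'.gamma u) = 0 at this
      rwa [map_zero, map_zero, zero_add] at this
    exact ⟨(u, u'), ⟨hu, hu'⟩, congrArg prodEquiv (Prod.ext h h')⟩

/-! ### Weak lagrangians of boundaries of hyperbolic forms -/

section Hyp

variable (L : Type u) [AddCommGroup L] [Module Λ L] [Module.Free Λ L] [Module.Finite Λ L]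

/-- Since `φ` sees only the `L^*`-coordinates, `L` is a lagrangian for every `φ`; an element `(x,
f)` pairs with `(x', 0)` to `f(x')`. -/
theorem Preform.isWeakLagrangian_hyp_left (φ : StarDual Λ L →ₗ[Λ] StarDual Λ (StarDual Λ L))
    (hφ : IsSymm (-eps q) φ) :
    (Preform.hyp q L φ hφ).IsWeakLagrangian ((⊤ : Submodule Λ L).prod ⊥) where
  form_zero u hu u' hu' := by
    have h1 : u.2 = 0 := hu.2
    have h2 : u'.2 = 0 := hu'.2
    rw [Preform.hyp_mu_apply, h1]
    change (0 : StarDual Λ L) _ + (-eps q • star (u'.2 u.1) + φ 0 u'.2) = 0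
    rw [h2, map_zero]
    simp
  exists_retraction := by
    refine ⟨LinearMap.prodMap LinearMap.id 0, fun x => ⟨trivial, Submodule.zero_mem _⟩,
      fun u hu => ?_⟩
    have h1 : u.2 = 0 := hu.2
    exact Prod.ext rfl h1.symm
  annihilator f hf := by
    obtain ⟨g, rfl⟩ := (hyp_mu_bijective L φ hφ).2 f
    refine ⟨g, ⟨trivial, StarDual.ext fun x => ?_⟩, rfl⟩
    have h := hf (x, 0) ⟨trivial, Submodule.zero_mem _⟩
    change (Preform.hyp q L φ hφ).mu g (x, 0) = 0 at h
    rw [Preform.hyp_mu_apply] at h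
    simpa using h

/-- This complementary lagrangian uses `φ = 0`. It is the one on which the stabilized
flip-isomorphism of `exists_stable_flip` is controlled. -/
theorem Preform.isWeakLagrangian_hyp_right :
    (Preform.hyp0 q L).IsWeakLagrangian ((⊥ : Submodule Λ L).prod ⊤) where
  form_zero u hu u' hu' := by
    have h1 : u.1 = 0 := hu.1
    have h2 : u'.1 = 0 := hu'.1
    rw [Preform.hyp_mu_apply, h1]
    change u.2 u'.1 + _ = 0
    rw [h2]
    simp
  exists_retraction := by
    refine ⟨LinearMap.prodMap 0 LinearMap.id, fun x => ⟨Submodule.zero_mem _, trivial⟩,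
      fun u hu => ?_⟩
    have h1 : u.1 = 0 := hu.1
    exact Prod.ext h1.symm rfl
  annihilator f hf := by
    obtain ⟨g, rfl⟩ := (hyp_mu_bijective L 0 (isSymm_zero _)).2 f
    refine ⟨g, ⟨?_, trivial⟩, rfl⟩
    refine (Submodule.mem_bot Λ).2 ((eval_bijective (Λ := Λ) (M := L)).1 (StarDual.ext fun p => ?_))
    have h := hf (0, p) ⟨Submodule.zero_mem _, trivial⟩
    change (Preform.hyp q L 0 _).mu g (0, p) = 0 at h
    rw [Preform.hyp_mu_apply] at h
    have h' : -eps q • star (p g.1) = 0 := by simpa using h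
    rw [smul_eq_zero_iff_eq] at h'
    rw [eval_apply, h', map_zero]
    rfl

end Hyp

/-- The dual complement of a weak lagrangian. -/
theorem Preform.IsWeakLagrangian.exists_section {U : Submodule Λ z.G} (hU : z.IsWeakLagrangian U)
    (hμ : Function.Injective z.mu) {r : z.F →ₗ[Λ] z.G} (hr : ∀ x, r x ∈ U)
    (hr' : ∀ u ∈ U, r (z.gamma u) = u) : ∃ s : StarDual Λ z.F →ₗ[Λ] z.G, (∀ f, s f ∈ U) ∧
      (∀ f, z.mu (s f) = f - dualMap (z.gamma ∘ₗ r) f) ∧ ∀ u ∈ U, s (z.mu u) = u := by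
  -- The functional `f - f ∘ γ ∘ r` annihilates `γ(U)` and hence lies in `μ(U)`; projectivity of
  -- `F^*` makes the choice of a preimage linear.
  obtain ⟨κ, hκ⟩ := exists_factor (z.mu ∘ₗ U.subtype)
    (LinearMap.id - dualMap (z.gamma ∘ₗ r)) fun f => by
    obtain ⟨u, hu, h⟩ := hU.annihilator (f - dualMap (z.gamma ∘ₗ r) f) fun u hu => by
      rw [StarDual.sub_apply, dualMap_apply, LinearMap.comp_apply, hr' u hu, sub_self]
    exact ⟨⟨u, hu⟩, h⟩
  refine ⟨U.subtype ∘ₗ κ, fun f => (κ f).2, fun f => (hκ f).symm, fun u hu => hμ ?_⟩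
  refine (hκ (z.mu u)).symm.trans ?_
  change z.mu u - dualMap (z.gamma ∘ₗ r) (z.mu u) = z.mu u
  rw [sub_eq_self]
  exact StarDual.ext fun x => hU.form_zero u hu _ (hr x)

/-- A flip-isomorphism that restricts to the identity of a weak lagrangian has a metabolic
asymmetric form. -/
theorem Flip.metabolic (t : Flip z) {U : Submodule Λ z.G} (hU : z.IsWeakLagrangian U)
    (ht : ∀ u ∈ U, t.beta u = u) : t.asymForm.Metabolic := by
  obtain ⟨r, hr, hr'⟩ := hU.exists_retraction
  -- `p` is the projection onto `γ(U)`, and `1 - p^*` is the projection onto the annihilator of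
  -- `γ(U)`, which is `μ(U)`. By `hsep` and `hμ`, `γ(U)` is in turn the common kernel of the
  -- functionals in `μ(U)`.
  let p : z.F →ₗ[Λ] z.F := z.gamma ∘ₗ r
  have hp : ∀ u ∈ U, p (z.gamma u) = z.gamma u := fun u hu => congrArg z.gamma (hr' u hu)
  have hpp : ∀ x, p (p x) = p x := fun x => hp _ (hr x)
  have hco : ∀ u ∈ U, t.co (z.mu u) = z.gamma u := fun u hu => by rw [t.co_mu, ht u hu]
  have hsep : ∀ x, (∀ u ∈ U, z.mu u x = 0) → p x = x := fun x hx =>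
    dual_separates (Λ := Λ) fun f => by
      obtain ⟨u, hu, h⟩ := hU.annihilator (f - dualMap p f) fun u hu => by
        rw [StarDual.sub_apply, dualMap_apply, hp u hu, sub_self]
      have := hx u hu
      rw [h, StarDual.sub_apply, sub_eq_zero] at this
      exact this.symm
  have hμ : ∀ x, p x = x → ∀ u ∈ U, z.mu u x = 0 := fun x hx u hu => by
    rw [← hx]
    exact hU.form_zero u hu _ (hr x)
  -- As `β` is the identity on `U`, each element of `γ(U)` has the form `α^{-*}μ(u)`, so `α(x)`
  -- evaluates on it as the conjugate of `μ(u)(x)`, which is zero for `x ∈ γ(U)`.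
  have hα : ∀ x y, p x = x → p y = y → t.alpha x y = 0 := fun x y hx hy => by
    have h : y = t.co (z.mu (r y)) := by rw [hco _ (hr y)]; exact hy.symm
    rw [h, t.alpha_co, hμ x hx _ (hr y), star_zero]
  -- For `x = γ(u)` one has `α^* x = μ(u)`, and the first flip condition writes `ασμ(u)` as `εμ(u) -
  -- αγ(u)`; both terms vanish on `γ(U)`.
  have hσ : ∀ x y, p x = x → p y = y →
      t.alpha (t.sigma (adj t.alpha.toLinearMap x)) y = 0 := fun x y hx hy => by
    have h : x = t.co (z.mu (r x)) := by rw [hco _ (hr x)]; exact hx.symm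
    rw [h, t.adj_co]
    have h1 := congrArg (fun f => f y) (t.cond_gamma (r x))
    change t.alpha (p x) y + t.alpha (t.sigma (z.mu (r x))) y = (eps q • z.mu _) y at h1
    rwa [hx, hα x y hx hy, zero_add, ht _ (hr x), units_smul_apply, hμ y hy _ (hr x),
      smul_zero] at h1
  -- The range of this idempotent is the lagrangian `γ(U) ⊕ μ(U) ⊕ γ(U)`.
  let f : (z.F × StarDual Λ z.F × z.F) →ₗ[Λ] z.F × StarDual Λ z.F × z.F :=
    LinearMap.prodMap p (LinearMap.prodMap (LinearMap.id - dualMap p) p)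
  have hf : IsIdempotentElem f := LinearMap.ext fun x => by
    refine Prod.ext (hpp _) (Prod.ext ?_ (hpp _))
    refine StarDual.ext fun y => ?_
    change x.2.1 y - x.2.1 (p y) - (x.2.1 (p y) - x.2.1 (p (p y))) = x.2.1 y - x.2.1 (p y)
    rw [hpp, sub_self, sub_zero]
  have hmem : ∀ x, x ∈ LinearMap.range f ↔ p x.1 = x.1 ∧ (∀ y, x.2.1 (p y) = 0) ∧
      p x.2.2 = x.2.2 := fun x => by
    rw [LinearMap.IsIdempotentElem.mem_range_iff hf]
    change (p x.1, x.2.1 - dualMap p x.2.1, p x.2.2) = (x.1, x.2.1, x.2.2) ↔ _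
    rw [Prod.mk_inj, Prod.mk_inj, sub_eq_self]
    refine and_congr_right fun _ => and_congr_left fun _ => ?_
    exact ⟨fun h y => congrArg (fun f => f y) h, fun h => StarDual.ext h⟩
  refine ⟨LinearMap.range f, ⟨_, LinearMap.IsIdempotentElem.isCompl hf⟩, fun x => ?_⟩
  rw [hmem]
  constructor
  · rintro ⟨h1, h2, h3⟩ y hy
    obtain ⟨k1, k2, k3⟩ := (hmem y).1 hy
    have e1 : p (x.1 - eps q • x.2.2) = x.1 - eps q • x.2.2 := by
      rw [map_sub, map_units_smul, h1, h3]
    change t.rho x y = 0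
    rw [t.rho_apply, hα _ _ h3 k1, hσ _ _ h3 k3, ← e1, k2, ← k3, h2]
    simp
  · intro h
    -- Testing against the three summands in turn gives one coordinate each: the first gives `x.2.2
    -- ∈ γ(U)`, the second gives `x.1 - εx.2.2 ∈ γ(U)`, and the third shows that `x.2.1` annihilates
    -- `γ(U)`.
    have h3 : p x.2.2 = x.2.2 := hsep _ fun u hu => by
      have := h (z.gamma u, 0, 0) ((hmem _).2 ⟨hp u hu, fun _ => rfl, map_zero p⟩)
      change t.rho x _ = 0 at this
      rw [t.rho_apply, ← hco u hu, t.alpha_co] at this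
      simpa using this
    have h1 : p x.1 = x.1 := by
      have e : p (x.1 - eps q • x.2.2) = x.1 - eps q • x.2.2 := hsep _ fun u hu => by
        have := h (0, z.mu u, 0) ((hmem _).2
          ⟨map_zero p, fun y => hU.form_zero u hu _ (hr y), map_zero p⟩)
        change t.rho x _ = 0 at this
        rw [t.rho_apply] at this
        exact star_eq_zero.1 (by simpa using this)
      rwa [map_sub, map_units_smul, h3, sub_left_inj] at e
    refine ⟨h1, fun y => ?_, h3⟩
    have := h (0, 0, p y) ((hmem _).2 ⟨map_zero p, fun _ => rfl, hpp y⟩)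
    change t.rho x _ = 0 at this
    rw [t.rho_apply, hσ _ _ h3 (hpp y)] at this
    simpa using this

/-- The value on `(z, l)` may be computed from any stable flip-isomorphism inducing `l`. The lifts
of `l` and of its inverse can be chosen so that they interchange `μ(u)` and `γ(u)` for `u ∈ U`, and
the resulting flip-isomorphism is the identity on a weak lagrangian. -/
theorem Preform.IsWeakLagrangian.sig_eq_zero {U : Submodule Λ z.G} (hU : z.IsWeakLagrangian U)
    (hz : z.IsS S) (l : (z.linkMu hz).Isometry (z.linkGamma hz)) :
    LinkMonoid.sig S q (LinkMonoid.mk z hz l) = 0 := by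
  obtain ⟨r, hr, hr'⟩ := hU.exists_retraction
  obtain ⟨s, hs, hμs, hs'⟩ := hU.exists_section hz.mu.injective hr hr'
  obtain ⟨a, ha⟩ := exists_quotient_lift l.toLinearEquiv.toLinearMap
  obtain ⟨a', ha'⟩ := exists_quotient_lift l.toLinearEquiv.symm.toLinearMap
  -- Replacing `x` by `x - μ(s x)` does not change its class in `coker μ`, and adding `γ(s x)` does
  -- not change the class in `coker γ`. So `c` still lifts `l`, while on `μ(U)`, where `μs` is the
  -- identity, it is `μ(u) ↦ γ(u)`.
  let c : StarDual Λ z.F →ₗ[Λ] z.F := a ∘ₗ (LinearMap.id - z.mu ∘ₗ s) + z.gamma ∘ₗ s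
  let c' : z.F →ₗ[Λ] StarDual Λ z.F := a' ∘ₗ (LinearMap.id - z.gamma ∘ₗ r) + z.mu ∘ₗ r
  obtain ⟨t, ht, hco⟩ := exists_stable_flip hz l c c' (fun x => by
      change _ = Submodule.Quotient.mk (a (x - z.mu (s x)) + z.gamma (s x))
      have h1 : (Submodule.Quotient.mk x : z.cokerMu) = Submodule.Quotient.mk (x - z.mu (s x)) :=
        (Submodule.Quotient.eq _).2 ⟨s x, by abel⟩
      rw [h1]
      exact (ha _).trans ((Submodule.Quotient.eq _).2 ⟨-s x, by rw [map_neg]; abel⟩))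
    (fun x => by
      change _ = Submodule.Quotient.mk (a' (x - z.gamma (r x)) + z.mu (r x))
      have h1 : (Submodule.Quotient.mk x : z.cokerGamma) =
          Submodule.Quotient.mk (x - z.gamma (r x)) := (Submodule.Quotient.eq _).2 ⟨r x, by abel⟩
      rw [h1]
      exact (ha' _).trans ((Submodule.Quotient.eq _).2 ⟨-r x, by rw [map_neg]; abel⟩))
  have hy : (Preform.hyp0 (Λ := Λ) q z.G).IsS S := Preform.IsS.hyp _ _ _
  have e1 : ∀ u ∈ U, c (z.mu u) = z.gamma u :=
    fun u hu => by
      change a (z.mu u - z.mu (s (z.mu u))) + z.gamma (s (z.mu u)) = _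
      rw [hs' u hu, sub_self, map_zero, zero_add]
  have e2 : ∀ u ∈ U, c' (z.gamma u) = z.mu u :=
    fun u hu => by
      change a' (z.gamma u - z.gamma (r (z.gamma u))) + z.mu (r (z.gamma u)) = _
      rw [hr' u hu, sub_self, map_zero, zero_add]
  rw [← LinkMonoid.mk_eq_L hz l (hz.add hy) t ht, LinkMonoid.sig_L]
  refine StableSystem.cls_stab _
    (t.metabolic (hU.add (Preform.isWeakLagrangian_hyp_right z.G)) fun w hw => ?_)
  -- Because `γβ = α^{-*}μ`, the claim `β w = w` becomes `α^{-*}μ(w) = γ(w)`. On `U` it holds by the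
  -- choice of lifts, and on `0 ⊕ G^*` because the stable flip-isomorphism carries `G^*`
  -- identically.
  refine (hz.add hy).gamma.injective ?_
  obtain ⟨u, x, f⟩ := w
  obtain ⟨hu, hx, -⟩ := hw
  obtain rfl : x = 0 := hx
  rw [← t.co_mu]
  have e3 : (z.add (Preform.hyp0 q z.G)).mu (u, 0, f) = prodEquiv (z.mu u, prodEquiv (f, 0)) := by
    refine StarDual.ext fun y => ?_
    change z.mu u y.1 + (Preform.hyp q z.G 0 _).mu (0, f) y.2 = z.mu u y.1 + (f y.2.1 + 0)
    rw [Preform.hyp_mu_apply]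
    simp
  rw [e3, hco _ _ (by rw [e1 u hu, e2 u hu]), e1 u hu]
  rfl

end WeakLagrangian

end Kreck

namespace Kreck

open StarDual

/-! ### Isometries defined by weak lagrangians -/

section Existence

variable {Λ : Type u} [Ring Λ] [StarRing Λ] {S : Submonoid Λ} [IsCentralMul S] {q : ℕ}
  {z : Preform Λ q}

/-- A weak lagrangian defines a flip-isomorphism. -/
theorem Preform.IsWeakLagrangian.exists_flip {U : Submodule Λ z.G} (hU : z.IsWeakLagrangian U)
    (hγ : Function.Injective z.gamma) (hμ : Function.Injective z.mu) {r : z.F →ₗ[Λ] z.G}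
    (hr : ∀ x, r x ∈ U) (hr' : ∀ u ∈ U, r (z.gamma u) = u) {s : StarDual Λ z.F →ₗ[Λ] z.G}
    (hs : ∀ f, s f ∈ U) (hμs : ∀ f, z.mu (s f) = f - dualMap (z.gamma ∘ₗ r) f)
    (hs' : ∀ u ∈ U, s (z.mu u) = u) :
    ∃ t : Flip z, ∀ g, t.beta g = r (z.gamma g) + s (z.mu g) - g := by
  -- In the decompositions `F = γ(U) ⊕ ker P` and `F^* = μ(U) ⊕ im P^*`, the map `γs` is the
  -- isomorphism `μ(u) ↦ γ(u)` extended by zero, and `W = (γs)^*` maps `im P^*` isomorphically to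
  -- `ker P`. In the opposite direction `μr` and `W' = (μr)^*` are their inverses; `c1` to `c6`
  -- record these relations.
  let P : z.F →ₗ[Λ] z.F := z.gamma ∘ₗ r
  let W : StarDual Λ z.F →ₗ[Λ] z.F :=
    (evalEquiv z.F).symm.toLinearMap ∘ₗ dualMap (z.gamma ∘ₗ s)
  let W' : z.F →ₗ[Λ] StarDual Λ z.F := adj (z.mu ∘ₗ r)
  have hW : ∀ p f : StarDual Λ z.F, p (W f) = star (f (z.gamma (s p))) := fun p f => by
    have h : eval (W f) = dualMap (z.gamma ∘ₗ s) f :=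
      LinearEquiv.apply_symm_apply (evalEquiv z.F) _
    rw [← star_star (p _), ← eval_apply, h]
    rfl
  have hW' : ∀ x y, W' x y = star (z.mu (r y) x) := fun _ _ => rfl
  have hsP : ∀ f, s (dualMap P f) = 0 := fun f => hμ (by
    rw [hμs, map_zero]
    refine StarDual.ext fun x => ?_
    change f (P x) - f (P (z.gamma (r x))) = 0
    rw [show P (z.gamma (r x)) = P x from congrArg z.gamma (hr' _ (hr x)), sub_self])
  have c1 : ∀ f, r (W f) = 0 := fun f => hγ (dual_separates (Λ := Λ) fun p => by
    rw [map_zero, map_zero]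
    change dualMap P p (W f) = 0
    rw [hW, hsP, map_zero, map_zero, star_zero])
  have c2 : ∀ f, W' (z.gamma (s f)) = 0 := fun f => StarDual.ext fun y => by
    rw [hW', hU.form_zero _ (hr y) _ (hs f), star_zero]
    rfl
  have c3 : ∀ f, W' (W f) = dualMap P f := fun f => StarDual.ext fun y => by
    rw [hW', hW, star_star, hs' _ (hr y)]
    rfl
  have c4 : ∀ x, s (W' x) = 0 := fun x => hμ (by
    rw [hμs, map_zero, sub_eq_zero]
    refine StarDual.ext fun y => ?_
    rw [dualMap_apply, hW', hW', LinearMap.comp_apply, hr' _ (hr y)])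
  have c5 : ∀ x, W (z.mu (r x)) = 0 := fun x => dual_separates (Λ := Λ) fun p => by
    rw [hW, hU.form_zero _ (hr x) _ (hs p), star_zero, map_zero]
  have c6 : ∀ x, W (W' x) = x - P x := fun x => dual_separates (Λ := Λ) fun p => by
    rw [hW, hW', star_star, hr' _ (hs p), hμs, map_sub]
    rfl
  -- The sum of the two blocks is invertible, and the factor `ε` makes it `ε`-symmetric, which is
  -- what allows `σ = 0`.
  let A₀ : StarDual Λ z.F →ₗ[Λ] z.F := z.gamma ∘ₗ s + eps q • W
  let B₀ : z.F →ₗ[Λ] StarDual Λ z.F := z.mu ∘ₗ r + eps q • W'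
  let A : StarDual Λ z.F ≃ₗ[Λ] z.F := LinearEquiv.ofLinearMap A₀ B₀
    (LinearMap.ext fun x => by
      change z.gamma (s (z.mu (r x) + eps q • W' x)) +
        eps q • W (z.mu (r x) + eps q • W' x) = x
      simp only [map_add, map_units_smul, c4, c5, c6, hs' _ (hr x), smul_zero, add_zero, zero_add,
        units_smul_smul_self]
      exact add_sub_cancel _ _)
    (LinearMap.ext fun f => by
      change z.mu (r (z.gamma (s f) + eps q • W f)) +
        eps q • W' (z.gamma (s f) + eps q • W f) = f
      simp only [map_add, map_units_smul, c1, c2, c3, hr' _ (hs f), smul_zero, add_zero, zero_add,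
        units_smul_smul_self, hμs]
      exact sub_add_cancel _ _)
  have hA : ∀ f, A f = z.gamma (s f) + eps q • W f := fun _ => rfl
  have hAs : ∀ f p : StarDual Λ z.F, f (A p) = eps q • star (p (A f)) := fun f p => by
    rw [hA, hA, map_add, map_add, dual_units_smul, dual_units_smul, hW, hW, star_add,
      star_units_smul, star_star, smul_add, units_smul_smul_self, add_comm]
  -- The formula is forced by `Aμ = γβ`: by symmetry of `γ^*μ` the summand `εWμ` equals `γrγ - γ`.
  -- Since `rγ` and `sμ` are both the identity on `U`, the map is an involution.
  let β₀ : z.G →ₗ[Λ] z.G := r ∘ₗ z.gamma + s ∘ₗ z.mu - LinearMap.id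
  have hβ₀ : ∀ g, β₀ g = r (z.gamma g) + s (z.mu g) - g := fun _ => rfl
  have hββ : ∀ g, β₀ (β₀ g) = g := fun g => by
    rw [hβ₀, hβ₀]
    simp only [map_add, map_sub, hr' _ (hr _), hr' _ (hs _), hs' _ (hr _), hs' _ (hs _)]
    abel
  let β : z.G ≃ₗ[Λ] z.G := LinearEquiv.ofLinearMap β₀ β₀ (LinearMap.ext hββ) (LinearMap.ext hββ)
  have hβ : ∀ g, A (z.mu g) = z.gamma (β g) := fun g => dual_separates (Λ := Λ) fun p => by
    change _ = p (z.gamma (r (z.gamma g) + s (z.mu g) - g))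
    have e1 : p (z.gamma g) - p (z.gamma (r (z.gamma g))) = z.mu (s p) (z.gamma g) := by
      rw [hμs]; rfl
    rw [hA, map_add, dual_units_smul, hW, z.mu_gamma, star_units_smul, star_star, ← e1]
    simp only [map_add, map_sub, Units.neg_smul, smul_neg, units_smul_smul_self]
    abel
  have hco : (adjEquiv (adjEquiv A.symm)).symm = A := by
    rw [adjEquiv_adjEquiv_symm, LinearEquiv.symm_symm]
  refine ⟨⟨adjEquiv A.symm, β, 0, isSymm_iff.2 fun f g => ?_, fun g => ?_, fun g => ?_⟩, hβ₀⟩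
  · simp
  · obtain ⟨g, rfl⟩ := β.surjective g
    refine StarDual.ext fun x => ?_
    obtain ⟨p, rfl⟩ := A.surjective x
    -- With `σ = 0` and `β` an involution, the first flip condition is the second one rewritten by
    -- the `ε`-symmetry of `A`.
    rw [LinearMap.zero_apply, map_zero, add_zero, adjEquiv_apply, LinearEquiv.symm_apply_apply,
      show β (β g) = g from hββ g, units_smul_apply, hAs, units_smul_smul_self, hβ]
  · rw [hco, hβ]

/-! ### The quadratic refinement under the flip of a weak lagrangian -/

theorem value_add_value {e : ℤˣ} {G : Type*} [AddCommGroup G] [Module Λ G] (θ : QForm Λ e G)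
    (g : G) : θ.value g + θ.value g = QuotientAddGroup.mk (θ.symmetrize g g) := by
  induction θ using QuotientAddGroup.induction_on with | H φ =>
  change (QForm.mk e φ).value g + (QForm.mk e φ).value g =
    QuotientAddGroup.mk ((QForm.mk e φ).symmetrize g g)
  rw [QForm.value_mk, QForm.symmetrize_mk, ← QuotientAddGroup.mk_add, QuotientAddGroup.eq]
  refine ⟨-(φ g g), ?_⟩
  rw [star_neg, smul_neg]
  abel

theorem value_neg_right {e : ℤˣ} {G : Type*} [AddCommGroup G] [Module Λ G] (θ : QForm Λ e G)
    (g : G) : θ.value (-g) = θ.value g := by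
  induction θ using QuotientAddGroup.induction_on with | H φ =>
  change (QForm.mk e φ).value (-g) = (QForm.mk e φ).value g
  rw [QForm.value_mk, QForm.value_mk, map_neg, map_neg, StarDual.neg_apply, neg_neg]

/-- Split `g = k + u` with `u = rγ(g) ∈ U` and `rγ(k) = 0`. Then `β(g) = sμ(g) - k`, and `θ`
vanishes on the two parts in `U`, so that twice `θ(k)` and cross terms remain. The cross terms
cancel `θ(k) + θ(k)` modulo `{b + ε * star b}`. -/
theorem value_beta_add_value {z : SplitPreform Λ q} {U : Submodule Λ z.G}
    (hU : z.toPreform.IsWeakLagrangian U) (hθ : ∀ u ∈ U, z.theta.value u = 0)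
    {r : z.F →ₗ[Λ] z.G}
    (hr : ∀ x, r x ∈ U) (hr' : ∀ u ∈ U, r (z.gamma u) = u) {s : StarDual Λ z.F →ₗ[Λ] z.G}
    (hs : ∀ f, s f ∈ U) (hμs : ∀ f, z.mu (s f) = f - dualMap (z.gamma ∘ₗ r) f) (g : z.G) :
    z.theta.value (r (z.gamma g) + s (z.mu g) - g) + z.theta.value g = 0 := by
  have hsym : ∀ g h, QForm.symmetrize z.theta g h = z.mu g (z.gamma h) := z.theta_gamma_mu
  obtain ⟨k, hk⟩ : ∃ k, g = k + r (z.gamma g) := ⟨g - r (z.gamma g), by abel⟩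
  have hrk : r (z.gamma k) = 0 := by
    have h := congrArg (fun x => r (z.gamma x)) hk
    simp only [map_add, hr' _ (hr _)] at h
    exact right_eq_add.1 h
  set u := r (z.gamma g) with hu
  have e1 : u + s (z.mu g) - g = s (z.mu g) + -k := by rw [hk]; abel
  have e2 : z.mu (s (z.mu g)) (z.gamma k) = z.mu g (z.gamma k) := by
    rw [hμs, StarDual.sub_apply, dualMap_apply, LinearMap.comp_apply, hrk, map_zero, map_zero,
      sub_zero]
  have e3 : z.theta.value g = z.theta.value k + z.theta.value u +
      QuotientAddGroup.mk (z.theta.symmetrize k u) := by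
    rw [← value_add_right, ← hk]
  have e4 : z.mu u (z.gamma u) = 0 := hU.form_zero _ (hr _) _ (hr _)
  rw [e1, e3, value_add_right, hθ _ (hs _), hθ _ (hr _), value_neg_right, zero_add, add_zero,
    add_add_add_comm, value_add_value, ← QuotientAddGroup.mk_add, ← QuotientAddGroup.mk_add,
    QuotientAddGroup.eq_zero_iff]
  -- The sum of the remaining terms is `μ(k)(γ u) - μ(u)(γ k)`, where `μ(u)(γ k) = -ε * star (μ(k)(γ
  -- u))` and `μ(k)(γ u) = μ(g)(γ u)` by isotropy of `U`.
  refine ⟨z.mu g (z.gamma u), ?_⟩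
  rw [hsym, hsym, hsym, ← z.mu_gamma, map_neg, map_neg, e2]
  have e5 : z.gamma g = z.gamma k + z.gamma u := by rw [← map_add, ← hk]
  have e6 : z.mu g = z.mu k + z.mu u := by rw [← map_add, ← hk]
  rw [e5, e6]
  simp only [StarDual.add_apply, map_add, e4]
  abel

theorem Preform.IsWeakLagrangian.nonempty_isometry {U : Submodule Λ z.G}
    (hU : z.IsWeakLagrangian U) (hz : z.IsS S) :
    Nonempty ((z.linkMu hz).Isometry (z.linkGamma hz)) := by
  obtain ⟨r, hr, hr'⟩ := hU.exists_retraction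
  obtain ⟨s, hs, hμs, hs'⟩ := hU.exists_section hz.mu.injective hr hr'
  obtain ⟨t, -⟩ := hU.exists_flip hz.gamma.injective hz.mu.injective hr hr' hs hμs hs'
  exact ⟨t.isometry hz⟩

/-- The quadratic part of a linking form depends only on the values of `θ`, so the identity `θ(β g)
= -θ(g)` in `Q_{-ε}(Λ)` suffices; no refinement `ν` of the flip-isomorphism has to be found. -/
theorem SplitPreform.nonempty_isometry {z : SplitPreform Λ q} {U : Submodule Λ z.G}
    (hU : z.toPreform.IsWeakLagrangian U) (hθ : ∀ u ∈ U, z.theta.value u = 0) (hz : z.IsS S) :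
    Nonempty ((z.linkMu hz).Isometry (z.linkGamma hz)) := by
  obtain ⟨r, hr, hr'⟩ := hU.exists_retraction
  obtain ⟨s, hs, hμs, hs'⟩ := hU.exists_section hz.mu.injective hr hr'
  obtain ⟨t, ht⟩ := hU.exists_flip hz.gamma.injective hz.mu.injective hr hr' hs hμs hs'
  refine ⟨⟨t.isometry hz, fun y => ?_⟩⟩
  obtain ⟨y, rfl⟩ := Submodule.Quotient.mk_surjective _ y
  change (z.linkGamma hz).quad (Submodule.Quotient.mk ((adjEquiv t.alpha).symm y)) = _
  rw [z.linkMu_mk, z.linkGamma_mk]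
  obtain ⟨d, g, h⟩ := hz.mu.exists_denom y
  rw [preQuad_eq hz.mu h, preQuad_eq hz.gamma (t.denom h)]
  have h1 := value_beta_add_value hU hθ hr hr' hs hμs g
  rw [← ht] at h1
  rw [QForm.value_neg, neg_eq_of_add_eq_zero_right h1]

end Existence

/-! ### Cancellation of summands with vanishing cokernels -/

section Cancel

variable {Λ : Type u} [Ring Λ] [StarRing Λ] {S : Submonoid Λ} [IsCentralMul S] {q : ℕ}

theorem exists_cancel_equiv {z w : Preform Λ q} [Subsingleton w.cokerMu]
    [Subsingleton w.cokerGamma] (m : (z.add w).cokerMu ≃ₗ[Λ] (z.add w).cokerGamma) :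
    ∃ l : z.cokerMu ≃ₗ[Λ] z.cokerGamma, ∀ x y,
      m (Submodule.Quotient.mk (prodEquiv x)) = Submodule.Quotient.mk y →
        l (Submodule.Quotient.mk x.1) = Submodule.Quotient.mk y.1 := by
  let c : (z.add w).cokerMu ≃ₗ[Λ] z.cokerMu × w.cokerMu :=
    cokerProd (d := z.mu) (d' := w.mu) prodEquiv fun _ => rfl
  let c' : (z.add w).cokerGamma ≃ₗ[Λ] z.cokerGamma × w.cokerGamma :=
    cokerProd (d := z.gamma) (d' := w.gamma) (LinearEquiv.refl Λ _) fun _ => rfl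
  have hc : ∀ x, c (Submodule.Quotient.mk (prodEquiv x)) =
      (Submodule.Quotient.mk x.1, Submodule.Quotient.mk x.2) := cokerProd_mk _ _
  have hc' : ∀ y, c' (Submodule.Quotient.mk y) =
      (Submodule.Quotient.mk y.1, Submodule.Quotient.mk y.2) := cokerProd_mk _ _
  let _ : Unique w.cokerMu := Unique.mk' _
  let _ : Unique w.cokerGamma := Unique.mk' _
  refine ⟨(c.trans LinearEquiv.prodUnique).symm.trans
    (m.trans (c'.trans LinearEquiv.prodUnique)), fun x y h => ?_⟩
  have h1 : (c.trans LinearEquiv.prodUnique).symm (Submodule.Quotient.mk x.1) =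
      Submodule.Quotient.mk (prodEquiv x) := by
    rw [LinearEquiv.symm_apply_eq, LinearEquiv.trans_apply, hc]
    rfl
  rw [LinearEquiv.trans_apply, h1, LinearEquiv.trans_apply, h, LinearEquiv.trans_apply, hc']
  rfl

/-- The linking forms of the sum split orthogonally, and the contribution of `w` is zero because its
cokernels are. -/
theorem exists_cancel_isometry {z w : Preform Λ q} (hz : z.IsS S) (hw : w.IsS S)
    [Subsingleton w.cokerMu] [Subsingleton w.cokerGamma]
    (m : ((z.add w).linkMu (hz.add hw)).Isometry ((z.add w).linkGamma (hz.add hw))) :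
    ∃ l : (z.linkMu hz).Isometry (z.linkGamma hz), ∀ x y,
      m.toLinearEquiv (Submodule.Quotient.mk (prodEquiv x)) = Submodule.Quotient.mk y →
        l.toLinearEquiv (Submodule.Quotient.mk x.1) = Submodule.Quotient.mk y.1 := by
  obtain ⟨l, hl⟩ := exists_cancel_equiv m.toLinearEquiv
  refine ⟨⟨l, fun x y => ?_⟩, hl⟩
  obtain ⟨x, rfl⟩ := Submodule.Quotient.mk_surjective _ x
  obtain ⟨y, rfl⟩ := Submodule.Quotient.mk_surjective _ y
  obtain ⟨x', hx⟩ := Submodule.Quotient.mk_surjective _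
    (m.toLinearEquiv (Submodule.Quotient.mk (prodEquiv (x, 0))))
  obtain ⟨y', hy⟩ := Submodule.Quotient.mk_surjective _
    (m.toLinearEquiv (Submodule.Quotient.mk (prodEquiv (y, 0))))
  have h := m.map_form (Submodule.Quotient.mk (prodEquiv (x, 0)))
    (Submodule.Quotient.mk (prodEquiv (y, 0)))
  rw [← hx, ← hy, Preform.linkMu_mk, Preform.linkGamma_mk, pair_prod_mu hz hw,
    pair_prod_gamma hz hw, map_add, map_add, ← z.linkMu_mk hz, ← w.linkMu_mk hw,
    ← z.linkGamma_mk hz, ← w.linkGamma_mk hw] at h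
  have h1 := hl (x, 0) x' hx.symm
  have h2 := hl (y, 0) y' hy.symm
  have e1 : (Submodule.Quotient.mk y'.2 : w.cokerGamma) = 0 := Subsingleton.elim _ _
  have e2 : (Submodule.Quotient.mk (0 : StarDual Λ w.F) : w.cokerMu) = 0 := Subsingleton.elim _ _
  rw [e1, e2, map_zero, map_zero, add_zero, add_zero] at h
  exact (congrArg₂ (fun a b => (z.linkGamma hz).form a b) h1 h2).trans h

theorem SplitLinkingForm.quad_zero {e : ℤˣ} {M : Type u} [AddCommGroup M] [Module Λ M]
    (A : SplitLinkingForm S e M) : A.quad 0 = 0 := by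
  have h := A.quad_add 0 0
  rw [map_zero, map_zero, add_zero, sub_self, zero_sub, neg_eq_zero] at h
  exact h

theorem nonempty_cancel_splitIsometry {z w : SplitPreform Λ q} (hz : z.IsS S) (hw : w.IsS S)
    [Subsingleton w.cokerMu] [Subsingleton w.cokerGamma]
    (m : ((z.add w).linkMu (hz.add hw)).Isometry ((z.add w).linkGamma (hz.add hw))) :
    Nonempty ((z.linkMu hz).Isometry (z.linkGamma hz)) := by
  obtain ⟨l, hl⟩ := exists_cancel_isometry hz hw m.toIsometry
  refine ⟨⟨l, fun x => ?_⟩⟩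
  obtain ⟨x, rfl⟩ := Submodule.Quotient.mk_surjective _ x
  obtain ⟨y, hy⟩ := Submodule.Quotient.mk_surjective _
    (m.toLinearEquiv (Submodule.Quotient.mk (prodEquiv (x, 0))))
  have h := m.map_quad (Submodule.Quotient.mk (prodEquiv (x, 0)))
  rw [← hy, SplitPreform.linkMu_mk, SplitPreform.linkGamma_mk] at h
  have h2 := preQuad_prod (ε := -eps q) (LinearEquiv.refl Λ (z.F × w.F)) (fun _ => rfl) hz.gamma
    hw.gamma (hz.add hw).gamma (-z.theta) (-w.theta) y
  have h3 := preQuad_prod (ε := -eps q) (prodEquiv (M := z.F) (N := w.F)) (fun _ => rfl) hz.mu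
    hw.mu (hz.add hw).mu z.theta w.theta (x, 0)
  have h4 : -(z.theta.sum w.theta) = (-z.theta).sum (-w.theta) := by
    rw [QForm.sum, QForm.sum, map_neg, map_neg, neg_add]
  have h5 := ((congrArg (fun t => preQuad (hz.add hw).gamma t y) h4).trans h2).symm.trans
    (h.trans h3)
  rw [← z.linkMu_mk hz, ← w.linkMu_mk hw, ← z.linkGamma_mk hz, ← w.linkGamma_mk hw] at h5
  have e1 : (Submodule.Quotient.mk y.2 : w.cokerGamma) = 0 := Subsingleton.elim _ _
  have e2 : (Submodule.Quotient.mk (0 : StarDual Λ w.F) : w.cokerMu) = 0 := Subsingleton.elim _ _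
  rw [e1, e2, SplitLinkingForm.quad_zero, SplitLinkingForm.quad_zero, add_zero, add_zero] at h5
  exact (congrArg (z.linkGamma hz).quad (hl (x, 0) y hy.symm)).trans h5

end Cancel

/-! ### Elementary classes -/

section Elementary

variable {Λ : Type u} [Ring Λ] [StarRing Λ] {S : Submonoid Λ} [IsCentralMul S] {q : ℕ}

theorem hyp_cokerMu_subsingleton (L : Type u) [AddCommGroup L] [Module Λ L] [Module.Free Λ L]
    [Module.Finite Λ L] (φ : StarDual Λ L →ₗ[Λ] StarDual Λ (StarDual Λ L))
    (hφ : IsSymm (-eps q) φ) : Subsingleton (Preform.hyp q L φ hφ).cokerMu :=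
  ⟨fun x y => by
    obtain ⟨x, rfl⟩ := Submodule.Quotient.mk_surjective _ x
    obtain ⟨y, rfl⟩ := Submodule.Quotient.mk_surjective _ y
    exact (Submodule.Quotient.eq _).2 ((hyp_mu_bijective L φ hφ).2 (x - y))⟩

/-- An elementary representative `z₀` satisfies `z₀ ⊕ x ≅ z ⊕ x'` with `x` and `x'` boundaries of
hyperbolic forms. The lagrangian of `z₀` plus the lagrangian `L` of `x` is carried to the other
side. -/
theorem LMonoid.Elementary.exists_isWeakLagrangian {z : Preform Λ q}
    (h : LMonoid.Elementary z.cls) :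
    ∃ (L : Type u) (_ : AddCommGroup L) (_ : Module Λ L) (_ : Module.Free Λ L)
      (_ : Module.Finite Λ L) (φ : StarDual Λ L →ₗ[Λ] StarDual Λ (StarDual Λ L))
      (hφ : IsSymm (-eps q) φ) (U : _), (z.add (Preform.hyp q L φ hφ)).IsWeakLagrangian U := by
  obtain ⟨z₀, h₀, U₀, hU₀⟩ := h
  obtain ⟨x, x', ⟨L, _, _, _, _, φ, hφ, ⟨i⟩⟩, ⟨L', _, _, _, _, φ', hφ', ⟨i'⟩⟩, ⟨j⟩⟩ :=
    Quotient.exact h₀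
  have h1 := (hU₀.isWeakLagrangian.add (Preform.isWeakLagrangian_hyp_left L φ hφ)).map
    ((((StrongIso.refl z₀).add i.symm).trans j).trans ((StrongIso.refl z).add i'))
  exact ⟨L', _, _, ‹_›, ‹_›, φ', hφ', _, h1⟩

theorem StrongIso.IsSplit.value_eq_zero {z z' : SplitPreform Λ q}
    {i : StrongIso z.toPreform z'.toPreform} (h : i.IsSplit) {U : Submodule Λ z.G}
    (hU : ∀ u ∈ U, z.theta.value u = 0) :
    ∀ u ∈ U.comap i.zeta.symm.toLinearMap, z'.theta.value u = 0 := fun u hu => by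
  obtain ⟨u, rfl⟩ := i.zeta.surjective u
  rw [Submodule.mem_comap, LinearEquiv.coe_coe, LinearEquiv.symm_apply_apply] at hu
  have h1 := hU u hu
  rw [← h, QForm.value_pullback] at h1
  exact h1

theorem SplitLMonoid.Elementary.exists_isWeakLagrangian {z : SplitPreform Λ q}
    (h : SplitLMonoid.Elementary z.cls) :
    ∃ (L : Type u) (_ : AddCommGroup L) (_ : Module Λ L) (_ : Module.Free Λ L)
      (_ : Module.Finite Λ L) (U : _),
      (z.add (SplitPreform.hyp0 q L)).toPreform.IsWeakLagrangian U ∧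
      ∀ u ∈ U, (z.add (SplitPreform.hyp0 q L)).theta.value u = 0 := by
  obtain ⟨z₀, h₀, U₀, hU₀, hθ⟩ := h
  obtain ⟨x, x', ⟨L, _, _, _, _, i, hi⟩, ⟨L', _, _, _, _, i', hi'⟩, ⟨j, hj⟩⟩ :=
    Quotient.exact h₀
  have hk := ((StrongIso.IsSplit.add (StrongIso.IsSplit.refl (z := z₀)) hi.symm).trans hj).trans
    (StrongIso.IsSplit.add (StrongIso.IsSplit.refl (z := z)) hi')
  have h1 := (hU₀.isWeakLagrangian.add
    (Preform.isWeakLagrangian_hyp_left (q := q) L 0 (isSymm_zero _))).map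
    ((((StrongIso.refl z₀.toPreform).add i.symm).trans j).trans
      ((StrongIso.refl z.toPreform).add i'))
  refine ⟨L', _, _, ‹_›, ‹_›, _, h1, hk.value_eq_zero fun u hu => ?_⟩
  change (QForm.pullback _ z₀.theta + QForm.pullback _ (SplitPreform.hyp0 q L).theta).value u = 0
  rw [QForm.value_add, QForm.value_pullback, QForm.value_pullback]
  have h2 : u.2.2 = 0 := hu.2.2
  have h3 : (SplitPreform.hyp0 (Λ := Λ) q L).theta.value u.2 =
    QuotientAddGroup.mk (u.2.2 u.2.1 + 0) := rfl
  have h4 : z₀.theta.value u.1 = 0 := hθ _ hu.1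
  refine (congrArg₂ (· + ·) h4 h3).trans ?_
  rw [h2, StarDual.zero_apply, add_zero, zero_add, QuotientAddGroup.mk_zero]

theorem LMonoid.Elementary.nonempty_isometry {z : Preform Λ q} (h : LMonoid.Elementary z.cls)
    (hz : z.IsS S) : Nonempty ((z.linkMu hz).Isometry (z.linkGamma hz)) := by
  obtain ⟨L, _, _, _, _, φ, hφ, U, hU⟩ := h.exists_isWeakLagrangian
  have := hyp_cokerMu_subsingleton L φ hφ
  have := hyp_cokerGamma_subsingleton L φ hφ
  have hw := Preform.IsS.hyp (S := S) L φ hφ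
  obtain ⟨m⟩ := hU.nonempty_isometry (hz.add hw)
  obtain ⟨l, -⟩ := exists_cancel_isometry hz hw m
  exact ⟨l⟩

/-- By additivity the signature of `z ⊕ w` is the sum of those of `z` and `w`, and two of the three
vanish. This route is taken because for `φ ≠ 0` the boundary of `H^{-ε}(L, φ)` is not among the
stabilizing objects of the linking monoid. -/
theorem sig_eq_zero_of_isWeakLagrangian {z w : Preform Λ q} (hz : z.IsS S) (hw : w.IsS S)
    {U : Submodule Λ (z.add w).G} (hU : (z.add w).IsWeakLagrangian U) {U' : Submodule Λ w.G}
    (hU' : w.IsWeakLagrangian U') (l : (z.linkMu hz).Isometry (z.linkGamma hz)) :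
    LinkMonoid.sig S q (LinkMonoid.mk z hz l) = 0 := by
  obtain ⟨m⟩ := hU'.nonempty_isometry hw
  have h1 : LinkMonoid.mk (z.add w) (hz.add hw) (sumIsometry l m) =
    LinkMonoid.mk z hz l + LinkMonoid.mk w hw m := rfl
  have h2 := hU.sig_eq_zero (hz.add hw) (sumIsometry l m)
  rwa [h1, map_add, hU'.sig_eq_zero hw m, add_zero] at h2

theorem LMonoid.Elementary.sig_eq_zero {z : Preform Λ q} (h : LMonoid.Elementary z.cls)
    (hz : z.IsS S) (l : (z.linkMu hz).Isometry (z.linkGamma hz)) :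
    LinkMonoid.sig S q (LinkMonoid.mk z hz l) = 0 := by
  obtain ⟨L, _, _, _, _, φ, hφ, U, hU⟩ := h.exists_isWeakLagrangian
  exact sig_eq_zero_of_isWeakLagrangian hz (Preform.IsS.hyp L φ hφ) hU
    (Preform.isWeakLagrangian_hyp_left L φ hφ) l

theorem SplitLMonoid.Elementary.nonempty_isometry {z : SplitPreform Λ q}
    (h : SplitLMonoid.Elementary z.cls) (hz : z.IsS S) :
    Nonempty ((z.linkMu hz).Isometry (z.linkGamma hz)) := by
  obtain ⟨L, _, _, _, _, U, hU, hθ⟩ := h.exists_isWeakLagrangian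
  have := hyp_cokerMu_subsingleton (Λ := Λ) (q := q) L 0 (isSymm_zero _)
  have := hyp_cokerGamma_subsingleton (Λ := Λ) (q := q) L 0 (isSymm_zero _)
  have hw : (SplitPreform.hyp0 (Λ := Λ) q L).IsS S := Preform.IsS.hyp L 0 (isSymm_zero _)
  obtain ⟨m⟩ := SplitPreform.nonempty_isometry hU hθ (hz.add hw)
  exact nonempty_cancel_splitIsometry (w := SplitPreform.hyp0 q L) hz hw m

theorem SplitLMonoid.Elementary.sig_eq_zero {z : SplitPreform Λ q}
    (h : SplitLMonoid.Elementary z.cls) (hz : z.IsS S)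
    (l : (z.toPreform.linkMu hz).Isometry (z.toPreform.linkGamma hz)) :
    LinkMonoid.sig S q (LinkMonoid.mk z.toPreform hz l) = 0 := by
  obtain ⟨L, _, _, _, _, U, hU, -⟩ := h.exists_isWeakLagrangian
  exact sig_eq_zero_of_isWeakLagrangian hz (Preform.IsS.hyp L 0 (isSymm_zero _)) hU
    (Preform.isWeakLagrangian_hyp_left L 0 (isSymm_zero _)) l

end Elementary

end Kreck

/-! ### The theorem -/

theorem mainTheorem6 {Λ : Type u} [Ring Λ] [StarRing Λ] (hΛ : WeaklyFinite Λ)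
    (S : Submonoid Λ) [IsCentralMul S] (q : ℕ) :
    -- flip-isomorphisms inducing the same isometry have the same asymmetric signature
    (∀ (z : Preform Λ q) (hz : z.IsS S) (t t' : Flip z),
      t.isometry hz = t'.isometry hz → t.asymSig = t'.asymSig) ∧
    (∀ (z : SplitPreform Λ q) (hz : z.IsS S) (t t' : SplitFlip z),
      t.isometry hz = t'.isometry hz → t.asymSig = t'.asymSig) ∧
    -- `L` is onto in the non-split case
    Function.Surjective (FlipMonoid.L S q) ∧
    -- the lift of the asymmetric signature in the non-split case
    ∃ σ : LinkMonoid S q →+ LAsy0 Λ,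
      σ.comp (FlipMonoid.L S q) = FlipMonoid.sig S q ∧
      (∀ σ' : LinkMonoid S q →+ LAsy0 Λ,
        σ'.comp (FlipMonoid.L S q) = FlipMonoid.sig S q → σ' = σ) ∧
      (∀ (z : Preform Λ q) (hz : z.IsS S), LMonoid.Elementary z.cls →
        Nonempty ((z.linkMu hz).Isometry (z.linkGamma hz)) ∧
        ∀ l : (z.linkMu hz).Isometry (z.linkGamma hz), σ (LinkMonoid.mk z hz l) = 0) ∧
      -- the lift of the asymmetric signature in the split case
      ∃ τ : SplitLinkMonoid S q →+ LAsy0 Λ,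
        τ = σ.comp (SplitLinkMonoid.forget S q) ∧
        τ.comp (SplitFlipMonoid.L S q) = SplitFlipMonoid.sig S q ∧
        ∀ (z : SplitPreform Λ q) (hz : z.IsS S), SplitLMonoid.Elementary z.cls →
          Nonempty ((z.linkMu hz).Isometry (z.linkGamma hz)) ∧
          ∀ l : (z.linkMu hz).Isometry (z.linkGamma hz), τ (SplitLinkMonoid.mk z hz l) = 0 := by
  refine ⟨fun z hz t t' h => t.asymSig_eq t' hz (congrArg (fun l => l.toLinearEquiv) h),
    fun z hz t t' h => t.toFlip.asymSig_eq t'.toFlip hz (congrArg (fun l => l.toLinearEquiv) h),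
    FlipMonoid.L_surjective, LinkMonoid.sig S q, AddMonoidHom.ext LinkMonoid.sig_L,
    fun σ' h => ?_, fun z hz h => ⟨h.nonempty_isometry hz, h.sig_eq_zero hz⟩,
    (LinkMonoid.sig S q).comp (SplitLinkMonoid.forget S q), rfl, AddMonoidHom.ext ?_,
    fun z hz h => ⟨h.nonempty_isometry hz, fun l => h.sig_eq_zero hz l.toIsometry⟩⟩
  -- Uniqueness is the surjectivity of `L`.
  · refine AddMonoidHom.ext fun x => ?_
    obtain ⟨y, rfl⟩ := FlipMonoid.L_surjective x
    rw [LinkMonoid.sig_L, ← h]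
    rfl
  -- Forgetting quadratic refinements commutes with `L` and with `σ^*`, so the split identity is the
  -- non-split one for the underlying pair.
  · rintro ⟨z, hz, t⟩
    exact LinkMonoid.sig_L (FlipMonoid.mk z.toPreform hz t.toFlip)
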